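/- Let $p$ be a prime, $K$ a finite extension of $\mathbb{Q}_p$, and $o$ its ring of integers. For a profinite group $H$ let $o[[H]] = \varprojlim o[H/H']$ (limit over all open normal subgroups $H'$ of $H$) and $K[[H]] = K \otimes_o o[[H]]$. Let $B \subseteq GL_2(\mathbb{Z}_p)$ be the Iwahori subgroup of all matrices that are lower triangular modulo $p$, and let $P$, $P^-$ and $T$ be the subgroups of lower triangular, upper triangular and diagonal matrices in $B$. Let $\chi : T \to o^\times$ be a continuous character. It extends uniquely to a continuous homomorphism of $K$-algebras $\chi : K[[T]] \to K$. Let $K^{(\chi)}$ denote the one dimensional $K[[P]]$-module given by the composite $K[[P]] \to K[[T]] \xrightarrow{\chi} K$ induced by the projection $P \to T$ onto the diagonal part, and likewise the one dimensional $K[[P^-]]$-module given by $P^- \to T$. Put $$N_\chi := K[[B]] \otimes_{K[[P]]} K^{(\chi)}, \qquad N_\chi^- := K[[B]] \otimes_{K[[P^-]]} K^{(\chi)}.$$ There is a unique $c(\chi) \in K$ such that $$\chi\begin{pmatrix} a^{-1} & 0 \\ 0 & a \end{pmatrix} = \exp(c(\chi)\log(a))$$ for all $a \in \mathbb{Z}_p^\times$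 sufficiently close to $1$. With $\mathbb{N}_0 = \{0, 1, 2, \dots\}$ the following hold. 1. If $c(\chi) \notin \mathbb{N}_0$, then $N_\chi$ is a simple $K[[B]]$-module. 2. If $c(\chi) \notin -\mathbb{N}_0$, then $N_\chi^-$ is a simple $K[[B]]$-module. -/

import Mathlib

open scoped TensorProduct Topology

noncomputable section

/-! ### The base field and its ring of integers -/

/-- The ring of integers `o = {x ∈ K : |x| ≤ 1}` of a nonarchimedean normed field `K`. -/
abbrev RingOfIntegersOf (K : Type*) [NormedField K] [IsUltrametricDist K] : Subring K :=
  (NormedField.valuation (K := K)).integer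

/-! ### Completed group rings -/

/-- The transition map `R[G/H] → R[G/H']` for open normal subgroups `H ≤ H'`. -/
def groupRingTransition (R : Type*) [CommRing R] {G : Type*} [Group G] [TopologicalSpace G]
    {H H' : OpenNormalSubgroup G} (h : H ≤ H') :
    MonoidAlgebra R (G ⧸ H.toSubgroup) →ₐ[R] MonoidAlgebra R (G ⧸ H'.toSubgroup) :=
  MonoidAlgebra.mapDomainAlgHom R R
    (QuotientGroup.map H.toSubgroup H'.toSubgroup (MonoidHom.id G) h)

/-- The completed group ring `R[[G]] = lim R[G/H]`, the limit being taken over all open normal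
subgroups `H` of `G`, realised as the algebra of all compatible families. -/
def CompletedGroupRing (R : Type*) [CommRing R] (G : Type*) [Group G] [TopologicalSpace G] :
    Subalgebra R (∀ H : OpenNormalSubgroup G, MonoidAlgebra R (G ⧸ H.toSubgroup)) where
  carrier := {x | ∀ (H H' : OpenNormalSubgroup G) (h : H ≤ H'),
    groupRingTransition R h (x H) = x H'}
  mul_mem' hx hy H H' h := by simp [hx H H' h, hy H H' h]
  add_mem' hx hy H H' h := by simp [hx H H' h, hy H H' h]
  algebraMap_mem' r H H' h := by
    rw [Pi.algebraMap_apply, Pi.algebraMap_apply, AlgHom.commutes]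

namespace CompletedGroupRing

/-- The canonical map `G → R[[G]]`. -/
def of (R : Type*) [CommRing R] {G : Type*} [Group G] [TopologicalSpace G] (g : G) :
    CompletedGroupRing R G :=
  ⟨fun H ↦ MonoidAlgebra.of R (G ⧸ H.toSubgroup) (QuotientGroup.mk g), fun H H' h ↦ by
    simp only [groupRingTransition, MonoidAlgebra.of_apply, MonoidAlgebra.mapDomainAlgHom_apply,
      MonoidAlgebra.mapDomain_single]
    rfl⟩

/-- The preimage of an open normal subgroup under a continuous homomorphism. -/
def comapOpenNormal {G G' : Type*} [Group G] [TopologicalSpace G] [Group G']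
    [TopologicalSpace G'] (f : G →ₜ* G') (H : OpenNormalSubgroup G') : OpenNormalSubgroup G where
  toSubgroup := H.toSubgroup.comap f.toMonoidHom
  isOpen' := H.isOpen'.preimage f.continuous_toFun
  isNormal' := inferInstance

/-- The map `R[G/f⁻¹(H)] → R[G'/H]` induced by a continuous homomorphism `f : G → G'`. -/
def mapLevel (R : Type*) [CommRing R] {G G' : Type*} [Group G] [TopologicalSpace G] [Group G']
    [TopologicalSpace G'] (f : G →ₜ* G') (H : OpenNormalSubgroup G') :
    MonoidAlgebra R (G ⧸ (comapOpenNormal f H).toSubgroup) →ₐ[R]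
      MonoidAlgebra R (G' ⧸ H.toSubgroup) :=
  MonoidAlgebra.mapDomainAlgHom R R
    (QuotientGroup.map (comapOpenNormal f H).toSubgroup H.toSubgroup f.toMonoidHom le_rfl)

/-- The homomorphism `R[[G]] → R[[G']]` induced by a continuous homomorphism `G → G'`. -/
def map (R : Type*) [CommRing R] {G G' : Type*} [Group G] [TopologicalSpace G] [Group G']
    [TopologicalSpace G'] (f : G →ₜ* G') :
    CompletedGroupRing R G →ₐ[R] CompletedGroupRing R G' :=
  AlgHom.codRestrict
    (AlgHom.pi fun H ↦ (mapLevel R f H).comp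
      ((Pi.evalAlgHom R _ (comapOpenNormal f H)).comp (CompletedGroupRing R G).val))
    (CompletedGroupRing R G') (by
      intro x H H' h
      have hle : comapOpenNormal f H ≤ comapOpenNormal f H' := fun g hg ↦ h hg
      have key : (groupRingTransition R h).comp (mapLevel R f H) =
          (mapLevel R f H').comp (groupRingTransition R hle) := by
        ext g
        obtain ⟨g, rfl⟩ := QuotientGroup.mk_surjective g
        simp [groupRingTransition, mapLevel]
        rfl
      have := DFunLike.congr_fun key (x.1 (comapOpenNormal f H))
      simp only [AlgHom.comp_apply] at this
      simpa [x.2 _ _ hle] using this)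

theorem map_of (R : Type*) [CommRing R] {G G' : Type*} [Group G] [TopologicalSpace G] [Group G']
    [TopologicalSpace G'] (f : G →ₜ* G') (g : G) : map R f (of R g) = of R (f g) := by
  apply Subtype.ext
  funext H
  simp [map, of, mapLevel]

end CompletedGroupRing

/-- `K[[G]] = K ⊗_o o[[G]]`. -/
abbrev IwasawaAlgebra (K : Type*) [NormedField K] [IsUltrametricDist K] (G : Type*) [Group G]
    [TopologicalSpace G] : Type _ :=
  K ⊗[RingOfIntegersOf K] (CompletedGroupRing (RingOfIntegersOf K) G)

/-- The `K`-algebra homomorphism `K[[G]] → K[[G']]` induced by a continuous homomorphism. -/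
def IwasawaAlgebra.map (K : Type*) [NormedField K] [IsUltrametricDist K] {G G' : Type*} [Group G]
    [TopologicalSpace G] [Group G'] [TopologicalSpace G'] (f : G →ₜ* G') :
    IwasawaAlgebra K G →ₐ[K] IwasawaAlgebra K G' :=
  Algebra.TensorProduct.map (AlgHom.id K K) (CompletedGroupRing.map (RingOfIntegersOf K) f)

/-! ### The extension of a continuous character to the Iwasawa algebra -/

/-- The ideal `p · o` of `o`. -/
def pIdeal (p : ℕ) (K : Type*) [NormedField K] [IsUltrametricDist K] :
    Ideal (RingOfIntegersOf K) :=
  Ideal.span {(p : RingOfIntegersOf K)}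

theorem norm_natCast_prime (p : ℕ) [Fact p.Prime] (K : Type*) [NormedField K]
    [NormedAlgebra ℚ_[p] K] : ‖(p : K)‖ = (p : ℝ)⁻¹ := by
  rw [← map_natCast (algebraMap ℚ_[p] K) p, norm_algebraMap', Padic.norm_p]

theorem mem_pIdeal_pow (p : ℕ) [Fact p.Prime] {K : Type*} [NormedField K] [IsUltrametricDist K]
    [NormedAlgebra ℚ_[p] K] (n : ℕ) (x : RingOfIntegersOf K) :
    x ∈ pIdeal p K ^ n ↔ ‖(x : K)‖ ≤ ((p : ℝ)⁻¹) ^ n := by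
  have hp : (0 : ℝ) < (p : ℝ)⁻¹ := inv_pos.mpr (by exact_mod_cast (Fact.out : p.Prime).pos)
  have hn := norm_natCast_prime p K
  have hp0 : (p : K) ≠ 0 := by
    rw [← norm_pos_iff, hn]; exact hp
  rw [pIdeal, Ideal.span_singleton_pow, Ideal.mem_span_singleton]
  constructor
  · rintro ⟨y, rfl⟩
    have hy : ‖(y : K)‖ ≤ 1 := y.2
    simp only [Subring.coe_mul, Subring.coe_pow, Subring.coe_natCast, norm_mul, norm_pow, hn]
    exact mul_le_of_le_one_right (by positivity) hy
  · intro h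
    refine ⟨⟨(x : K) / (p : K) ^ n, ?_⟩, ?_⟩
    · change ‖(x : K) / (p : K) ^ n‖ ≤ 1
      rw [norm_div, norm_pow, hn]
      exact div_le_one_of_le₀ h (by positivity)
    · apply Subtype.ext
      simp only [Subring.coe_mul, Subring.coe_pow, Subring.coe_natCast]
      field_simp

instance isAdicComplete_pIdeal (p : ℕ) [Fact p.Prime] (K : Type*) [NormedField K]
    [IsUltrametricDist K] [NormedAlgebra ℚ_[p] K] [FiniteDimensional ℚ_[p] K] :
    IsAdicComplete (pIdeal p K) (RingOfIntegersOf K) where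
  haus' x hx := by
    apply Subtype.ext
    have h : ∀ n : ℕ, ‖(x : K)‖ ≤ ((p : ℝ)⁻¹) ^ n := fun n ↦ by
      have := hx n
      rw [SModEq.zero, smul_eq_mul, Ideal.mul_top, mem_pIdeal_pow] at this
      exact this
    have hp1 : ((p : ℝ)⁻¹) < 1 := inv_lt_one_of_one_lt₀ (by exact_mod_cast (Fact.out : p.Prime).one_lt)
    have := ge_of_tendsto' (tendsto_pow_atTop_nhds_zero_of_lt_one (by positivity) hp1) h
    simpa using this
  prec' f hf := by
    have : CompleteSpace K := FiniteDimensional.complete ℚ_[p] K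
    have hp1 : ((p : ℝ)⁻¹) < 1 := inv_lt_one_of_one_lt₀ (by exact_mod_cast (Fact.out : p.Prime).one_lt)
    have hdist : ∀ m n, m ≤ n → ‖(f m : K) - f n‖ ≤ ((p : ℝ)⁻¹) ^ m := fun m n hmn ↦ by
      have := hf hmn
      rw [SModEq.sub_mem, smul_eq_mul, Ideal.mul_top, mem_pIdeal_pow] at this
      exact this
    have hc : CauchySeq fun n ↦ (f n : K) :=
      cauchySeq_of_le_tendsto_0' (fun n ↦ ((p : ℝ)⁻¹) ^ n)
        (fun m n hmn ↦ by rw [dist_eq_norm]; exact hdist m n hmn)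
        (tendsto_pow_atTop_nhds_zero_of_lt_one (by positivity) hp1)
    obtain ⟨L, hL⟩ := cauchySeq_tendsto_of_complete hc
    have hL1 : ‖L‖ ≤ 1 := le_of_tendsto' hL.norm fun n ↦ (f n).2
    refine ⟨⟨L, hL1⟩, fun n ↦ ?_⟩
    rw [SModEq.sub_mem, smul_eq_mul, Ideal.mul_top, mem_pIdeal_pow]
    refine le_of_tendsto (hL.const_sub (f n : K)).norm ?_
    filter_upwards [Filter.eventually_ge_atTop n] with m hm using hdist n m hm

section Character

variable (p : ℕ) [Fact p.Prime] {K : Type*} [NormedField K] [IsUltrametricDist K]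
  [NormedAlgebra ℚ_[p] K] {G : Type*} [Group G] [TopologicalSpace G]

/-- The reduction `G → (o/pⁿo)` of a character `χ : G → oˣ`. -/
def reducedCharacter (χ : G →ₜ* (RingOfIntegersOf K)ˣ) (n : ℕ) :
    G →* RingOfIntegersOf K ⧸ pIdeal p K ^ n :=
  ((Ideal.Quotient.mk (pIdeal p K ^ n)).toMonoidHom.comp
    (Units.coeHom (RingOfIntegersOf K))).comp χ.toMonoidHom

/-- The open normal subgroup of all `g` with `χ g ≡ 1 mod pⁿ`. -/
def congruenceKernel (χ : G →ₜ* (RingOfIntegersOf K)ˣ) (n : ℕ) : OpenNormalSubgroup G where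
  toSubgroup := (reducedCharacter p χ n).ker
  isOpen' := by
    have hset : ((reducedCharacter p χ n).ker : Set G) =
        (fun g ↦ ((χ g : RingOfIntegersOf K) : K)) ⁻¹' Metric.closedBall 1 (((p : ℝ)⁻¹) ^ n) := by
      ext g
      rw [Set.mem_preimage, Metric.mem_closedBall, dist_eq_norm, SetLike.mem_coe,
        MonoidHom.mem_ker]
      change Ideal.Quotient.mk (pIdeal p K ^ n) (χ g : RingOfIntegersOf K) = 1 ↔ _
      rw [← map_one (Ideal.Quotient.mk (pIdeal p K ^ n)), Ideal.Quotient.eq, mem_pIdeal_pow]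
      rfl
    change IsOpen ((reducedCharacter p χ n).ker : Set G)
    rw [hset]
    have hp : ((p : ℝ)⁻¹) ^ n ≠ 0 :=
      pow_ne_zero _ (inv_ne_zero (by exact_mod_cast (Fact.out : p.Prime).ne_zero))
    refine (IsUltrametricDist.isOpen_closedBall (1 : K) hp).preimage ?_
    exact continuous_subtype_val.comp (Units.continuous_val.comp χ.continuous_toFun)
  isNormal' := inferInstanceAs (reducedCharacter p χ n).ker.Normal

/-- The `o`-algebra homomorphism `o[G/H] → o/pⁿo` induced by `χ`, where `H` is the open normal
subgroup on which `χ ≡ 1 mod pⁿ`. -/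
def characterLevelFinite (χ : G →ₜ* (RingOfIntegersOf K)ˣ) (n : ℕ) :
    MonoidAlgebra (RingOfIntegersOf K) (G ⧸ (congruenceKernel p χ n).toSubgroup) →ₐ[
      RingOfIntegersOf K] RingOfIntegersOf K ⧸ pIdeal p K ^ n :=
  MonoidAlgebra.lift (RingOfIntegersOf K) (RingOfIntegersOf K ⧸ pIdeal p K ^ n) _
    (QuotientGroup.lift (congruenceKernel p χ n).toSubgroup (reducedCharacter p χ n) fun _ h ↦ h)

/-- The composite `o[[G]] → o[G/H] → o/pⁿo` induced by `χ`. -/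
def characterLevel (χ : G →ₜ* (RingOfIntegersOf K)ˣ) (n : ℕ) :
    CompletedGroupRing (RingOfIntegersOf K) G →ₐ[RingOfIntegersOf K]
      RingOfIntegersOf K ⧸ pIdeal p K ^ n :=
  (characterLevelFinite p χ n).comp
    ((Pi.evalAlgHom (RingOfIntegersOf K) _ (congruenceKernel p χ n)).comp
      (CompletedGroupRing (RingOfIntegersOf K) G).val)

theorem congruenceKernel_anti (χ : G →ₜ* (RingOfIntegersOf K)ˣ) {m n : ℕ} (h : m ≤ n) :
    congruenceKernel p χ n ≤ congruenceKernel p χ m := by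
  intro g hg
  have hg' : Ideal.Quotient.mk (pIdeal p K ^ n) (χ g : RingOfIntegersOf K) = 1 := hg
  change Ideal.Quotient.mk (pIdeal p K ^ m) (χ g : RingOfIntegersOf K) = 1
  rw [← map_one (Ideal.Quotient.mk _), Ideal.Quotient.eq] at hg' ⊢
  exact Ideal.pow_le_pow_right h hg'

theorem characterLevel_compatible (χ : G →ₜ* (RingOfIntegersOf K)ˣ) {m n : ℕ} (h : m ≤ n) :
    (Ideal.Quotient.factorₐ (RingOfIntegersOf K) (Ideal.pow_le_pow_right h)).comp
      (characterLevel p χ n) = characterLevel p χ m := by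
  have key : (Ideal.Quotient.factorₐ (RingOfIntegersOf K)
        (Ideal.pow_le_pow_right (I := pIdeal p K) h)).comp (characterLevelFinite p χ n) =
      (characterLevelFinite p χ m).comp
        (groupRingTransition (RingOfIntegersOf K) (congruenceKernel_anti p χ h)) := by
    ext g
    obtain ⟨g, rfl⟩ := QuotientGroup.mk_surjective g
    simp [groupRingTransition, characterLevelFinite, reducedCharacter]
    rfl
  ext x
  have := DFunLike.congr_fun key (x.1 (congruenceKernel p χ n))
  simp only [AlgHom.comp_apply] at this
  rw [x.2 _ _ (congruenceKernel_anti p χ h)] at this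
  exact this

theorem characterLevel_ringHom_compatible (χ : G →ₜ* (RingOfIntegersOf K)ˣ) {m n : ℕ}
    (h : m ≤ n) :
    (Ideal.Quotient.factorPow (pIdeal p K) h).comp (characterLevel p χ n).toRingHom =
      (characterLevel p χ m).toRingHom :=
  RingHom.ext fun x ↦ DFunLike.congr_fun (characterLevel_compatible p χ h) x

variable [FiniteDimensional ℚ_[p] K]

/-- The extension `o[[G]] → o` of a continuous character `χ : G → oˣ`: the limit of the maps
`o[[G]] → o[G/H] → o/pⁿo`. Since each of them factors through some `o[G/H]`, this is the unique
continuous homomorphism of `o`-algebras that extends `χ`. -/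
def integralCharacterExtension (χ : G →ₜ* (RingOfIntegersOf K)ˣ) :
    CompletedGroupRing (RingOfIntegersOf K) G →ₐ[RingOfIntegersOf K] RingOfIntegersOf K :=
  { IsAdicComplete.liftRingHom (pIdeal p K) (fun n ↦ (characterLevel p χ n).toRingHom)
      (characterLevel_ringHom_compatible p χ) with
    commutes' := fun r ↦ by
      refine (IsHausdorff.eq_iff_smodEq (I := pIdeal p K)).mpr fun n ↦ ?_
      rw [smul_eq_mul, Ideal.mul_top]
      refine (IsAdicComplete.mk_liftRingHom (pIdeal p K)
        (fun n ↦ (characterLevel p χ n).toRingHom)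
        (characterLevel_ringHom_compatible p χ) n (algebraMap _ _ r)).trans ?_
      exact (characterLevel p χ n).commutes r }

theorem mk_integralCharacterExtension (χ : G →ₜ* (RingOfIntegersOf K)ˣ) (n : ℕ)
    (x : CompletedGroupRing (RingOfIntegersOf K) G) :
    Ideal.Quotient.mk (pIdeal p K ^ n) (integralCharacterExtension p χ x) =
      characterLevelFinite p χ n (x.1 (congruenceKernel p χ n)) :=
  IsAdicComplete.mk_liftRingHom (pIdeal p K) (fun n ↦ (characterLevel p χ n).toRingHom)
    (characterLevel_ringHom_compatible p χ) n x

theorem integralCharacterExtension_of (χ : G →ₜ* (RingOfIntegersOf K)ˣ) (g : G) :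
    integralCharacterExtension p χ (CompletedGroupRing.of _ g) = χ g := by
  rw [IsHausdorff.eq_iff_smodEq (I := pIdeal p K)]
  intro n
  rw [smul_eq_mul, Ideal.mul_top]
  change Ideal.Quotient.mk (pIdeal p K ^ n) _ = Ideal.Quotient.mk (pIdeal p K ^ n) _
  rw [mk_integralCharacterExtension]
  simp [characterLevelFinite, CompletedGroupRing.of, reducedCharacter]

/-- The extension `K[[G]] → K` of a continuous character `χ : G → oˣ` to a homomorphism of
`K`-algebras. -/
def characterExtension (χ : G →ₜ* (RingOfIntegersOf K)ˣ) : IwasawaAlgebra K G →ₐ[K] K :=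
  Algebra.TensorProduct.lift (AlgHom.id K K)
    ((IsScalarTower.toAlgHom (RingOfIntegersOf K) (RingOfIntegersOf K) K).comp
      (integralCharacterExtension p χ))
    (fun _ _ ↦ Commute.all _ _)

theorem characterExtension_of (χ : G →ₜ* (RingOfIntegersOf K)ˣ) (a : K) (g : G) :
    characterExtension p χ (a ⊗ₜ CompletedGroupRing.of _ g) =
      a * ((χ g : RingOfIntegersOf K) : K) := by
  simp only [characterExtension, Algebra.TensorProduct.lift_tmul, AlgHom.comp_apply,
    integralCharacterExtension_of]
  rfl

end Character

/-! ### Modules given by characters, and base change along a ring homomorphism -/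

/-- The field `K`, viewed as a left `A`-module through a ring homomorphism `φ : A → K`. -/
def ScalarModule {A K : Type*} [Ring A] [Field K] (_φ : A →+* K) : Type _ := K

instance {A K : Type*} [Ring A] [Field K] (φ : A →+* K) : AddCommGroup (ScalarModule φ) :=
  inferInstanceAs (AddCommGroup K)

instance {A K : Type*} [Ring A] [Field K] (φ : A →+* K) : Module A (ScalarModule φ) :=
  Module.compHom K φ

/-- The relations `(a · f r) ⊗ v = a ⊗ (r • v)` that define `A ⊗_R V` as a quotient of
`A ⊗_ℤ V`. -/
def baseChangeRelations {R A : Type*} [Ring R] [Ring A] (f : R →+* A) (V : Type*)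
    [AddCommGroup V] [Module R V] : Submodule A (A ⊗[ℤ] V) :=
  Submodule.span A {z | ∃ (a : A) (r : R) (v : V),
    z = (a * f r) ⊗ₜ[ℤ] v - a ⊗ₜ[ℤ] (r • v)}

/-- The left `A`-module `A ⊗_R V`, for a homomorphism `f : R → A` of possibly noncommutative
rings and a left `R`-module `V`. The additive group generated by the relations is stable under
left multiplication by `A`. -/
abbrev BaseChangeModule {R A : Type*} [Ring R] [Ring A] (f : R →+* A) (V : Type*)
    [AddCommGroup V] [Module R V] : Type _ :=
  (A ⊗[ℤ] V) ⧸ baseChangeRelations f V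

/-! ### The Iwahori subgroup of `GL₂(ℤ_p)` and its subgroups -/

section Groups

variable (p : ℕ) [Fact p.Prime]

/-- The Iwahori subgroup `B` of all matrices in `GL₂(ℤ_p)` that are lower triangular mod `p`. -/
def iwahori : Subgroup (GL (Fin 2) ℤ_[p]) where
  carrier := {g | (p : ℤ_[p]) ∣ g 0 1}
  mul_mem' {g h} hg hh := by
    change (p : ℤ_[p]) ∣ (g.val * h.val) 0 1
    rw [Matrix.mul_apply, Fin.sum_univ_two]
    exact dvd_add (Dvd.dvd.mul_left hh _) (Dvd.dvd.mul_right hg _)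
  one_mem' := by simp
  inv_mem' {g} hg := by
    change (p : ℤ_[p]) ∣ g⁻¹.val 0 1
    rw [Matrix.coe_units_inv, Matrix.inv_def, Matrix.adjugate_fin_two]
    simp only [Matrix.smul_apply, Matrix.of_apply, Matrix.cons_val', Matrix.cons_val_one, Matrix.cons_val_zero, smul_eq_mul]
    exact Dvd.dvd.mul_left ((dvd_neg).mpr hg) _

/-- The subgroup `P` of lower triangular matrices in `B`. -/
def lowerTriangular : Subgroup (iwahori p) where
  carrier := {g | g.1 0 1 = 0}
  mul_mem' {g h} hg hh := by
    change (g.1.val * h.1.val) 0 1 = 0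
    rw [Matrix.mul_apply, Fin.sum_univ_two]
    rw [show g.1.val 0 1 = 0 from hg, show h.1.val 0 1 = 0 from hh]
    simp
  one_mem' := by simp
  inv_mem' {g} hg := by
    change g.1⁻¹.val 0 1 = 0
    rw [Matrix.coe_units_inv, Matrix.inv_def, Matrix.adjugate_fin_two]
    simp [show g.1.val 0 1 = 0 from hg]

/-- The subgroup `P⁻` of upper triangular matrices in `B`. -/
def upperTriangular : Subgroup (iwahori p) where
  carrier := {g | g.1 1 0 = 0}
  mul_mem' {g h} hg hh := by
    change (g.1.val * h.1.val) 1 0 = 0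
    rw [Matrix.mul_apply, Fin.sum_univ_two]
    rw [show g.1.val 1 0 = 0 from hg, show h.1.val 1 0 = 0 from hh]
    simp
  one_mem' := by simp
  inv_mem' {g} hg := by
    change g.1⁻¹.val 1 0 = 0
    rw [Matrix.coe_units_inv, Matrix.inv_def, Matrix.adjugate_fin_two]
    simp [show g.1.val 1 0 = 0 from hg]

/-- The subgroup `T` of diagonal matrices in `B`. -/
def diagonalTorus : Subgroup (iwahori p) := lowerTriangular p ⊓ upperTriangular p

variable {p}

theorem lowerTriangular_mul_diag (g h : lowerTriangular p) (i : Fin 2) :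
    (g * h).1.1.val i i = g.1.1.val i i * h.1.1.val i i := by
  change (g.1.1.val * h.1.1.val) i i = _
  have hg : g.1.1.val 0 1 = 0 := g.2
  have hh : h.1.1.val 0 1 = 0 := h.2
  fin_cases i <;> simp [Matrix.mul_apply, hg, hh]

theorem upperTriangular_mul_diag (g h : upperTriangular p) (i : Fin 2) :
    (g * h).1.1.val i i = g.1.1.val i i * h.1.1.val i i := by
  change (g.1.1.val * h.1.1.val) i i = _
  have hg : g.1.1.val 1 0 = 0 := g.2
  have hh : h.1.1.val 1 0 = 0 := h.2
  fin_cases i <;> simp [Matrix.mul_apply, hg, hh]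

/-- The continuous homomorphism `(a, d) ↦ diag(a, d)` into `T`. -/
def torusDiag : ℤ_[p]ˣ × ℤ_[p]ˣ →ₜ* diagonalTorus p where
  toFun x := ⟨⟨⟨!![(x.1 : ℤ_[p]), 0; 0, x.2], !![((x.1⁻¹ : ℤ_[p]ˣ) : ℤ_[p]), 0; 0, (x.2⁻¹ : ℤ_[p]ˣ)],
      by simp [Matrix.one_fin_two], by simp [Matrix.one_fin_two]⟩,
      by change (p : ℤ_[p]) ∣ 0; simp⟩, rfl, rfl⟩
  map_one' := by
    apply Subtype.ext; apply Subtype.ext; apply Units.ext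
    simp [Matrix.one_fin_two]
  map_mul' x y := by
    apply Subtype.ext; apply Subtype.ext; apply Units.ext
    simp
  continuous_toFun := by
    refine Continuous.subtype_mk (Continuous.subtype_mk (Units.continuous_iff.mpr ⟨?_, ?_⟩) _) _
    · refine continuous_matrix fun i j ↦ ?_
      fin_cases i <;> fin_cases j <;> simp <;> fun_prop
    · refine continuous_matrix fun i j ↦ ?_
      fin_cases i <;> fin_cases j <;> simp <;> fun_prop

/-- The `i`-th diagonal entry of a lower triangular matrix. -/
def lowerDiagEntry (i : Fin 2) : lowerTriangular p →ₜ* ℤ_[p]ˣ where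
  toFun g := ⟨g.1.1.val i i, (g⁻¹).1.1.val i i,
    by rw [← lowerTriangular_mul_diag]; simp, by rw [← lowerTriangular_mul_diag]; simp⟩
  map_one' := by apply Units.ext; simp
  map_mul' g h := by apply Units.ext; exact lowerTriangular_mul_diag g h i
  continuous_toFun := by
    have h1 : Continuous fun g : lowerTriangular p ↦ g.1.1.val i i :=
      (Units.continuous_val.comp
        (continuous_subtype_val.comp continuous_subtype_val)).matrix_elem i i
    have h2 : Continuous fun g : lowerTriangular p ↦ g.1.1⁻¹.val i i :=
      (Units.continuous_val.comp (continuous_inv.comp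
        (continuous_subtype_val.comp continuous_subtype_val))).matrix_elem i i
    exact Units.continuous_iff.mpr ⟨h1, h2⟩

/-- The `i`-th diagonal entry of an upper triangular matrix. -/
def upperDiagEntry (i : Fin 2) : upperTriangular p →ₜ* ℤ_[p]ˣ where
  toFun g := ⟨g.1.1.val i i, (g⁻¹).1.1.val i i,
    by rw [← upperTriangular_mul_diag]; simp, by rw [← upperTriangular_mul_diag]; simp⟩
  map_one' := by apply Units.ext; simp
  map_mul' g h := by apply Units.ext; exact upperTriangular_mul_diag g h i
  continuous_toFun := by
    have h1 : Continuous fun g : upperTriangular p ↦ g.1.1.val i i :=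
      (Units.continuous_val.comp
        (continuous_subtype_val.comp continuous_subtype_val)).matrix_elem i i
    have h2 : Continuous fun g : upperTriangular p ↦ g.1.1⁻¹.val i i :=
      (Units.continuous_val.comp (continuous_inv.comp
        (continuous_subtype_val.comp continuous_subtype_val))).matrix_elem i i
    exact Units.continuous_iff.mpr ⟨h1, h2⟩

variable (p)

/-- The projection `P → T` onto the diagonal part. -/
def lowerToTorus : lowerTriangular p →ₜ* diagonalTorus p :=
  torusDiag.comp ((lowerDiagEntry 0).prod (lowerDiagEntry 1))

/-- The projection `P⁻ → T` onto the diagonal part. -/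
def upperToTorus : upperTriangular p →ₜ* diagonalTorus p :=
  torusDiag.comp ((upperDiagEntry 0).prod (upperDiagEntry 1))

/-- The inclusion `P → B`. -/
def lowerToIwahori : lowerTriangular p →ₜ* iwahori p where
  toMonoidHom := (lowerTriangular p).subtype
  continuous_toFun := continuous_subtype_val

/-- The inclusion `P⁻ → B`. -/
def upperToIwahori : upperTriangular p →ₜ* iwahori p where
  toMonoidHom := (upperTriangular p).subtype
  continuous_toFun := continuous_subtype_val

end Groups

/-! ### The modules `N_χ`, `N_χ⁻` and the invariant `c(χ)` -/

section Modules

variable {p : ℕ} [Fact p.Prime] {K : Type*} [NormedField K] [IsUltrametricDist K]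
  [NormedAlgebra ℚ_[p] K]

section

variable [FiniteDimensional ℚ_[p] K]

/-- The homomorphism `K[[P]] → K[[T]] → K` attached to `χ`. -/
def lowerCharacter (χ : diagonalTorus p →ₜ* (RingOfIntegersOf K)ˣ) :
    IwasawaAlgebra K (lowerTriangular p) →ₐ[K] K :=
  (characterExtension p χ).comp (IwasawaAlgebra.map K (lowerToTorus p))

/-- The homomorphism `K[[P⁻]] → K[[T]] → K` attached to `χ`. -/
def upperCharacter (χ : diagonalTorus p →ₜ* (RingOfIntegersOf K)ˣ) :
    IwasawaAlgebra K (upperTriangular p) →ₐ[K] K :=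
  (characterExtension p χ).comp (IwasawaAlgebra.map K (upperToTorus p))

/-- `N_χ = K[[B]] ⊗_{K[[P]]} K^(χ)`. -/
abbrev NModule (χ : diagonalTorus p →ₜ* (RingOfIntegersOf K)ˣ) : Type _ :=
  BaseChangeModule (IwasawaAlgebra.map K (lowerToIwahori p)).toRingHom
    (ScalarModule (lowerCharacter χ).toRingHom)

/-- `N_χ⁻ = K[[B]] ⊗_{K[[P⁻]]} K^(χ)`. -/
abbrev NMinusModule (χ : diagonalTorus p →ₜ* (RingOfIntegersOf K)ˣ) : Type _ :=
  BaseChangeModule (IwasawaAlgebra.map K (upperToIwahori p)).toRingHom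
    (ScalarModule (upperCharacter χ).toRingHom)

end

/-- The `p`-adic logarithm `log a = ∑_{n ≥ 0} (-1)ⁿ (a - 1)ⁿ⁺¹ / (n + 1)`, which converges for
`a ∈ 1 + pℤ_p`. -/
def padicLogSeries (a : ℤ_[p]) : ℚ_[p] :=
  ∑' n : ℕ, (-1) ^ n * ((a : ℚ_[p]) - 1) ^ (n + 1) / ((n : ℚ_[p]) + 1)

/-- The exponential series `exp x = ∑_{n ≥ 0} xⁿ / n!`, which converges for `x ∈ K` close
to `0`. -/
def expSeriesSum (x : K) : K :=
  ∑' n : ℕ, x ^ n / (n.factorial : K)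

/-- `c` is the invariant `c(χ)`: `χ(diag(a⁻¹, a)) = exp(c · log a)` for all `a ∈ ℤ_pˣ`
sufficiently close to `1`. -/
def IsCharacterExponent (χ : diagonalTorus p →ₜ* (RingOfIntegersOf K)ˣ) (c : K) : Prop :=
  ∀ᶠ a : ℤ_[p]ˣ in 𝓝 1,
    ((χ (torusDiag (a⁻¹, a)) : RingOfIntegersOf K) : K) =
      expSeriesSum (c * algebraMap ℚ_[p] K (padicLogSeries (a : ℤ_[p])))

end Modules

end

/-! Both modules are cyclic, generated by `v = 1 ⊗ 1`, on which the triangular subgroup acts through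
`χ`. The Iwahori subgroup is the product of an opposite one-parameter unipotent group `α(ℤ_p)` and
that triangular subgroup. Hence every vector is, up to a scalar of `K`, a power series over `o` in
`X = [α(1)] - 1` applied to `v`. As with Weierstrass division in `o[[X]]`, dividing by one nonzero
element leaves only finitely many powers of `X`, so every nonzero submodule has finite codimension
over `K` (`exists_finite_generation`, `finiteDimensional_quotient_of_cyclic`). Compactness of
`o[[B]]` replaces all convergence estimates.

Suppose a nonzero submodule is proper. The quotient is then finite dimensional and the image of `v`
in it is nonzero. Let `A` be the action of `α(1)`. A torus element `t(s)` conjugates `A ^ s` into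
`A`, so the eigenvalues of `A` are roots of unity and some power `A ^ N` is unipotent
(`exists_isNilpotent_pow_sub_one`). Thus `A ^ (N m) v` is a polynomial in `m`, and its coefficient
at `m ^ k` is scaled by `s⁻ᵏ` under the normalised `t(s)`. For `w` in the triangular subgroup, a `2
× 2` matrix identity gives `w α(m) v = ψ(s) α(s⁻¹ m) v` with `s = 1 + p m`, where `ψ` is `a ↦
χ(diag(a⁻¹, a))` for `N_χ` and its inverse for `N_χ⁻`. Projecting both sides to the line of `v`
shows that `ψ(1 + p N m)` is a polynomial in `m`. A multiplicative polynomial function is a power,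
so `ψ(s) = s ^ k` near `1` with `k ∈ ℕ` (`exists_eq_pow_of_intertwining`). This forces `c(χ) = k`,
respectively `c(χ) = -k`, which is excluded by hypothesis.

Two points remain. The induced module is nonzero: a continuous function on `B` that transforms under
the triangular subgroup by `χ` integrates to a functional that does not kill `v`
(`nontrivial_induced`). The number `c(χ)` is the derivative at `1` of `a ↦ exp(c log a)`, hence
unique; it exists because the powers of `1 + p ^ M` are dense in `1 + p ^ M ℤ_p`
(`exists_exponent`). -/

noncomputable section

/-! ### Finite dimensional representations and polynomial characters -/

section IntertwiningRelation

open Polynomial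

variable {K V : Type*} [Field K] [AddCommGroup V] [Module K V]

/-- `A ^ s` is conjugate to `A`, so the minimal polynomial of `A` kills `A ^ s` and therefore
divides its own expansion under `X ↦ X ^ s`. Roots are taken in an extension `L`, since `K` need not
contain the eigenvalues. -/
theorem pow_isRoot_minpoly_of_semiconj [FiniteDimensional K V] {A T : Module.End K V}
    (hT : IsUnit T) {s : ℕ}
    (h : T * A ^ s = A * T) {L : Type*} [Field L] [Algebra K L] {μ : L}
    (hμ : aeval μ (minpoly K A) = 0) : aeval (μ ^ s) (minpoly K A) = 0 := by
  have hsc : ∀ q : K[X], T * aeval (A ^ s) q = aeval A q * T := by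
    intro q
    induction q using Polynomial.induction_on' with
    | add q r hq hr => simp only [map_add, mul_add, add_mul, hq, hr]
    | monomial n a =>
      have hs : SemiconjBy T (A ^ s) A := h
      have := (hs.pow_right n).eq
      simp only [aeval_monomial]
      rw [← mul_assoc, ← Algebra.commutes, mul_assoc, this, mul_assoc]
  have h0 : aeval A (expand K s (minpoly K A)) = 0 := by
    rw [expand_aeval]
    apply hT.mul_left_cancel
    rw [hsc, minpoly.aeval, zero_mul, mul_zero]
  obtain ⟨q, hq⟩ := minpoly.dvd K A h0
  have := congrArg (aeval μ) hq
  rwa [expand_aeval, map_mul, hμ, zero_mul] at this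

theorem aeval_minpoly_ne_zero_of_isUnit [FiniteDimensional K V] {A : Module.End K V}
    (hA : IsUnit A) {L : Type*} [Field L]
    [Algebra K L] : aeval (0 : L) (minpoly K A) ≠ 0 := by
  intro h
  rw [← coeff_zero_eq_aeval_zero', map_eq_zero] at h
  have : (minpoly K A).IsRoot 0 := by rwa [IsRoot, ← coeff_zero_eq_eval_zero]
  have h1 := Module.End.hasEigenvalue_of_isRoot this
  obtain ⟨v, hv⟩ := h1.exists_hasEigenvector
  have h2 : A v = 0 := by simpa using hv.apply_eq_smul
  exact hv.2 (((Module.End.isUnit_iff A).1 hA).1 (by simpa using h2))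

/-- If an automorphism `A` of a finite dimensional space is conjugate to its power `A ^ s` with
`s ≥ 2`, then some power of `A` is unipotent. -/
theorem exists_isNilpotent_pow_sub_one [FiniteDimensional K V] {A T : Module.End K V}
    (hA : IsUnit A) (hT : IsUnit T)
    {s : ℕ} (hs : 2 ≤ s) (h : T * A ^ s = A * T) :
    ∃ N : ℕ, 0 < N ∧ IsNilpotent (A ^ N - 1) := by
  classical
  let L := AlgebraicClosure K
  have hm : minpoly K A ≠ 0 := minpoly.ne_zero (Algebra.IsIntegral.isIntegral A)
  let S := (minpoly K A).aroots L
  have hS : ∀ μ, μ ∈ S ↔ aeval μ (minpoly K A) = 0 := fun μ ↦ by simp [S, hm]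
  have hroot : ∀ μ ∈ S, ∃ n, 0 < n ∧ μ ^ n = 1 := by
    intro μ hμ
    -- The orbit of `μ` under `μ ↦ μ ^ s` stays in the finite set of roots. Two of the strictly
    -- increasing exponents `s ^ i` then give the same value, which makes the nonzero `μ` a root of
    -- unity.
    have hmem : ∀ i : ℕ, μ ^ s ^ i ∈ S := by
      intro i
      induction i with
      | zero => simpa using hμ
      | succ i ih =>
        rw [pow_succ, pow_mul]
        exact (hS _).2 (pow_isRoot_minpoly_of_semiconj hT h ((hS _).1 ih))
    have hfin : ((S.toFinset : Finset L) : Set L).Finite := Finset.finite_toSet _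
    obtain ⟨i, -, j, -, hij, heq⟩ := Set.infinite_univ.exists_ne_map_eq_of_mapsTo
      (f := fun i : ℕ ↦ μ ^ s ^ i) (fun i _ ↦ by simpa using hmem i) hfin
    have h0 : μ ≠ 0 := by
      rintro rfl
      exact aeval_minpoly_ne_zero_of_isUnit hA ((hS 0).1 hμ)
    have key : ∀ i j : ℕ, i < j → μ ^ s ^ i = μ ^ s ^ j → ∃ n, 0 < n ∧ μ ^ n = 1 := by
      intro i j hij heq
      have hlt : s ^ i < s ^ j := Nat.pow_lt_pow_right (by omega) hij
      refine ⟨s ^ j - s ^ i, by omega, ?_⟩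
      rw [pow_sub₀ _ h0 hlt.le, ← heq, mul_inv_cancel₀ (pow_ne_zero _ h0)]
    rcases lt_or_gt_of_ne hij with hlt | hlt
    · exact key i j hlt heq
    · exact key j i hlt heq.symm
  choose! n hn hn1 using hroot
  refine ⟨∏ μ ∈ S.toFinset, n μ, Finset.prod_pos fun μ hμ ↦ hn μ (by simpa using hμ), ?_⟩
  set N := ∏ μ ∈ S.toFinset, n μ with hN
  have hSN : ∀ μ ∈ S, μ ^ N = 1 := fun μ hμ ↦ by
    obtain ⟨c, hc⟩ := Finset.dvd_prod_of_mem n (Multiset.mem_toFinset.2 hμ)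
    rw [hN, hc, pow_mul, hn1 μ hμ, one_pow]
  -- Over `L` the minimal polynomial is a product of `S.card` linear factors, each dividing `X ^ N -
  -- 1`. Divisibility by it descends from `L` to `K`.
  have hdvd : (minpoly K A).map (algebraMap K L) ∣
      ((X ^ N - 1 : K[X]) ^ S.card).map (algebraMap K L) := by
    rw [(IsAlgClosed.splits ((minpoly K A).map (algebraMap K L))).eq_prod_roots_of_monic
      ((minpoly.monic (Algebra.IsIntegral.isIntegral A)).map _)]
    have : ((X ^ N - 1 : K[X]) ^ S.card).map (algebraMap K L) =
        (S.map fun _ ↦ (X ^ N - 1 : L[X])).prod := by simp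
    rw [this]
    refine Multiset.prod_dvd_prod_of_dvd _ _ fun μ hμ ↦ ?_
    rw [dvd_iff_isRoot]
    simp [hSN μ hμ]
  rw [map_dvd_map'] at hdvd
  obtain ⟨q, hq⟩ := hdvd
  refine ⟨S.card, ?_⟩
  have := congrArg (aeval A) hq
  simpa [minpoly.aeval] using this

/-! ### Functions that are polynomial in an exponent. -/

theorem exists_polynomial_eval_eq_choose (K : Type*) [Field K] [CharZero K] (j : ℕ) :
    ∃ q : K[X], ∀ m : ℕ, q.eval (m : K) = m.choose j := by
  refine ⟨C ((j.factorial : K)⁻¹) * descPochhammer K j, fun m ↦ ?_⟩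
  have hj : (j.factorial : K) ≠ 0 := by exact_mod_cast j.factorial_ne_zero
  rw [eval_mul, eval_C, descPochhammer_eval_eq_descFactorial,
      Nat.descFactorial_eq_factorial_mul_choose]
  push_cast
  field_simp

/-- The powers of a unipotent operator depend polynomially on the exponent. -/
theorem exists_pow_apply_eq_sum [CharZero K] {U : Module.End K V} (hU : IsNilpotent (U - 1))
    (v : V) : ∃ (d : ℕ) (e : ℕ → V), ∀ m : ℕ, (U ^ m) v = ∑ k ∈ Finset.range d, (m : K) ^ k • e k
        := by
  obtain ⟨r, hr⟩ := hU
  choose q hq using exists_polynomial_eval_eq_choose K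
  obtain ⟨d, hd⟩ : ∃ d, ∀ j ∈ Finset.range r, (q j).natDegree < d := by
    refine ⟨(Finset.range r).sup (fun j ↦ (q j).natDegree) + 1, fun j hj ↦ ?_⟩
    exact Nat.lt_succ_of_le (Finset.le_sup (f := fun j ↦ (q j).natDegree) hj)
  refine ⟨d, fun k ↦ ∑ j ∈ Finset.range r, (q j).coeff k • ((U - 1) ^ j) v, fun m ↦ ?_⟩
  -- The binomial expansion of `(1 + (U - 1)) ^ m` stops below `r` by nilpotency and at `m` by
  -- vanishing binomials. Both ranges are enlarged to their maximum to be compared.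
  have h1 : U ^ m = ∑ j ∈ Finset.range r, (m.choose j : K) • (U - 1) ^ j := by
    have h2 : U ^ m = ∑ j ∈ Finset.range (m + 1), (m.choose j : K) • (U - 1) ^ j := by
      conv_lhs => rw [← sub_add_cancel U 1, (Commute.one_right (U - 1)).add_pow]
      refine Finset.sum_congr rfl fun j _ ↦ ?_
      rw [one_pow, mul_one, Nat.cast_smul_eq_nsmul, nsmul_eq_mul, Nat.cast_comm]
    have h3 : ∀ n, r ≤ n → m + 1 ≤ n → U ^ m = ∑ j ∈ Finset.range n, (m.choose j : K) • (U - 1) ^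
        j ∧
        ∑ j ∈ Finset.range r, (m.choose j : K) • (U - 1) ^ j =
          ∑ j ∈ Finset.range n, (m.choose j : K) • (U - 1) ^ j := by
      intro n hrn hmn
      constructor
      · rw [h2]
        refine Finset.sum_subset (Finset.range_mono hmn) fun j _ hj ↦ ?_
        rw [Finset.mem_range, not_lt] at hj
        rw [Nat.choose_eq_zero_of_lt hj, Nat.cast_zero, zero_smul]
      · refine Finset.sum_subset (Finset.range_mono hrn) fun j _ hj ↦ ?_
        rw [Finset.mem_range, not_lt] at hj
        rw [pow_eq_zero_of_le hj hr, smul_zero]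
    obtain ⟨h4, h5⟩ := h3 _ (le_max_left r (m + 1)) (le_max_right r (m + 1))
    rw [h4, h5]
  rw [h1, LinearMap.sum_apply]
  simp only [LinearMap.smul_apply, Finset.smul_sum]
  rw [Finset.sum_comm]
  refine Finset.sum_congr rfl fun j hj ↦ ?_
  rw [← hq, eval_eq_sum_range' (hd j hj), Finset.sum_smul]
  exact Finset.sum_congr rfl fun k _ ↦ by rw [smul_smul, mul_comm]

/-- A linear functional turns the difference of the two sides into a scalar polynomial that vanishes
at all natural numbers, which are infinitely many points in characteristic zero. Functionals
separate vectors. -/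
theorem eq_of_forall_sum_pow_smul_eq [CharZero K] {d : ℕ} {e e' : ℕ → V}
    (h : ∀ m : ℕ, ∑ k ∈ Finset.range d, (m : K) ^ k • e k =
      ∑ k ∈ Finset.range d, (m : K) ^ k • e' k) {k : ℕ} (hk : k < d) : e k = e' k := by
  rw [← sub_eq_zero, ← Module.forall_dual_apply_eq_zero_iff K]
  intro φ
  let P : K[X] := ∑ k ∈ Finset.range d, C (φ (e k - e' k)) * X ^ k
  have hP : P = 0 := by
    refine eq_zero_of_infinite_isRoot P ((Set.infinite_range_of_injective
      (Nat.cast_injective (R := K))).mono ?_)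
    rintro _ ⟨m, rfl⟩
    have := congrArg φ (sub_eq_zero.2 (h m))
    rw [← Finset.sum_sub_distrib, map_sum, map_zero] at this
    simp only [Set.mem_ofPred_eq, IsRoot, P, eval_finsetSum, eval_mul, eval_C, eval_pow, eval_X]
    rw [← this]
    refine Finset.sum_congr rfl fun k _ ↦ ?_
    rw [← smul_sub, map_smul, smul_eq_mul, mul_comm]
  have := congrArg (fun Q ↦ coeff Q k) hP
  simpa only [P, finsetSum_coeff, coeff_C_mul_X_pow, Finset.sum_ite_eq, Finset.mem_range, hk,
    if_true, coeff_zero] using this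

/-- A multiplicative function on `1 + rℕ` that is given by a polynomial is a power function. -/
theorem exists_eq_pow_of_polynomial {K : Type*} [Field K] [CharZero K] {ψ : ℕ → K} {r : ℕ}
    (hr : 0 < r) (h1 : ψ 1 = 1)
    (hmul : ∀ m n, ψ ((1 + r * m) * (1 + r * n)) = ψ (1 + r * m) * ψ (1 + r * n)) {P : K[X]}
    (hP : ∀ m : ℕ, P.eval (m : K) = ψ (1 + r * m)) :
    ∃ k : ℕ, ∀ m : ℕ, ψ (1 + r * m) = ((1 + r * m : ℕ) : K) ^ k := by
  have hr0 : (r : K) ≠ 0 := by exact_mod_cast hr.ne'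
  let R : K[X] := P.comp (C ((r : K)⁻¹) * (X - 1))
  have hR : ∀ m : ℕ, R.eval ((1 + r * m : ℕ) : K) = ψ (1 + r * m) := fun m ↦ by
    rw [← hP, eval_comp]
    congr 1
    simp [hr0]
  have hR0 : R ≠ 0 := by
    intro h0
    have := hR 0
    simp [h0, h1] at this
  refine ⟨R.natDegree, fun m ↦ ?_⟩
  -- `R` is `P` rescaled so that `R(s) = ψ(s)` for `s ∈ 1 + rℕ`. Multiplicativity becomes `ψ(s) R(X)
  -- = R(s X)`, and comparison of leading coefficients gives `ψ(s) = s ^ deg R`.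
  have heq : C (ψ (1 + r * m)) * R = R.comp (C ((1 + r * m : ℕ) : K) * X) := by
    refine eq_of_infinite_eval_eq _ _ ((Set.infinite_range_of_injective
      (f := fun n : ℕ ↦ ((1 + r * n : ℕ) : K)) fun a b hab ↦ ?_).mono ?_)
    · simpa [hr0, hr.ne'] using hab
    · rintro _ ⟨n, rfl⟩
      simp only [Set.mem_ofPred_eq, eval_mul, eval_C, eval_comp, eval_X]
      rw [hR, ← hmul, ← Nat.cast_mul]
      have : (1 + r * m) * (1 + r * n) = 1 + r * (m + n + r * m * n) := by ring
      rw [this, hR]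
  have h2 := congrArg (fun Q ↦ coeff Q R.natDegree) heq
  simp only [coeff_C_mul, comp_C_mul_X_coeff] at h2
  rw [mul_comm] at h2
  exact mul_left_cancel₀ (leadingCoeff_ne_zero.2 hR0) h2

/-- Let `A`, `b` and `t s` be operators on a finite dimensional space, with `t s` conjugating
`A ^ s` into `A`, and let `v` be a nonzero vector fixed by all `t s` such that
`b A ^ m v = ψ (1 + p m) t (1 + p m) A ^ m v`. If `ψ` is multiplicative, then it is given by a
power function with a natural exponent on `1 + pNℕ` for some `N > 0`. -/
theorem exists_eq_pow_of_intertwining [CharZero K] [FiniteDimensional K V] {p : ℕ} (hp : 0 < p)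
    {A b : Module.End K V}
    {t : ℕ → Module.End K V} {ψ : ℕ → K} {v : V} (hv : v ≠ 0) (hA : IsUnit A)
    (ht : ∀ m, IsUnit (t (1 + p * m))) (htv : ∀ m, t (1 + p * m) v = v)
    (hconj : ∀ m, t (1 + p * m) * A ^ (1 + p * m) = A * t (1 + p * m))
    (hb : ∀ m, b ((A ^ m) v) = ψ (1 + p * m) • t (1 + p * m) ((A ^ m) v)) (h1 : ψ 1 = 1)
    (hmul : ∀ m n, ψ ((1 + p * m) * (1 + p * n)) = ψ (1 + p * m) * ψ (1 + p * n)) :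
    ∃ N k : ℕ, 0 < N ∧ ∀ m : ℕ, ψ (1 + p * N * m) = ((1 + p * N * m : ℕ) : K) ^ k := by
  obtain ⟨N, hN, hnil⟩ := exists_isNilpotent_pow_sub_one hA (ht 1) (s := 1 + p * 1) (by omega)
    (hconj 1)
  obtain ⟨d, e, he⟩ := exists_pow_apply_eq_sum hnil v
  -- Each `e k` is an eigenvector (or zero) of every `t s` with eigenvalue `s⁻ᵏ`. This results from
  -- `t s (A ^ N) ^ (s j) v = (A ^ N) ^ j v` by comparing coefficients of `j ^ k`.
  have hte : ∀ m k, k < d → ((1 + p * m : ℕ) : K) ^ k • t (1 + p * m) (e k) = e k := by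
    intro m k hk
    set s := 1 + p * m with hs
    have := eq_of_forall_sum_pow_smul_eq (K := K) (d := d)
      (e := fun k ↦ (s : K) ^ k • t s (e k)) (e' := e) (fun j ↦ ?_) hk
    · exact this
    rw [← he j]
    have h2 := he (s * j)
    have h3 : t s (((A ^ N) ^ (s * j)) v) = ((A ^ N) ^ j) v := by
      have hsc : SemiconjBy (t s) (A ^ s) A := hconj m
      have := (hsc.pow_right (N * j)).eq
      rw [← pow_mul A s] at this
      rw [← pow_mul, ← pow_mul, mul_left_comm, ← Module.End.mul_apply, this,
        Module.End.mul_apply, htv]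
    rw [← h3, h2, map_sum]
    refine Finset.sum_congr rfl fun k _ ↦ ?_
    rw [map_smul, smul_smul, ← mul_pow, Nat.cast_mul, mul_comm]
  have he0 : 0 < d ∧ e 0 = v := by
    have := he 0
    rcases Nat.eq_zero_or_pos d with rfl | hd
    · simp at this
      exact absurd this hv
    · refine ⟨hd, ?_⟩
      rw [Finset.sum_eq_single_of_mem 0 (by simpa using hd)] at this
      · simpa using this.symm
      · intro k _ hk
        simp [hk]
  obtain ⟨hd, he0⟩ := he0
  set s : K := ((1 + p * 1 : ℕ) : K) with hs
  have hs0 : s ≠ 0 := by rw [hs]; exact_mod_cast (by omega)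
  -- The operator `R = q(t (1 + p))` is, up to the factor `q(1)`, the projection of the span of the
  -- `e k` onto the line of `e 0 = v`. The factor is nonzero because `(1 + p) ^ k ≠ 1` for `k ≥ 1`.
  let q : K[X] := ∏ k ∈ Finset.Ico 1 d, (X - C ((s ^ k)⁻¹))
  let R : Module.End K V := aeval (t (1 + p * 1)) q
  have heig : ∀ k < d, t (1 + p * 1) (e k) = (s ^ k)⁻¹ • e k := fun k hk ↦ by
    conv_rhs => rw [← hte 1 k hk, inv_smul_smul₀ (pow_ne_zero _ hs0)]
  have hRe : ∀ k < d, R (e k) = q.eval ((s ^ k)⁻¹) • e k := fun k hk ↦ by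
    by_cases h0 : e k = 0
    · simp [h0]
    · exact Module.End.aeval_apply_of_hasEigenvector
        ⟨Module.End.mem_eigenspace_iff.2 (heig k hk), h0⟩
  have hRk : ∀ k < d, k ≠ 0 → R (e k) = 0 := fun k hk hk0 ↦ by
    rw [hRe k hk]
    simp only [q, eval_prod]
    rw [Finset.prod_eq_zero (i := k) (by simp; omega) (by simp), zero_smul]
  have hR0 : R v = q.eval 1 • v := by
    have := hRe 0 hd
    rwa [he0, pow_zero, inv_one] at this
  have hq0 : q.eval 1 ≠ 0 := by
    simp only [q, eval_prod]
    refine Finset.prod_ne_zero_iff.2 fun k hk ↦ ?_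
    simp only [eval_sub, eval_X, eval_C]
    rw [sub_ne_zero]
    intro h
    have h3 : s ^ k = 1 := by rw [← inv_inv (s ^ k), ← h, inv_one]
    rw [hs] at h3
    have h4 : (1 + p * 1) ^ k = 1 := by exact_mod_cast h3
    have : k ≠ 0 := by simp at hk; omega
    have := Nat.one_lt_pow this (show 1 < 1 + p * 1 by omega)
    omega
  obtain ⟨φ, hφ⟩ := Module.Projective.exists_dual_ne_zero K hv
  -- The functional `φ ∘ R` is applied to the intertwining relation for `A ^ (N m) v`. On the right
  -- only the `v` component survives and gives `ψ(1 + p N m) q(1) φ(v)`; the left is visibly a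
  -- polynomial in `m`.
  let P : K[X] := ∑ k ∈ Finset.range d,
    C (φ (R (b (e k))) * (φ v)⁻¹ * (q.eval 1)⁻¹) * X ^ k
  have hP : ∀ m : ℕ, P.eval (m : K) = ψ (1 + p * N * m) := by
    intro m
    have h2 := hb (N * m)
    rw [pow_mul, he m] at h2
    have h3 := congrArg (fun x ↦ φ (R x)) h2
    have h4 : R (t (1 + p * (N * m)) (∑ k ∈ Finset.range d, (m : K) ^ k • e k)) =
        q.eval 1 • v := by
      rw [map_sum, map_sum, Finset.sum_eq_single_of_mem 0 (by simpa using hd)]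
      · rw [pow_zero, one_smul, he0, htv, hR0]
      · intro k hk hk0
        have hk' : k < d := by simpa using hk
        have h5 : t (1 + p * (N * m)) (e k) = (((1 + p * (N * m) : ℕ) : K) ^ k)⁻¹ • e k := by
          conv_rhs => rw [← hte (N * m) k hk']
          rw [inv_smul_smul₀ (pow_ne_zero _ (by exact_mod_cast (by omega)))]
        rw [map_smul, h5, map_smul, map_smul, hRk k hk' hk0, smul_zero, smul_zero]
    simp only [map_smul, h4] at h3
    simp only [P, eval_finsetSum, eval_mul, eval_C, eval_pow, eval_X]
    rw [mul_assoc p N m, ← mul_right_inj' hφ, ← mul_right_inj' hq0]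
    simp only [smul_eq_mul] at h3
    rw [show eval 1 q * (φ v * ψ (1 + p * (N * m))) = ψ (1 + p * (N * m)) * (eval 1 q * φ v) by
        ring,
      ← h3, map_sum, map_sum, map_sum, Finset.mul_sum, Finset.mul_sum]
    refine Finset.sum_congr rfl fun k _ ↦ ?_
    simp only [map_smul, smul_eq_mul]
    field_simp
  obtain ⟨k, hk⟩ := exists_eq_pow_of_polynomial (r := p * N) (Nat.mul_pos hp hN) h1
    (fun m n ↦ by rw [mul_assoc, mul_assoc]; exact hmul _ _) hP
  exact ⟨N, k, hN, hk⟩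

end IntertwiningRelation

/-! ### The exponential and the logarithm -/

section ExpLog

open Filter

variable (p : ℕ) [hp : Fact p.Prime]

theorem charZero_of_normedAlgebra_padic (K : Type*) [NormedField K] [NormedAlgebra ℚ_[p] K] :
    CharZero K :=
  charZero_of_injective_algebraMap (algebraMap ℚ_[p] K).injective

theorem norm_inv_factorial_le (n : ℕ) : ‖((n.factorial : ℚ_[p]))⁻¹‖ ≤ (p : ℝ) ^ n := by
  have h1 : (1 : ℝ) ≤ p := by exact_mod_cast hp.out.one_le
  have hne : (n.factorial : ℚ_[p]) ≠ 0 := by exact_mod_cast n.factorial_ne_zero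
  rw [norm_inv, Padic.norm_eq_zpow_neg_valuation hne, Padic.valuation_natCast, zpow_neg, inv_inv,
    zpow_natCast]
  exact pow_le_pow_right₀ h1 (padicValNat_factorial_le (p := p) n)

/-- The crude bound `v_p(n!) ≤ n` is enough, since only positivity of the radius matters; it gives
at least `1/p`. -/
theorem expSeries_radius_pos_of_padic (K : Type*) [NormedField K] [NormedAlgebra ℚ_[p] K] :
    0 < (NormedSpace.expSeries ℚ_[p] K).radius := by
  have hp0 : (0 : ℝ) < p := by exact_mod_cast hp.out.pos
  let r : NNReal := (p : NNReal)⁻¹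
  have hr : 0 < r := inv_pos.2 (by exact_mod_cast hp.out.pos)
  refine lt_of_lt_of_le (ENNReal.coe_pos.2 hr)
    (FormalMultilinearSeries.le_radius_of_bound _ 1 fun n ↦ ?_)
  have h1 : ‖NormedSpace.expSeries ℚ_[p] K n‖ ≤ (p : ℝ) ^ n := by
    rw [NormedSpace.expSeries, norm_smul]
    calc _ ≤ (p : ℝ) ^ n * 1 := by
          gcongr
          · exact norm_inv_factorial_le p n
          · simp
      _ = _ := mul_one _
  calc _ ≤ (p : ℝ) ^ n * ((p : ℝ)⁻¹) ^ n := by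
        gcongr
        simp [r]
    _ = 1 := by rw [← mul_pow, mul_inv_cancel₀ hp0.ne', one_pow]

theorem expSeriesSum_eq_exp (K : Type*) [NormedField K] [NormedAlgebra ℚ_[p] K] :
    (expSeriesSum : K → K) = NormedSpace.exp := by
  have := charZero_of_normedAlgebra_padic p K
  rw [NormedSpace.exp_eq_tsum_div]
  rfl

/-- On a small ball the exponential series is additive-to-multiplicative and continuous. -/
theorem exists_ball_expSeriesSum (K : Type*) [NormedField K] [NormedAlgebra ℚ_[p] K]
    [CompleteSpace K] : ∃ ρ : ℝ, 0 < ρ ∧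
      (∀ x y : K, ‖x‖ < ρ → ‖y‖ < ρ → expSeriesSum (x + y) = expSeriesSum x * expSeriesSum y) ∧
      (∀ x : K, ‖x‖ < ρ → ContinuousAt expSeriesSum x) ∧
      ∀ᶠ z in 𝓝 (1 : K), ∃ y : K, ‖y‖ < ρ ∧ expSeriesSum y = z := by
  have := charZero_of_normedAlgebra_padic p K
  have hpos := expSeries_radius_pos_of_padic p K
  obtain ⟨ρ, hρ, hρ'⟩ := ENNReal.lt_iff_exists_nnreal_btwn.1 hpos
  have hmem : ∀ x : K, ‖x‖ < ρ →
      x ∈ Metric.eball (0 : K) (NormedSpace.expSeries ℚ_[p] K).radius := by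
    intro x hx
    rw [Metric.mem_eball, edist_zero_right]
    refine lt_trans ?_ hρ'
    rw [enorm_eq_nnnorm, ENNReal.coe_lt_coe]
    exact hx
  have hρ0 : (0 : ℝ) < ρ := by exact_mod_cast hρ
  rw [expSeriesSum_eq_exp p K]
  refine ⟨ρ, hρ0, fun x y hx hy ↦ NormedSpace.exp_add_of_mem_ball (hmem x hx) (hmem y hy),
    fun x hx ↦ (NormedSpace.analyticAt_exp_of_mem_ball (𝕂 := ℚ_[p]) x (hmem x hx)).continuousAt,
    ?_⟩
  -- By the inverse function theorem the exponential, with derivative `1` at `0`, maps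
  -- neighbourhoods of `0` onto neighbourhoods of `1`. So every `z` near `1` has a logarithm in the
  -- ball.
  have hd := hasStrictFDerivAt_exp_zero_of_radius_pos hpos
  have h1 := HasStrictFDerivAt.map_nhds_eq_of_equiv
    (f' := ContinuousLinearEquiv.refl ℚ_[p] K) hd
  rw [NormedSpace.exp_zero] at h1
  rw [← h1, eventually_map]
  filter_upwards [Metric.ball_mem_nhds (0 : K) hρ0] with y hy
  exact ⟨y, by simpa using hy, rfl⟩

theorem hasDerivAt_expSeriesSum_mul (K : Type*) [NormedField K] [NormedAlgebra ℚ_[p] K]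
    [CompleteSpace K] (c : K) :
    HasDerivAt (fun y : ℚ_[p] ↦ expSeriesSum (c * algebraMap ℚ_[p] K y)) c 0 := by
  have := charZero_of_normedAlgebra_padic p K
  have hd := hasFDerivAt_exp_zero_of_radius_pos (expSeries_radius_pos_of_padic p K)
  rw [← expSeriesSum_eq_exp p K] at hd
  have h1 : HasDerivAt (fun y : ℚ_[p] ↦ c * algebraMap ℚ_[p] K y) c 0 := by
    have := ((Algebra.linearMap ℚ_[p] K).toContinuousLinearMap.hasDerivAt (x := (0 :
        ℚ_[p]))).const_mul c
    simpa using this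
  have h2 : HasFDerivAt (expSeriesSum : K → K) (1 : K →L[ℚ_[p]] K)
      (c * algebraMap ℚ_[p] K 0) := by simpa using hd
  have h3 := h2.comp_hasDerivAt (0 : ℚ_[p]) h1
  exact h3

/-! ### The `p`-adic logarithm: limit formula, additivity, zeros near `1`. -/

theorem norm_inv_natCast_le (n : ℕ) (hn : n ≠ 0) : ‖(n : ℚ_[p])‖⁻¹ ≤ n := by
  rw [Padic.norm_eq_zpow_neg_valuation (by exact_mod_cast hn), Padic.valuation_natCast, zpow_neg,
    inv_inv, zpow_natCast]
  exact_mod_cast Nat.le_of_dvd (Nat.pos_of_ne_zero hn) pow_padicValNat_dvd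

theorem norm_pow_div_le {x : ℚ_[p]} (n : ℕ) :
    ‖x ^ (n + 1) / ((n : ℚ_[p]) + 1)‖ ≤ (n + 1 : ℕ) * ‖x‖ ^ (n + 1) := by
  rw [norm_div, norm_pow, div_eq_mul_inv, mul_comm]
  gcongr
  exact_mod_cast norm_inv_natCast_le p (n + 1) (by omega)

theorem summable_succ_mul_pow {r : ℝ} (h0 : 0 ≤ r) (h1 : r < 1) :
    Summable fun n : ℕ ↦ ((n + 1 : ℕ) : ℝ) * r ^ (n + 1) := by
  have := summable_pow_mul_geometric_of_norm_lt_one 1 (r := r)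
    (by rwa [Real.norm_of_nonneg h0])
  simpa using (summable_nat_add_iff 1).2 this

/-- Since `p ^ n - 1` tends to `-1`, the limit is the binomial coefficient of `-1` over `k`. The
induction uses `C(q, k + 1) = (q + 1) C(q, k) / (k + 1) - C(q, k)` with `q + 1 = p ^ n`. -/
theorem tendsto_choose_prime_pow_sub_one (k : ℕ) :
    Tendsto (fun n : ℕ ↦ (((p ^ n - 1).choose k : ℕ) : ℚ_[p])) atTop (𝓝 ((-1) ^ k)) := by
  have hpn : Tendsto (fun n : ℕ ↦ (p : ℚ_[p]) ^ n) atTop (𝓝 0) :=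
    tendsto_pow_atTop_nhds_zero_of_norm_lt_one Padic.norm_p_lt_one
  induction k with
  | zero => simp
  | succ k ih =>
    have hk : ((k : ℚ_[p]) + 1) ≠ 0 := by exact_mod_cast k.succ_ne_zero
    have h1 : Tendsto (fun n : ℕ ↦ (p : ℚ_[p]) ^ n * (((p ^ n - 1).choose k : ℕ) : ℚ_[p]) /
        ((k : ℚ_[p]) + 1) - (((p ^ n - 1).choose k : ℕ) : ℚ_[p])) atTop
        (𝓝 (0 * (-1) ^ k / ((k : ℚ_[p]) + 1) - (-1) ^ k)) :=
      ((hpn.mul ih).div_const _).sub ih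
    have e : (0 * (-1) ^ k / ((k : ℚ_[p]) + 1) - (-1) ^ k) = (-1 : ℚ_[p]) ^ (k + 1) := by ring
    rw [e] at h1
    refine h1.congr fun n ↦ ?_
    obtain ⟨q, hq⟩ : ∃ q, p ^ n = q + 1 := ⟨p ^ n - 1, by have := pow_pos hp.out.pos n; omega⟩
    have h2 : ((p ^ n : ℕ) : ℚ_[p]) = q + 1 := by rw [hq]; push_cast; rfl
    have h3 := Nat.add_one_mul_choose_eq q k
    have h4 := Nat.choose_succ_succ q k
    rw [Nat.cast_pow] at h2
    rw [h2, hq, Nat.add_sub_cancel, sub_eq_iff_eq_add, div_eq_iff hk]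
    rw [Nat.succ_eq_add_one, Nat.succ_eq_add_one] at h4
    rw [h4] at h3
    have h5 := congrArg (Nat.cast : ℕ → ℚ_[p]) h3
    push_cast at h5
    rw [h5]
    ring

/-- The logarithm as the limit of `(a ^ pⁿ - 1) / pⁿ`. -/
theorem tendsto_pow_sub_one_div (x : ℚ_[p]) (hx : ‖x‖ < 1) :
    Tendsto (fun n : ℕ ↦ ((1 + x) ^ p ^ n - 1) / (p : ℚ_[p]) ^ n) atTop
      (𝓝 (∑' n : ℕ, (-1) ^ n * x ^ (n + 1) / ((n : ℚ_[p]) + 1))) := by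
  have hp0 : (p : ℚ_[p]) ≠ 0 := by exact_mod_cast hp.out.ne_zero
  -- By the binomial theorem `((1 + x) ^ pⁿ - 1) / pⁿ` is the sum of `C(pⁿ - 1, k) x ^ (k + 1) / (k
  -- + 1)`. Its terms tend to those of the logarithm and are dominated by `(k + 1) ‖x‖ ^ (k + 1)`.
  have h1 : Tendsto (fun n : ℕ ↦ ∑' k : ℕ, (((p ^ n - 1).choose k : ℕ) : ℚ_[p]) *
      x ^ (k + 1) / ((k : ℚ_[p]) + 1)) atTop
      (𝓝 (∑' n : ℕ, (-1) ^ n * x ^ (n + 1) / ((n : ℚ_[p]) + 1))) := by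
    refine tendsto_tsum_of_dominated_convergence
      (summable_succ_mul_pow (norm_nonneg x) hx) (fun k ↦ ?_) (Eventually.of_forall fun n k ↦ ?_)
    · exact ((tendsto_choose_prime_pow_sub_one p k).mul_const _).div_const _
    · rw [mul_div_assoc, norm_mul]
      refine (mul_le_of_le_one_left (norm_nonneg _) ?_).trans (norm_pow_div_le p k)
      simpa using Padic.norm_int_le_one ((p ^ n - 1).choose k)
  refine h1.congr fun n ↦ ?_
  obtain ⟨q, hq⟩ : ∃ q, p ^ n = q + 1 := ⟨p ^ n - 1, by have := pow_pos hp.out.pos n; omega⟩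
  have h2 : (p : ℚ_[p]) ^ n = q + 1 := by
    have : ((p ^ n : ℕ) : ℚ_[p]) = q + 1 := by rw [hq]; push_cast; rfl
    simpa using this
  have hq0 : (q : ℚ_[p]) + 1 ≠ 0 := by rw [← h2]; exact pow_ne_zero _ hp0
  rw [h2, hq, Nat.add_sub_cancel, tsum_eq_sum (s := Finset.range (q + 1))]
  · rw [add_comm 1 x, add_pow, Finset.sum_range_succ' _ (q + 1), eq_div_iff hq0, Finset.sum_mul]
    simp only [one_pow, mul_one, pow_zero, Nat.choose_zero_right, Nat.cast_one,
        add_sub_cancel_right]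
    refine Finset.sum_congr rfl fun k _ ↦ ?_
    have hk : ((k : ℚ_[p]) + 1) ≠ 0 := by exact_mod_cast k.succ_ne_zero
    have h5 := congrArg (Nat.cast : ℕ → ℚ_[p]) (Nat.add_one_mul_choose_eq q k)
    push_cast at h5
    rw [div_mul_eq_mul_div, div_eq_iff hk]
    linear_combination x ^ (k + 1) * h5
  · intro k hk
    rw [Finset.mem_range, not_lt] at hk
    rw [Nat.choose_eq_zero_of_lt (by omega)]
    simp

theorem norm_coe_sub_one_lt_one {a : ℤ_[p]} (ha : ‖a - 1‖ < 1) : ‖(a : ℚ_[p]) - 1‖ < 1 := by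
  rw [← PadicInt.coe_one, ← PadicInt.coe_sub]; exact ha

theorem tendsto_padicLogSeries {a : ℤ_[p]} (ha : ‖a - 1‖ < 1) :
    Tendsto (fun n : ℕ ↦ ((a : ℚ_[p]) ^ p ^ n - 1) / (p : ℚ_[p]) ^ n) atTop
      (𝓝 (padicLogSeries a)) := by
  have := tendsto_pow_sub_one_div p ((a : ℚ_[p]) - 1) (norm_coe_sub_one_lt_one p ha)
  simpa [padicLogSeries] using this

/-- A quadratic error bound, from which come the derivative of the logarithm at `1` and its
nonvanishing near `1`. By discreteness `‖x‖ ≤ 1/p`, and this absorbs the denominators because `n + 2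
≤ p ^ (n + 1)`. -/
theorem norm_padicLogSeries_sub_le {a : ℤ_[p]} (ha : ‖a - 1‖ < 1) :
    ‖padicLogSeries a - ((a : ℚ_[p]) - 1)‖ ≤ p * ‖a - 1‖ ^ 2 := by
  set x : ℚ_[p] := (a : ℚ_[p]) - 1 with hx
  have hxa : ‖x‖ = ‖a - 1‖ := by
    rw [hx, ← PadicInt.coe_one, ← PadicInt.coe_sub]; rfl
  rw [← hxa] at ha ⊢
  have hs : Summable fun n : ℕ ↦ (-1) ^ n * x ^ (n + 1) / ((n : ℚ_[p]) + 1) := by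
    refine Summable.of_norm_bounded (summable_succ_mul_pow (norm_nonneg x) ha) fun n ↦ ?_
    rw [mul_div_assoc, norm_mul, norm_pow, norm_neg, norm_one, one_pow, one_mul]
    exact norm_pow_div_le p n
  have hp1 : (1 : ℝ) ≤ p := by exact_mod_cast hp.out.one_le
  have hxp : ‖x‖ ≤ (p : ℝ)⁻¹ := by
    have := (Padic.norm_le_pow_iff_norm_lt_pow_add_one x (-1)).2 (by simpa using ha)
    simpa using this
  have h0 : padicLogSeries a = ∑' n : ℕ, (-1) ^ n * x ^ (n + 1) / ((n : ℚ_[p]) + 1) := rfl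
  rw [h0, hs.tsum_eq_zero_add]
  simp only [pow_zero, zero_add, pow_one, Nat.cast_zero, one_mul, div_one, add_sub_cancel_left]
  refine IsUltrametricDist.norm_tsum_le_of_forall_le_of_nonneg (by positivity) fun n ↦ ?_
  rw [mul_div_assoc, norm_mul, norm_pow, norm_neg, norm_one, one_pow, one_mul]
  refine (norm_pow_div_le p (n + 1)).trans ?_
  have h3 : ((n + 1 + 1 : ℕ) : ℝ) ≤ p * (p : ℝ) ^ n := by
    rw [← pow_succ']
    have : n + 1 + 1 ≤ p ^ (n + 1) := Nat.lt_pow_self hp.out.one_lt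
    exact_mod_cast this
  calc ((n + 1 + 1 : ℕ) : ℝ) * ‖x‖ ^ (n + 1 + 1)
      = ((n + 1 + 1 : ℕ) : ℝ) * ‖x‖ ^ n * ‖x‖ ^ 2 := by ring
    _ ≤ (p * (p : ℝ) ^ n) * ((p : ℝ)⁻¹) ^ n * ‖x‖ ^ 2 := by gcongr
    _ = p * ‖x‖ ^ 2 * ((p : ℝ) * (p : ℝ)⁻¹) ^ n := by rw [mul_pow]; ring
    _ = p * ‖x‖ ^ 2 := by rw [mul_inv_cancel₀ (by positivity), one_pow, mul_one]

theorem norm_mul_sub_one_lt {a b : ℤ_[p]} {r : ℝ} (ha : ‖a - 1‖ < r) (hb : ‖b - 1‖ < r) :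
    ‖a * b - 1‖ < r := by
  have : a * b - 1 = (a - 1) * b + (b - 1) := by ring
  rw [this]
  refine (PadicInt.nonarchimedean _ _).trans_lt (max_lt ?_ hb)
  rw [norm_mul]
  exact lt_of_le_of_lt (mul_le_of_le_one_right (norm_nonneg _) (PadicInt.norm_le_one b)) ha

/-- With the limit formula this is `(a b) ^ pⁿ - 1 = (a ^ pⁿ - 1) b ^ pⁿ + (b ^ pⁿ - 1)` together
with `b ^ pⁿ → 1`; no identity of power series is needed. -/
theorem padicLogSeries_mul {a b : ℤ_[p]} (ha : ‖a - 1‖ < 1) (hb : ‖b - 1‖ < 1) :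
    padicLogSeries (a * b) = padicLogSeries a + padicLogSeries b := by
  have h1 := tendsto_padicLogSeries p ha
  have h2 := tendsto_padicLogSeries p hb
  have h3 := tendsto_padicLogSeries p (norm_mul_sub_one_lt p ha hb)
  have hp0 : (p : ℚ_[p]) ≠ 0 := by exact_mod_cast hp.out.ne_zero
  have hpn : Tendsto (fun n : ℕ ↦ (p : ℚ_[p]) ^ n) atTop (𝓝 0) :=
    tendsto_pow_atTop_nhds_zero_of_norm_lt_one Padic.norm_p_lt_one
  have h4 : Tendsto (fun n : ℕ ↦ (b : ℚ_[p]) ^ p ^ n) atTop (𝓝 1) := by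
    have := (h2.mul hpn).add_const 1
    rw [mul_zero, zero_add] at this
    refine this.congr fun n ↦ ?_
    rw [div_mul_cancel₀ _ (pow_ne_zero _ hp0), sub_add_cancel]
  have h5 := (h1.mul h4).add h2
  rw [mul_one] at h5
  refine tendsto_nhds_unique h3 (h5.congr fun n ↦ ?_)
  rw [PadicInt.coe_mul, mul_pow]
  ring

theorem padicLogSeries_one : padicLogSeries (1 : ℤ_[p]) = 0 := by
  have := padicLogSeries_mul p (a := 1) (b := 1) (by simp) (by simp)
  simpa using this

theorem padicLogSeries_pow {a : ℤ_[p]} (ha : ‖a - 1‖ < 1) (n : ℕ) :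
    ‖a ^ n - 1‖ < 1 ∧ padicLogSeries (a ^ n) = n * padicLogSeries a := by
  induction n with
  | zero => simp [padicLogSeries_one]
  | succ n ih =>
    rw [pow_succ]
    refine ⟨norm_mul_sub_one_lt p ih.1 ha, ?_⟩
    rw [padicLogSeries_mul p ih.1 ha, ih.2]
    push_cast
    ring

/-- A zero would give `‖x‖ ≤ p ‖x‖ ^ 2` for `x = a - 1`, against `p ‖x‖ < 1`. The strict bound `1/p`
excludes the zero `a = -1` for `p = 2`. -/
theorem padicLogSeries_ne_zero {a : ℤ_[p]} (ha : ‖a - 1‖ < (p : ℝ)⁻¹) (ha1 : a ≠ 1) :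
    padicLogSeries a ≠ 0 := by
  intro h0
  have hp1 : (1 : ℝ) < p := by exact_mod_cast hp.out.one_lt
  have h := norm_padicLogSeries_sub_le p (ha.trans (inv_lt_one_of_one_lt₀ hp1))
  rw [h0, zero_sub, norm_neg, ← PadicInt.coe_one, ← PadicInt.coe_sub, ← PadicInt.norm_def] at h
  have h2 : 0 < ‖a - 1‖ := norm_pos_iff.2 (sub_ne_zero.2 ha1)
  have h3 : p * ‖a - 1‖ < 1 := by
    calc _ < p * (p : ℝ)⁻¹ := by gcongr
      _ = 1 := mul_inv_cancel₀ (by positivity)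
  nlinarith

end ExpLog

/-! ### Density of the powers of `1 + p ^ M` -/

section Density

variable {p : ℕ} [hp : Fact p.Prime]

theorem exists_one_add_pow_eq {R : Type*} [CommRing R] (x : R) (n : ℕ) :
    ∃ r, (1 + x) ^ n = 1 + n * x + x ^ 2 * r := by
  induction n with
  | zero => exact ⟨0, by simp⟩
  | succ n ih =>
    obtain ⟨r, hr⟩ := ih
    exact ⟨r + n + x * r, by rw [pow_succ, hr]; push_cast; ring⟩

/-- Raising to the `p`-th power multiplies the deviation from `1` by `p`, up to a factor `≡ 1` mod
`p`. The condition `M ≥ 2` makes the quadratic error divisible by `p ^ (M + i + 2)`, also for `p =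
2`, where `M = 1` would fail. -/
theorem exists_one_add_prime_pow_pow_eq {M : ℕ} (hM : 2 ≤ M) (i : ℕ) :
    ∃ u : ℤ_[p], (1 + (p : ℤ_[p]) ^ M) ^ p ^ i = 1 + (p : ℤ_[p]) ^ (M + i) * (1 + p * u) := by
  induction i with
  | zero => exact ⟨0, by simp⟩
  | succ i ih =>
    obtain ⟨u, hu⟩ := ih
    obtain ⟨r, hr⟩ := exists_one_add_pow_eq ((p : ℤ_[p]) ^ (M + i) * (1 + p * u)) p
    obtain ⟨k, hk⟩ := Nat.exists_eq_add_of_le hM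
    refine ⟨u + (p : ℤ_[p]) ^ (k + i) * (1 + p * u) ^ 2 * r, ?_⟩
    rw [pow_succ, pow_mul, hu, hr, hk]
    ring

/-- Successive approximation: if `a` agrees with the `n`-th power modulo `p ^ (M + i)`, the next
digit of the error is removed by adding `p ^ i r` to `n`, where `r` is that digit. -/
theorem exists_prime_pow_dvd_sub_pow {M : ℕ} (hM : 2 ≤ M) {a : ℤ_[p]}
    (ha : (p : ℤ_[p]) ^ M ∣ a - 1) (i : ℕ) :
    ∃ n : ℕ, (p : ℤ_[p]) ^ (M + i) ∣ a - (1 + (p : ℤ_[p]) ^ M) ^ n := by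
  induction i with
  | zero => exact ⟨0, by simpa using ha⟩
  | succ i ih =>
    obtain ⟨n, z, hz⟩ := ih
    obtain ⟨u, hu⟩ := exists_one_add_prime_pow_pow_eq (p := p) hM i
    obtain ⟨k, hk⟩ := Nat.exists_eq_add_of_le hM
    set r := PadicInt.zmodRepr z
    have hr : (p : ℤ_[p]) ∣ z - r := by
      have := PadicInt.sub_zmodRepr_mem z
      rwa [PadicInt.maximalIdeal_eq_span_p, Ideal.mem_span_singleton] at this
    obtain ⟨z', hz'⟩ := hr
    obtain ⟨t, ht⟩ := exists_one_add_pow_eq ((p : ℤ_[p]) ^ (M + i) * (1 + p * u)) r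
    obtain ⟨s, hs⟩ : (p : ℤ_[p]) ∣ (1 + (p : ℤ_[p]) ^ M) ^ n - 1 := by
      have h1 : (1 + (p : ℤ_[p]) ^ M) - 1 ∣ (1 + (p : ℤ_[p]) ^ M) ^ n - 1 := by
        simpa using sub_dvd_pow_sub_pow (1 + (p : ℤ_[p]) ^ M) 1 n
      refine dvd_trans ?_ h1
      rw [add_sub_cancel_left]
      exact dvd_pow_self _ (by omega)
    refine ⟨n + p ^ i * r, ?_⟩
    have h2 : a - (1 + (p : ℤ_[p]) ^ M) ^ (n + p ^ i * r) = (p : ℤ_[p]) ^ (M + i) *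
        (z - (1 + p * s) * (r * (1 + p * u) + (p : ℤ_[p]) ^ (M + i) * (1 + p * u) ^ 2 * t)) := by
      rw [pow_add, pow_mul, hu, ht]
      have : a = (1 + (p : ℤ_[p]) ^ M) ^ n + (p : ℤ_[p]) ^ (M + i) * z := by
        rw [← hz]; ring
      rw [this, eq_add_of_sub_eq hs]
      ring
    rw [h2, ← add_assoc, pow_succ]
    refine mul_dvd_mul_left _ ⟨z' - s * r - r * u - p * s * r * u -
      (1 + p * s) * ((p : ℤ_[p]) ^ (k + 1 + i) * (1 + p * u) ^ 2 * t), ?_⟩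
    rw [eq_add_of_sub_eq hz', hk]
    ring

theorem prime_pow_dvd_iff (n : ℕ) (x : ℤ_[p]) :
    (p : ℤ_[p]) ^ n ∣ x ↔ ‖x‖ ≤ ((p : ℝ)⁻¹) ^ n := by
  rw [← Ideal.mem_span_singleton, ← PadicInt.norm_le_pow_iff_mem_span_pow, zpow_neg, inv_pow,
    zpow_natCast]

/-- The closed subset of units congruent to `1` modulo `p ^ M`. -/
theorem mem_closure_range_pow {M : ℕ} (hM : 2 ≤ M) {g : ℤ_[p]ˣ}
    (hg : (g : ℤ_[p]) = 1 + (p : ℤ_[p]) ^ M) {a : ℤ_[p]ˣ} (ha : (p : ℤ_[p]) ^ M ∣ a - 1) :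
    a ∈ closure (Set.range fun n : ℕ ↦ g ^ n) := by
  rw [Units.isOpenEmbedding_val.isInducing.closure_eq_preimage_closure_image, Set.mem_preimage,
    Metric.mem_closure_iff]
  intro ε hε
  have hp1 : (p : ℝ)⁻¹ < 1 := inv_lt_one_of_one_lt₀ (by exact_mod_cast hp.out.one_lt)
  have hp0 : (0 : ℝ) ≤ (p : ℝ)⁻¹ := by positivity
  obtain ⟨i, hi⟩ := exists_pow_lt_of_lt_one hε hp1
  obtain ⟨n, hn⟩ := exists_prime_pow_dvd_sub_pow hM ha i
  refine ⟨_, ⟨_, ⟨n, rfl⟩, rfl⟩, ?_⟩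
  rw [dist_eq_norm, Units.val_pow_eq_pow_val, hg]
  rw [prime_pow_dvd_iff] at hn
  exact (hn.trans (pow_le_pow_of_le_one hp0 hp1.le (by omega))).trans_lt hi

theorem exists_unit_eq_one_add {x : ℤ_[p]} (hx : ‖x‖ < 1) : ∃ u : ℤ_[p]ˣ, (u : ℤ_[p]) = 1 + x := by
  have : IsUnit (1 + x) := by
    rw [PadicInt.isUnit_iff]
    refine le_antisymm (PadicInt.norm_le_one _) (not_lt.1 fun h ↦ ?_)
    have h1 := PadicInt.nonarchimedean (1 + x) (-x)
    rw [add_neg_cancel_right, norm_neg, norm_one] at h1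
    exact absurd (h1.trans_lt (max_lt h hx)) (lt_irrefl _)
  exact ⟨this.unit, rfl⟩

end Density

/-! ### The exponent of a continuous character of `ℤ_pˣ` -/

section Exponent

open Filter

variable {p : ℕ} [hp : Fact p.Prime] {K : Type*} [NormedField K] [NormedAlgebra ℚ_[p] K]

/-- The slopes at `x` agree at points accumulating at `x`, so their limits agree. Every comparison
of exponents is reduced to this, as `c` is the derivative of `exp(c log a)` at `a = 1`. -/
theorem eq_of_hasDerivAt_of_frequently_eq {F G : ℚ_[p] → K} {c c' : K} {x : ℚ_[p]}
    (hF : HasDerivAt F c x) (hG : HasDerivAt G c' x) (h0 : F x = G x)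
    (h : ∃ᶠ y in 𝓝[≠] x, F y = G y) : c = c' := by
  rw [hasDerivAt_iff_tendsto_slope] at hF hG
  refine tendsto_nhds_unique_of_frequently_eq hF hG (h.mono fun y hy ↦ ?_)
  rw [slope, slope, hy, h0]

/-- The logarithm on `1 + pℤ_p` as a function of `x ∈ ℚ_p`, extended by the same series. -/
theorem hasDerivAt_log_series :
    HasDerivAt (fun x : ℚ_[p] ↦ ∑' n : ℕ, (-1) ^ n * (x - 1) ^ (n + 1) / ((n : ℚ_[p]) + 1)) 1 1
        := by
  rw [hasDerivAt_iff_isLittleO]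
  have h1 : (∑' n : ℕ, (-1) ^ n * ((1 : ℚ_[p]) - 1) ^ (n + 1) / ((n : ℚ_[p]) + 1)) = 0 := by simp
  rw [h1]
  have h2 : (fun x : ℚ_[p] ↦ x - 1) =o[𝓝 1] fun _ ↦ (1 : ℝ) := by
    rw [Asymptotics.isLittleO_one_iff]
    have : Tendsto (fun x : ℚ_[p] ↦ x - 1) (𝓝 1) (𝓝 (1 - 1)) := tendsto_id.sub_const 1
    simpa using this
  have h3 : (fun x : ℚ_[p] ↦ (x - 1) * (x - 1)) =o[𝓝 1] fun x ↦ (x - 1) := by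
    simpa using ((Asymptotics.isLittleO_one_iff ℚ_[p]).2 ((Asymptotics.isLittleO_one_iff ℝ).1
        h2)).mul_isBigO
      (Asymptotics.isBigO_refl (fun x : ℚ_[p] ↦ x - 1) (𝓝 1))
  refine Asymptotics.IsBigO.trans_isLittleO ?_ h3
  refine Asymptotics.IsBigO.of_bound p ?_
  filter_upwards [Metric.ball_mem_nhds (1 : ℚ_[p]) one_pos] with x hx
  rw [Metric.mem_ball, dist_eq_norm] at hx
  have hx1 : ‖x‖ ≤ 1 := by
    have : x = (x - 1) + 1 := by ring
    rw [this]
    exact (Padic.nonarchimedean _ _).trans (max_le hx.le (by simp))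
  have := norm_padicLogSeries_sub_le p (a := ⟨x, hx1⟩) hx
  rw [norm_mul, ← pow_two]
  simp only [mul_one, sub_zero, smul_eq_mul]
  exact this

theorem hasDerivAt_exp_mul_log [CompleteSpace K] (c : K) :
    HasDerivAt (fun x : ℚ_[p] ↦ expSeriesSum (c * algebraMap ℚ_[p] K
      (∑' n : ℕ, (-1) ^ n * (x - 1) ^ (n + 1) / ((n : ℚ_[p]) + 1)))) c 1 := by
  have h1 := hasDerivAt_expSeriesSum_mul p K c
  have h2 := hasDerivAt_log_series (p := p)
  have h0 : (∑' n : ℕ, (-1) ^ n * ((1 : ℚ_[p]) - 1) ^ (n + 1) / ((n : ℚ_[p]) + 1)) = 0 := by simp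
  rw [← h0] at h1
  have h3 := h1.scomp (1 : ℚ_[p]) h2
  rw [one_smul] at h3
  exact h3

/-- A property of units close to `1` holds for `1 + p ^ j r` with `j` large. -/
theorem frequently_of_eventually_units {P : ℤ_[p]ˣ → Prop} (h : ∀ᶠ a in 𝓝 1, P a) {r : ℕ}
    (hr : 0 < r) {Q : ℚ_[p] → Prop}
    (hPQ : ∀ (a : ℤ_[p]ˣ) (m : ℕ), (a : ℤ_[p]) = ((1 + p * r * m : ℕ) : ℤ_[p]) → P a →
      Q ((a : ℤ_[p]) : ℚ_[p])) : ∃ᶠ x in 𝓝[≠] (1 : ℚ_[p]), Q x := by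
  have hp1 : ‖(p : ℤ_[p])‖ < 1 := by
    rw [PadicInt.norm_p]
    exact inv_lt_one_of_one_lt₀ (by exact_mod_cast hp.out.one_lt)
  have hlt : ∀ j : ℕ, ‖((p * r * p ^ j : ℕ) : ℤ_[p])‖ < 1 := fun j ↦ by
    push_cast
    rw [mul_assoc, norm_mul]
    exact mul_lt_one_of_nonneg_of_lt_one_left (norm_nonneg _) hp1 (PadicInt.norm_le_one _)
  choose u hu using fun j ↦ exists_unit_eq_one_add (hlt j)
  have hpj : Tendsto (fun j : ℕ ↦ (p : ℤ_[p]) ^ j) atTop (𝓝 0) :=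
    tendsto_pow_atTop_nhds_zero_of_norm_lt_one hp1
  have ht : Tendsto (fun j ↦ ((u j : ℤ_[p]ˣ) : ℤ_[p])) atTop (𝓝 1) := by
    have := (hpj.const_mul ((p : ℤ_[p]) * r)).const_add 1
    rw [mul_zero, add_zero] at this
    refine this.congr fun j ↦ ?_
    rw [hu]
    push_cast
    rfl
  have htu : Tendsto u atTop (𝓝 1) := by
    rw [Units.isOpenEmbedding_val.isInducing.tendsto_nhds_iff]
    exact ht
  have htq : Tendsto (fun j ↦ (((u j : ℤ_[p]ˣ) : ℤ_[p]) : ℚ_[p])) atTop (𝓝[≠] 1) := by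
    refine tendsto_nhdsWithin_iff.2 ⟨?_, Eventually.of_forall fun j ↦ ?_⟩
    · exact (continuous_subtype_val.tendsto (1 : ℤ_[p])).comp ht
    · rw [hu, Set.mem_compl_iff, Set.mem_singleton_iff]
      push_cast
      rw [add_eq_left]
      have hp0 : (p : ℚ_[p]) ≠ 0 := by exact_mod_cast hp.out.ne_zero
      have hr0 : (r : ℚ_[p]) ≠ 0 := by exact_mod_cast hr.ne'
      positivity
  refine htq.frequently (Eventually.frequently ?_)
  filter_upwards [htu.eventually h] with j hj
  exact hPQ (u j) (p ^ j) (by rw [hu]; push_cast; ring) hj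

/-- The exponent of a character near `1` is unique. -/
theorem exponent_unique [CompleteSpace K] {ψ : ℤ_[p]ˣ → K} {c c' : K}
    (h : ∀ᶠ a in 𝓝 1, ψ a = expSeriesSum (c * algebraMap ℚ_[p] K (padicLogSeries (a : ℤ_[p]))))
    (h' : ∀ᶠ a in 𝓝 1, ψ a = expSeriesSum (c' * algebraMap ℚ_[p] K (padicLogSeries (a : ℤ_[p])))) :
    c = c' :=
  eq_of_hasDerivAt_of_frequently_eq (hasDerivAt_exp_mul_log c) (hasDerivAt_exp_mul_log c')
    (by simp) (frequently_of_eventually_units (h.and h') one_pos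
      fun _ _ _ ha ↦ ha.1.symm.trans ha.2)

/-- If a character is given by the `k`-th power on `1 + prℕ` then its exponent is `k`. -/
theorem exponent_eq_natCast [CompleteSpace K] {ψ : ℤ_[p]ˣ → K} {c : K}
    (h : ∀ᶠ a in 𝓝 1, ψ a = expSeriesSum (c * algebraMap ℚ_[p] K (padicLogSeries (a : ℤ_[p]))))
    {r k : ℕ} (hr : 0 < r) (hk : ∀ (a : ℤ_[p]ˣ) (m : ℕ),
      (a : ℤ_[p]) = ((1 + p * r * m : ℕ) : ℤ_[p]) → ψ a = ((1 + p * r * m : ℕ) : K) ^ k) :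
    c = k := by
  refine eq_of_hasDerivAt_of_frequently_eq (hasDerivAt_exp_mul_log c)
    (G := fun x ↦ algebraMap ℚ_[p] K (x ^ k)) ?_ ?_
    (frequently_of_eventually_units h hr fun a m ham ha ↦ ?_)
  · have h1 := (hasDerivAt_pow k (1 : ℚ_[p]))
    have := (Algebra.linearMap ℚ_[p] K).toContinuousLinearMap.hasFDerivAt.comp_hasDerivAt
      (1 : ℚ_[p]) h1
    convert! this using 1
    simp
  · have := charZero_of_normedAlgebra_padic p K
    have h0 : (expSeriesSum (0 : K)) = 1 := by
      rw [expSeriesSum_eq_exp p K, NormedSpace.exp_zero]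
    simp [h0]
  · refine ha.symm.trans ((hk a m ham).trans ?_)
    rw [ham]
    simp

/-- Likewise for the inverse of the `k`-th power. -/
theorem exponent_eq_neg_natCast [CompleteSpace K] {ψ : ℤ_[p]ˣ → K} {c : K}
    (h : ∀ᶠ a in 𝓝 1, ψ a = expSeriesSum (c * algebraMap ℚ_[p] K (padicLogSeries (a : ℤ_[p]))))
    {r k : ℕ} (hr : 0 < r) (hk : ∀ (a : ℤ_[p]ˣ) (m : ℕ),
      (a : ℤ_[p]) = ((1 + p * r * m : ℕ) : ℤ_[p]) → ψ a = (((1 + p * r * m : ℕ) : K) ^ k)⁻¹) :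
    c = -k := by
  refine eq_of_hasDerivAt_of_frequently_eq (hasDerivAt_exp_mul_log c)
    (G := fun x ↦ algebraMap ℚ_[p] K ((x ^ k)⁻¹)) ?_ ?_
    (frequently_of_eventually_units h hr fun a m ham ha ↦ ?_)
  · have h1 := (hasDerivAt_pow k (1 : ℚ_[p])).fun_inv (by simp)
    have := (Algebra.linearMap ℚ_[p] K).toContinuousLinearMap.hasFDerivAt.comp_hasDerivAt
      (1 : ℚ_[p]) h1
    convert! this using 1
    simp
  · have := charZero_of_normedAlgebra_padic p K
    have h0 : (expSeriesSum (0 : K)) = 1 := by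
      rw [expSeriesSum_eq_exp p K, NormedSpace.exp_zero]
    simp [h0]
  · refine ha.symm.trans ((hk a m ham).trans ?_)
    rw [ham]
    simp

/-- Continuity at `1` follows from differentiability there, and is moved to `a` by `log b = log (b
a⁻¹) + log a`. -/
theorem continuousAt_padicLogSeries {a : ℤ_[p]ˣ} (ha : ‖(a : ℤ_[p]) - 1‖ < 1) :
    ContinuousAt (fun a : ℤ_[p]ˣ ↦ padicLogSeries (a : ℤ_[p])) a := by
  have h1 : ContinuousAt (fun a : ℤ_[p]ˣ ↦ padicLogSeries (a : ℤ_[p])) 1 := by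
    have h2 := (hasDerivAt_log_series (p := p)).continuousAt
    have hcoe : Continuous (fun a : ℤ_[p] ↦ (a : ℚ_[p])) := continuous_subtype_val
    exact ContinuousAt.comp (f := fun a : ℤ_[p]ˣ ↦ ((a : ℤ_[p]) : ℚ_[p])) (x := (1 : ℤ_[p]ˣ))
      (by simpa using h2) (hcoe.comp Units.continuous_val).continuousAt
  have h3 : ContinuousAt (fun b : ℤ_[p]ˣ ↦ padicLogSeries ((b * a⁻¹ : ℤ_[p]ˣ) : ℤ_[p]) +
      padicLogSeries (a : ℤ_[p])) a := by
    refine ContinuousAt.add ?_ continuousAt_const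
    refine ContinuousAt.comp (f := fun b : ℤ_[p]ˣ ↦ b * a⁻¹)
      (g := fun a : ℤ_[p]ˣ ↦ padicLogSeries (a : ℤ_[p])) (x := a) ?_ (by fun_prop)
    rw [mul_inv_cancel]
    exact h1
  refine h3.congr ?_
  have h4 : ContinuousAt (fun b : ℤ_[p]ˣ ↦ ‖((b * a⁻¹ : ℤ_[p]ˣ) : ℤ_[p]) - 1‖) a :=
    ((Units.continuous_val.comp (continuous_mul_const a⁻¹)).sub continuous_const).norm.continuousAt
  filter_upwards [h4.tendsto.eventually_lt_const (u := 1) (by rw [mul_inv_cancel]; simp)] with b hb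
  rw [← padicLogSeries_mul p hb ha]
  simp

/-- A continuous character of `ℤ_pˣ` with values in `K` is of the form `a ↦ exp (c log a)`
near `1`. -/
theorem exists_exponent [CompleteSpace K] {ψ : ℤ_[p]ˣ →* K} (hψ : Continuous ψ) :
    ∃ c : K, ∀ᶠ a : ℤ_[p]ˣ in 𝓝 1,
      ψ a = expSeriesSum (c * algebraMap ℚ_[p] K (padicLogSeries (a : ℤ_[p]))) := by
  obtain ⟨ρ, hρ, hadd, hcont, hsurj⟩ := exists_ball_expSeriesSum p K
  have hp1 : (p : ℝ)⁻¹ < 1 := inv_lt_one_of_one_lt₀ (by exact_mod_cast hp.out.one_lt)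
  have hp0 : (0 : ℝ) < (p : ℝ)⁻¹ := inv_pos.2 (by exact_mod_cast hp.out.pos)
  have h1 : ∀ᶠ a : ℤ_[p]ˣ in 𝓝 1, ∃ y : K, ‖y‖ < ρ ∧ expSeriesSum y = ψ a := by
    have := hψ.tendsto 1
    rw [map_one] at this
    exact this.eventually hsurj
  rw [Units.isOpenEmbedding_val.isInducing.nhds_eq_comap, Units.val_one,
    Metric.nhds_basis_ball.comap _ |>.eventually_iff] at h1
  obtain ⟨ε, hε, h1⟩ := h1
  obtain ⟨M0, hM0⟩ := exists_pow_lt_of_lt_one hε hp1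
  -- The summand `2` serves both the density of powers of `g = 1 + p ^ M` and the bound `p⁻ᴹ < p⁻¹`
  -- that makes `log g` nonzero. The choice of `M0` puts `ψ g` in the image of the exponential.
  set M := M0 + 2 with hMdef
  have hMε : ((p : ℝ)⁻¹) ^ M < ε :=
    (pow_le_pow_of_le_one hp0.le hp1.le (by omega)).trans_lt hM0
  have hMp : ((p : ℝ)⁻¹) ^ M < (p : ℝ)⁻¹ := by
    conv_rhs => rw [← pow_one ((p : ℝ)⁻¹)]
    exact pow_lt_pow_right_of_lt_one₀ hp0 hp1 (by omega)
  have hpM : ‖(p : ℤ_[p]) ^ M‖ = ((p : ℝ)⁻¹) ^ M := by rw [norm_pow, PadicInt.norm_p]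
  obtain ⟨g, hg⟩ := exists_unit_eq_one_add (x := (p : ℤ_[p]) ^ M) (by rw [hpM]; exact hMp.trans hp1)
  have hg1 : ‖(g : ℤ_[p]) - 1‖ = ((p : ℝ)⁻¹) ^ M := by rw [hg, add_sub_cancel_left, hpM]
  have hg1' : ‖(g : ℤ_[p]) - 1‖ < 1 := by rw [hg1]; exact hMp.trans hp1
  obtain ⟨y, hy, hyg⟩ := h1 (x := g) (by
    rw [Set.mem_preimage, Metric.mem_ball, dist_eq_norm, hg1]; exact hMε)
  have hlog : padicLogSeries (g : ℤ_[p]) ≠ 0 := by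
    refine padicLogSeries_ne_zero p (by rw [hg1]; exact hMp) fun h ↦ ?_
    rw [h, sub_self, norm_zero] at hg1
    exact absurd hg1 (pow_pos hp0 M).ne
  set lam : K := algebraMap ℚ_[p] K (padicLogSeries (g : ℤ_[p])) with hlam
  have hlam0 : lam ≠ 0 := by rw [hlam]; simpa using hlog
  -- Forced by `ψ g = exp y = exp (c log g)`.
  refine ⟨y / lam, ?_⟩
  set f : ℤ_[p]ˣ → K := fun a ↦ y / lam * algebraMap ℚ_[p] K (padicLogSeries (a : ℤ_[p])) with hf
  have hfcont : ∀ a : ℤ_[p]ˣ, ‖(a : ℤ_[p]) - 1‖ < 1 → ContinuousAt f a := fun a ha ↦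
    ((algebraMapCLM ℚ_[p] K).continuous.continuousAt.comp
      (continuousAt_padicLogSeries ha)).const_mul _
  have hfpow : ∀ n : ℕ, f (g ^ n) = n * y := fun n ↦ by
    simp only [hf, Units.val_pow_eq_pow_val]
    rw [(padicLogSeries_pow p hg1' n).2, map_mul, map_natCast, ← hlam]
    field_simp
  -- All multiples of `y` stay in the ball where the exponential is multiplicative, because natural
  -- numbers have norm at most `1`.
  have hnorm : ∀ n : ℕ, ‖(n : K) * y‖ < ρ := fun n ↦ by
    rw [norm_mul, ← map_natCast (algebraMap ℚ_[p] K), norm_algebraMap']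
    refine (mul_le_of_le_one_left (norm_nonneg y) ?_).trans_lt hy
    simpa using Padic.norm_int_le_one (p := p) n
  have hexp0 : expSeriesSum (0 : K) = 1 := by
    have := charZero_of_normedAlgebra_padic p K
    rw [expSeriesSum_eq_exp p K, NormedSpace.exp_zero]
  have hpow : ∀ n : ℕ, expSeriesSum ((n : K) * y) = ψ (g ^ n) := by
    intro n
    induction n with
    | zero => simp [hexp0]
    | succ n ih =>
      rw [Nat.cast_add, Nat.cast_one, add_mul, one_mul, hadd _ _ (hnorm n) hy, ih, hyg, pow_succ,
        map_mul]
  have hf1 : f 1 = 0 := by simpa using hfpow 0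
  have hev1 : ∀ᶠ a : ℤ_[p]ˣ in 𝓝 1, ‖f a‖ < ρ := by
    have := (hfcont 1 (by simp)).norm
    exact this.eventually (gt_mem_nhds (by simpa only [hf1, norm_zero] using hρ))
  have hev2 : ∀ᶠ a : ℤ_[p]ˣ in 𝓝 1, ‖(a : ℤ_[p]) - 1‖ < ((p : ℝ)⁻¹) ^ M := by
    have : Continuous fun a : ℤ_[p]ˣ ↦ ‖(a : ℤ_[p]) - 1‖ :=
      (Units.continuous_val.sub continuous_const).norm
    exact this.continuousAt.eventually (gt_mem_nhds (by simpa using pow_pos hp0 M))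
  filter_upwards [hev1, hev2] with a ha1 ha2
  have hmem := mem_closure_range_pow (M := M) (by omega) hg ((prime_pow_dvd_iff M _).2 ha2.le)
  have hne := mem_closure_iff_nhdsWithin_neBot.1 hmem
  have hc1 : ContinuousAt (fun a ↦ expSeriesSum (f a)) a :=
    ContinuousAt.comp (hcont _ ha1) (hfcont a (ha2.trans (hMp.trans hp1)))
  -- Both sides are continuous at `a` and agree on the powers of `g`, which accumulate at `a`.
  refine tendsto_nhds_unique (l := 𝓝[Set.range fun n : ℕ ↦ g ^ n] a)
    (hψ.continuousAt.tendsto.mono_left nhdsWithin_le_nhds)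
    ((hc1.tendsto.mono_left nhdsWithin_le_nhds).congr' ?_)
  filter_upwards [self_mem_nhdsWithin] with b hb
  obtain ⟨n, rfl⟩ := hb
  change expSeriesSum (f (g ^ n)) = ψ (g ^ n)
  rw [hfpow, hpow]

end Exponent

/-! ### Compact rings and Weierstrass division by compactness -/

section CompactRing

open Filter

set_option linter.unusedSectionVars false

variable {R A : Type*} [CommRing R] [TopologicalSpace R] [CompactSpace R]
  [Ring A] [Algebra R A] [TopologicalSpace A] [IsTopologicalRing A] [CompactSpace A] [T2Space A]
  [ContinuousSMul R A]

/-- By the tube lemma some neighbourhood of `0` multiplies the whole compact ring into a given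
neighbourhood of `0`, so the factors `z n` are arbitrary. -/
theorem tendsto_mul_zero_of_compactSpace {w : ℕ → A} (hw : Tendsto w atTop (𝓝 0)) (z : ℕ → A) :
    Tendsto (fun n ↦ w n * z n) atTop (𝓝 0) := by
  rw [tendsto_nhds]
  intro U hU h0
  have h1 : ∀ᶠ a in 𝓝 (0 : A), ∀ b ∈ (Set.univ : Set A), a * b ∈ U :=
    isCompact_univ.eventually_forall_of_forall_eventually fun b _ ↦ by
      have hc : Continuous fun q : A × A ↦ q.1 * q.2 := continuous_mul
      exact hc.continuousAt.eventually (hU.mem_nhds (by simpa using h0))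
  filter_upwards [hw.eventually h1] with n hn using hn _ trivial

/-- This replaces the summation of series: it suffices to reach a closed set up to remainders `w n *
z` with no control on `z`. -/
theorem mem_of_forall_sub_mul_mem {C : Set A} (hC : IsClosed C) {w : ℕ → A}
    (hw : Tendsto w atTop (𝓝 0)) {a : A} (h : ∀ n, ∃ z, a - w n * z ∈ C) : a ∈ C := by
  choose z hz using h
  have h1 : Tendsto (fun n ↦ a - w n * z n) atTop (𝓝 a) := by
    simpa using (tendsto_mul_zero_of_compactSpace hw z).const_sub a
  exact hC.mem_of_tendsto h1 (Eventually.of_forall hz)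

variable (R) in
/-- The closed subalgebra generated by `x`. -/
abbrev closedAdjoin (x : A) : Subalgebra R A := (Algebra.adjoin R {x}).topologicalClosure

theorem mul_comm_of_mem_closedAdjoin {x y z : A} (hy : y ∈ closedAdjoin R x)
    (hz : z ∈ closedAdjoin R x) : y * z = z * y := by
  let _ := Subalgebra.commRingTopologicalClosure (Algebra.adjoin R {x})
    (fun a b ↦ mul_comm a b)
  exact congrArg Subtype.val (mul_comm (⟨y, hy⟩ : closedAdjoin R x) ⟨z, hz⟩)

theorem isCompact_closedAdjoin (x : A) : IsCompact (closedAdjoin R x : Set A) :=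
  (Subalgebra.isClosed_topologicalClosure _).isCompact

theorem self_mem_closedAdjoin (x : A) : x ∈ closedAdjoin R x :=
  Subalgebra.le_topologicalClosure _ (Algebra.self_mem_adjoin_singleton R x)

/-- Elements of the closed subalgebra play the role of power series in `x`, and this splits off a
constant term. The set of all `r + x z` is compact, hence closed, and contains the polynomials in
`x`. -/
theorem exists_eq_algebraMap_add_mul {x y : A} (hy : y ∈ closedAdjoin R x) :
    ∃ r : R, ∃ z ∈ closedAdjoin R x, y = algebraMap R A r + x * z := by
  let f : R × closedAdjoin R x → A := fun q ↦ q.1 • 1 + x * q.2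
  have : CompactSpace (closedAdjoin R x) := isCompact_iff_compactSpace.1 (isCompact_closedAdjoin x)
  have hf : Continuous f := by fun_prop
  have hcl : IsClosed (Set.range f) := (isCompact_range hf).isClosed
  have hsub : ((Algebra.adjoin R {x} : Subalgebra R A) : Set A) ⊆ Set.range f := by
    intro a ha
    rw [SetLike.mem_coe, Algebra.adjoin_singleton_eq_range_aeval] at ha
    obtain ⟨q, rfl⟩ := ha
    refine ⟨(q.coeff 0, ⟨Polynomial.aeval x q.divX, Subalgebra.le_topologicalClosure _ ?_⟩), ?_⟩
    · exact Polynomial.aeval_mem_adjoin_singleton R x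
    · have h := congrArg (Polynomial.aeval x) (Polynomial.X_mul_divX_add q)
      rwa [map_add, map_mul, Polynomial.aeval_X, Polynomial.aeval_C,
        Algebra.algebraMap_eq_smul_one, add_comm] at h
  obtain ⟨⟨r, z⟩, hrz⟩ := closure_minimal hsub hcl hy
  exact ⟨r, z, z.2, by rw [← hrz, Algebra.algebraMap_eq_smul_one]⟩

theorem exists_eq_sum_add_pow_mul {x y : A} (hy : y ∈ closedAdjoin R x) (d : ℕ) :
    ∃ c : Fin d → R, ∃ z ∈ closedAdjoin R x, y = ∑ i, c i • x ^ (i : ℕ) + x ^ d * z := by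
  induction d with
  | zero => exact ⟨0, y, hy, by simp⟩
  | succ d ih =>
    obtain ⟨c, z, hz, h⟩ := ih
    obtain ⟨r, z', hz', h'⟩ := exists_eq_algebraMap_add_mul hz
    refine ⟨Fin.snoc c r, z', hz', ?_⟩
    rw [h, h', Fin.sum_univ_castSucc, mul_add, ← Algebra.commutes, ← Algebra.smul_def]
    simp [pow_succ, mul_assoc, add_assoc]

/-- A power series with unit constant term divides every other. Cancelling the constant term of the
remainder by a multiple of `y` pushes it to the next power of `x`. -/
theorem exists_eq_mul_of_isUnit {x y z : A} (hx : Tendsto (fun n ↦ x ^ n) atTop (𝓝 0)) {r : R}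
    (hr : IsUnit r) {y' : A} (hy' : y' ∈ closedAdjoin R x) (hy : y = algebraMap R A r + x * y')
    (hz : z ∈ closedAdjoin R x) : ∃ w ∈ closedAdjoin R x, z = y * w := by
  have hym : y ∈ closedAdjoin R x := by
    rw [hy]
    exact add_mem (algebraMap_mem _ r) (mul_mem (self_mem_closedAdjoin x) hy')
  have hcl : IsClosed ((fun w ↦ y * w) '' (closedAdjoin R x : Set A)) :=
    ((isCompact_closedAdjoin x).image (continuous_const_mul y)).isClosed
  have key : ∀ n, ∃ z' ∈ closedAdjoin R x, ∃ w ∈ closedAdjoin R x, z = y * w + x ^ n * z' := by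
    intro n
    induction n with
    | zero => exact ⟨z, hz, 0, zero_mem _, by simp⟩
    | succ n ih =>
      obtain ⟨z', hz', w, hw, h⟩ := ih
      obtain ⟨a, u, hu, h'⟩ := exists_eq_algebraMap_add_mul hz'
      obtain ⟨r, rfl⟩ := hr
      have hx' : x ^ n ∈ closedAdjoin R x := pow_mem (self_mem_closedAdjoin x) n
      set e : A := algebraMap R A (a * ↑r⁻¹) with he
      have hem : e ∈ closedAdjoin R x := algebraMap_mem _ _
      have h1 : algebraMap R A a = y * e - x * y' * e := by
        rw [hy, add_mul, add_sub_cancel_right, he, ← map_mul]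
        congr 1
        rw [mul_left_comm, Units.mul_inv, mul_one]
      refine ⟨u - y' * e, sub_mem hu (mul_mem hy' hem), w + x ^ n * e,
        add_mem hw (mul_mem hx' hem), ?_⟩
      rw [h, h', h1, mul_add y, ← mul_assoc y, mul_comm_of_mem_closedAdjoin hym hx', pow_succ]
      noncomm_ring
  obtain ⟨w, hw, h⟩ := mem_of_forall_sub_mul_mem hcl hx (a := z) fun n ↦ by
    obtain ⟨z', -, w, hw, h⟩ := key n
    exact ⟨z', w, hw, by simp [h]⟩
  exact ⟨w, hw, h.symm⟩

/-- Weierstrass preparation modulo `ϖ`. -/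
theorem exists_eq_pow_mul_add {ϖ : R} (hϖ : ∀ r : R, IsUnit r ∨ ϖ ∣ r) {x y : A}
    (hx : Tendsto (fun n ↦ x ^ n) atTop (𝓝 0)) (hy : y ∈ closedAdjoin R x) :
    (∃ u ∈ closedAdjoin R x, y = ϖ • u) ∨ ∃ (d : ℕ) (r : R) (y' u : A), IsUnit r ∧
      y' ∈ closedAdjoin R x ∧ u ∈ closedAdjoin R x ∧
      y = x ^ d * (algebraMap R A r + x * y') + ϖ • u := by
  by_cases hex : ∃ (d : ℕ) (r : R) (y' u : A), IsUnit r ∧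
      y' ∈ closedAdjoin R x ∧ u ∈ closedAdjoin R x ∧
      y = x ^ d * (algebraMap R A r + x * y') + ϖ • u
  · exact Or.inr hex
  left
  -- If no unit coefficient is ever met, each constant term goes into the multiple of `ϖ` and the
  -- rest is divisible by an ever higher power of `x`.
  have key : ∀ n, ∃ z ∈ closedAdjoin R x, ∃ u ∈ closedAdjoin R x, y = x ^ n * z + ϖ • u := by
    intro n
    induction n with
    | zero => exact ⟨y, hy, 0, zero_mem _, by simp⟩
    | succ n ih =>
      obtain ⟨z, hz, u, hu, h⟩ := ih
      obtain ⟨r, z', hz', h'⟩ := exists_eq_algebraMap_add_mul hz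
      rcases hϖ r with hr | ⟨r', rfl⟩
      · exact absurd ⟨n, r, z', u, hr, hz', hu, by rw [h, h']⟩ hex
      · refine ⟨z', hz', u + r' • x ^ n,
          add_mem hu (Subalgebra.smul_mem _ (pow_mem (self_mem_closedAdjoin x) n) _), ?_⟩
        rw [h, h', mul_add, ← Algebra.commutes, ← Algebra.smul_def, pow_succ, smul_add, smul_smul,
          mul_assoc]
        abel
  have hcl : IsClosed ((fun u ↦ ϖ • u) '' (closedAdjoin R x : Set A)) :=
    ((isCompact_closedAdjoin x).image (continuous_const_smul ϖ)).isClosed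
  obtain ⟨u, hu, h⟩ := mem_of_forall_sub_mul_mem hcl hx (a := y) fun n ↦ by
    obtain ⟨z, -, u, hu, h⟩ := key n
    exact ⟨z, u, hu, by simp [h]⟩
  exact ⟨u, hu, h.symm⟩

/-- A finitely generated left ideal is the image of a compact power of `A`. This is why topological
generation of the triangular group by a finite set matters. -/
theorem isClosed_span_range {S : Type*} [Finite S] (s : S → A) :
    IsClosed (Submodule.span A (Set.range s) : Set A) := by
  have := Fintype.ofFinite S
  have h : (Submodule.span A (Set.range s) : Set A) = Set.range fun c : S → A ↦ ∑ i, c i * s i := by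
    ext a
    rw [SetLike.mem_coe, Submodule.mem_span_range_iff_exists_fun]
    rfl
  rw [h]
  exact (isCompact_range (by fun_prop)).isClosed

/-- Let `J` be a closed left ideal of `A` such that `A / J` is generated by the closed subalgebra
topologically generated by `x`. For `m ∉ J`, up to division by a power of `ϖ`, the quotient of `A`
by `J + A m` is finitely generated over `R`. -/
theorem exists_finite_generation {ϖ : R} (hϖ : ∀ r : R, IsUnit r ∨ ϖ ∣ r)
    (hϖ0 : Tendsto (fun n ↦ algebraMap R A ϖ ^ n) atTop (𝓝 0)) {x : A}
    (hx : Tendsto (fun n ↦ x ^ n) atTop (𝓝 0)) {J : Submodule A A} (hJ : IsClosed (J : Set A))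
    (hYJ : ∀ a : A, ∃ y ∈ closedAdjoin R x, a - y ∈ J) {m : A} (hm : m ∉ J) :
    ∃ (n d : ℕ) (m' : A), m - ϖ ^ n • m' ∈ J ∧
      ∀ a : A, ∃ (c : Fin d → R) (b : A), a - (∑ i, c i • x ^ (i : ℕ) + b * m') ∈ J := by
  have hsmul : ∀ (r : R) {j : A}, j ∈ J → r • j ∈ J := fun r j hj ↦ by
    rw [Algebra.smul_def]
    exact J.smul_mem _ hj
  -- Modulo `J`, divide `m` by `ϖ` as often as possible. Unlimited division would put `m` in the
  -- closed ideal `J`.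
  obtain ⟨n, m', hmm, hm'⟩ : ∃ (n : ℕ) (m' : A), m - ϖ ^ n • m' ∈ J ∧ ∀ a, m' - ϖ • a ∉ J := by
    by_contra! hcon
    have key : ∀ n : ℕ, ∃ m', m - ϖ ^ n • m' ∈ J := by
      intro n
      induction n with
      | zero => exact ⟨m, by simp⟩
      | succ n ih =>
        obtain ⟨m', h'⟩ := ih
        obtain ⟨a, ha⟩ := hcon n m' h'
        refine ⟨a, ?_⟩
        have : m - ϖ ^ (n + 1) • a = (m - ϖ ^ n • m') + ϖ ^ n • (m' - ϖ • a) := by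
          rw [smul_sub, smul_smul, pow_succ]
          abel
        rw [this]
        exact add_mem h' (hsmul _ ha)
    refine hm (mem_of_forall_sub_mul_mem hJ hϖ0 fun n ↦ ?_)
    obtain ⟨m', h'⟩ := key n
    exact ⟨m', by rwa [← map_pow, ← Algebra.smul_def]⟩
  obtain ⟨y, hy, hyj⟩ := hYJ m'
  rcases exists_eq_pow_mul_add hϖ hx hy with ⟨u, -, rfl⟩ | ⟨d, r, y', u, hr, hy', hu, hyd⟩
  · exact absurd hyj (hm' u)
  refine ⟨n, d, m', hmm, ?_⟩
  -- The range of `L` is compact, so it is enough to reach every element modulo each `ϖ ^ n`; one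
  -- step modulo `ϖ` is iterated.
  let L : ((Fin d → R) × A × J) → A := fun q ↦ ∑ i, q.1 i • x ^ (i : ℕ) + q.2.1 * m' + q.2.2
  have : CompactSpace J := isCompact_iff_compactSpace.1 hJ.isCompact
  have hL : Continuous L := by fun_prop
  have hcl : IsClosed (Set.range L) := (isCompact_range hL).isClosed
  have hstep : ∀ a : A, ∃ q z, a = L q + ϖ • z := by
    intro a
    obtain ⟨ya, hya, hja⟩ := hYJ a
    obtain ⟨c, z, hz, h⟩ := exists_eq_sum_add_pow_mul hya d
    obtain ⟨w, hw, hzw⟩ := exists_eq_mul_of_isUnit hx hr hy' rfl hz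
    refine ⟨⟨c, w, ⟨(a - ya) - w * (m' - y), sub_mem hja (J.smul_mem w hyj)⟩⟩, -(u * w), ?_⟩
    -- Here `y = x ^ d e + ϖ u` with `e` of unit constant term and `z = e w`. So the tail of degree
    -- at least `d` is `w y` modulo `ϖ`, and `y` may be replaced by `m'` at the cost of an element
    -- of `J`.
    have h1 : x ^ d * z = w * y - ϖ • (u * w) := by
      rw [← mul_comm_of_mem_closedAdjoin hy hw, hyd, hzw]
      generalize algebraMap R A r + x * y' = e
      rw [add_mul, smul_mul_assoc, mul_assoc, add_sub_cancel_right]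
    simp only [L]
    rw [h1] at h
    rw [smul_neg, mul_sub, h]
    abel
  have hadd : ∀ q q' (r : R), ∃ q'', L q + r • L q' = L q'' := by
    intro q q' r
    refine ⟨⟨q.1 + r • q'.1, q.2.1 + r • q'.2.1, ⟨q.2.2 + r • (q'.2.2 : A),
      add_mem q.2.2.2 (hsmul r q'.2.2.2)⟩⟩, ?_⟩
    simp only [L, Pi.add_apply, Pi.smul_apply, add_smul, Finset.sum_add_distrib, smul_add,
      Finset.smul_sum, smul_eq_mul, mul_smul, add_mul, smul_mul_assoc]
    abel
  have hiter : ∀ (a : A) (n : ℕ), ∃ q z, a = L q + ϖ ^ n • z := by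
    intro a n
    induction n with
    | zero => exact ⟨0, a, by simp [L]⟩
    | succ n ih =>
      obtain ⟨q, z, h⟩ := ih
      obtain ⟨q', z', h'⟩ := hstep z
      obtain ⟨q'', h''⟩ := hadd q q' (ϖ ^ n)
      exact ⟨q'', z', by rw [← h'', h, h', smul_add, smul_smul, pow_succ, ← add_assoc]⟩
  intro a
  obtain ⟨q, hq⟩ : a ∈ Set.range L := mem_of_forall_sub_mul_mem hcl hϖ0 fun n ↦ by
    obtain ⟨q, z, h⟩ := hiter a n
    refine ⟨z, q, ?_⟩
    rw [← map_pow, ← Algebra.smul_def]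
    exact eq_sub_of_add_eq h.symm
  refine ⟨q.1, q.2.1, ?_⟩
  rw [← hq]
  simp only [L, add_sub_cancel_left]
  exact q.2.2.2

end CompactRing

/-! ### The profinite topology of a completed group ring -/

namespace CompletedGroupRing

open Filter

set_option linter.unusedSectionVars false

variable {R : Type*} [CommRing R] [TopologicalSpace R] [IsTopologicalRing R]
  {G : Type*} [Group G] [TopologicalSpace G]

/-- The coefficients of all images of an element of `R[[G]]` in the group rings `R[G/H]`. -/
def coeffs (x : CompletedGroupRing R G) (H : OpenNormalSubgroup G) (q : G ⧸ H.toSubgroup) : R :=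
  (x.1 H).coeff q

theorem coeffs_injective : Function.Injective (coeffs (R := R) (G := G)) := by
  intro x y h
  apply Subtype.ext
  funext H
  ext q
  exact congrFun (congrFun h H) q

instance : TopologicalSpace (CompletedGroupRing R G) := TopologicalSpace.induced coeffs
    inferInstance

theorem isInducing_coeffs : Topology.IsInducing (coeffs (R := R) (G := G)) := ⟨rfl⟩

theorem continuous_coeffs (H : OpenNormalSubgroup G) (q : G ⧸ H.toSubgroup) :
    Continuous fun x : CompletedGroupRing R G ↦ coeffs x H q :=
  (continuous_apply q).comp ((continuous_apply H).comp isInducing_coeffs.continuous)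

theorem continuous_iff_coeffs {Y : Type*} [TopologicalSpace Y] {f : Y → CompletedGroupRing R G} :
    Continuous f ↔ ∀ H q, Continuous fun y ↦ coeffs (f y) H q := by
  rw [isInducing_coeffs.continuous_iff, continuous_pi_iff]
  exact forall_congr' fun H ↦ continuous_pi_iff

theorem tendsto_iff_coeffs {Y : Type*} {l : Filter Y} {f : Y → CompletedGroupRing R G}
    {a : CompletedGroupRing R G} :
    Tendsto f l (𝓝 a) ↔ ∀ H q, Tendsto (fun y ↦ coeffs (f y) H q) l (𝓝 (coeffs a H q)) := by
  rw [isInducing_coeffs.tendsto_nhds_iff, tendsto_pi_nhds]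
  exact forall_congr' fun H ↦ tendsto_pi_nhds

instance [T2Space R] : T2Space (CompletedGroupRing R G) :=
  T2Space.of_injective_continuous coeffs_injective isInducing_coeffs.continuous

theorem coeffs_add (x y : CompletedGroupRing R G) (H : OpenNormalSubgroup G)
    (q : G ⧸ H.toSubgroup) : coeffs (x + y) H q = coeffs x H q + coeffs y H q := rfl

theorem coeffs_smul (r : R) (x : CompletedGroupRing R G) (H : OpenNormalSubgroup G)
    (q : G ⧸ H.toSubgroup) : coeffs (r • x) H q = r * coeffs x H q := rfl

theorem coeffs_of (g : G) (H : OpenNormalSubgroup G) [DecidableEq (G ⧸ H.toSubgroup)]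
    (q : G ⧸ H.toSubgroup) :
    coeffs (of R g) H q = if (QuotientGroup.mk g : G ⧸ H.toSubgroup) = q then 1 else 0 := by
  simp only [coeffs, of, MonoidAlgebra.of_apply, MonoidAlgebra.coeff_single, Finsupp.single_apply]

theorem of_mul (g h : G) : of R (g * h) = of R g * of R h := by
  apply Subtype.ext
  funext H
  exact map_mul (MonoidAlgebra.of R (G ⧸ H.toSubgroup)) (QuotientGroup.mk g) (QuotientGroup.mk h)

theorem of_one : of R (1 : G) = 1 := by
  apply Subtype.ext
  funext H
  exact map_one (MonoidAlgebra.of R (G ⧸ H.toSubgroup))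

theorem of_pow (g : G) (n : ℕ) : of R (g ^ n) = of R g ^ n := by
  induction n with
  | zero => simp [of_one]
  | succ n ih => rw [pow_succ, pow_succ, of_mul, ih]

section Compact

variable [IsTopologicalGroup G] [CompactSpace G]

instance (H : OpenNormalSubgroup G) : Finite (G ⧸ H.toSubgroup) :=
  Subgroup.quotient_finite_of_isOpen _ H.isOpen'

theorem coeffs_mul (x y : CompletedGroupRing R G) (H : OpenNormalSubgroup G)
    [Fintype (G ⧸ H.toSubgroup)] (q : G ⧸ H.toSubgroup) :
    coeffs (x * y) H q = ∑ a, coeffs x H a * coeffs y H (a⁻¹ * q) := by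
  classical
  change (x.1 H * y.1 H).coeff q = _
  rw [MonoidAlgebra.coeff_mul, Finsupp.sum_fintype _ _ (by simp)]
  refine Finset.sum_congr rfl fun a _ ↦ ?_
  rw [Finsupp.sum_fintype _ _ (by simp), Finset.sum_eq_single (a⁻¹ * q)]
  · simp [coeffs]
  · intro b _ hb
    rw [if_neg]
    rintro rfl
    simp at hb
  · simp

instance : IsTopologicalRing (CompletedGroupRing R G) where
  continuous_add := continuous_iff_coeffs.2 fun H q ↦
    ((continuous_coeffs H q).comp continuous_fst).add ((continuous_coeffs H q).comp continuous_snd)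
  continuous_neg := continuous_iff_coeffs.2 fun H q ↦ (continuous_coeffs H q).neg
  continuous_mul := continuous_iff_coeffs.2 fun H q ↦ by
    have := Fintype.ofFinite (G ⧸ H.toSubgroup)
    simp only [coeffs_mul]
    exact continuous_finsetSum _ fun a _ ↦ ((continuous_coeffs H _).comp continuous_fst).mul
      ((continuous_coeffs H _).comp continuous_snd)

instance : ContinuousSMul R (CompletedGroupRing R G) where
  continuous_smul := continuous_iff_coeffs.2 fun H q ↦
    continuous_fst.mul ((continuous_coeffs H q).comp continuous_snd)

theorem coeff_groupRingTransition {H H' : OpenNormalSubgroup G} (h : H ≤ H')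
    [Fintype (G ⧸ H.toSubgroup)] [DecidableEq (G ⧸ H'.toSubgroup)]
    (x : MonoidAlgebra R (G ⧸ H.toSubgroup)) (q' : G ⧸ H'.toSubgroup) :
    (groupRingTransition R h x).coeff q' = ∑ q, if QuotientGroup.map H.toSubgroup H'.toSubgroup
      (MonoidHom.id G) h q = q' then x.coeff q else 0 := by
  rw [groupRingTransition, MonoidAlgebra.mapDomainAlgHom_apply, MonoidAlgebra.coeff_mapDomain,
    Finsupp.mapDomain, Finsupp.sum_apply, Finsupp.sum_fintype _ _ (by simp)]
  exact Finset.sum_congr rfl fun q _ ↦ by rw [Finsupp.single_apply]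

/-- The image in the product of all coefficient spaces is cut out by finite sums of coordinates, so
it is closed. Compactness of `R[[G]]` comes from here. -/
theorem range_coeffs [∀ H : OpenNormalSubgroup G, Fintype (G ⧸ H.toSubgroup)]
    [∀ H : OpenNormalSubgroup G, DecidableEq (G ⧸ H.toSubgroup)] :
    Set.range (coeffs (R := R) (G := G)) = {f | ∀ (H H' : OpenNormalSubgroup G) (h : H ≤ H')
      (q' : G ⧸ H'.toSubgroup), (∑ q, if QuotientGroup.map H.toSubgroup H'.toSubgroup
      (MonoidHom.id G) h q = q' then f H q else 0) = f H' q'} := by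
  ext f
  constructor
  · rintro ⟨x, rfl⟩ H H' h q'
    have := x.2 H H' h
    exact (coeff_groupRingTransition (R := R) h (x.1 H) q').symm.trans (by rw [this]; rfl)
  · intro hf
    refine ⟨⟨fun H ↦ MonoidAlgebra.ofCoeff (Finsupp.equivFunOnFinite.symm (f H)),
      fun H H' h ↦ ?_⟩, ?_⟩
    · ext q'
      rw [coeff_groupRingTransition]
      exact hf H H' h q'
    · funext H q
      rfl

instance [CompactSpace R] [T2Space R] : CompactSpace (CompletedGroupRing R G) := by
  classical
  have (H : OpenNormalSubgroup G) : Fintype (G ⧸ H.toSubgroup) := Fintype.ofFinite _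
  have hcl : IsClosed (Set.range (coeffs (R := R) (G := G))) := by
    rw [range_coeffs]
    simp only [Set.ofPred_forall]
    refine isClosed_iInter fun H ↦ isClosed_iInter fun H' ↦ isClosed_iInter fun h ↦
      isClosed_iInter fun q' ↦ isClosed_eq ?_ ?_
    · refine continuous_finsetSum _ fun q _ ↦ ?_
      split_ifs
      · exact (continuous_apply q).comp (continuous_apply H)
      · exact continuous_const
    · exact (continuous_apply q').comp (continuous_apply H')
  exact Topology.IsClosedEmbedding.compactSpace
    (f := coeffs (R := R) (G := G)) ⟨⟨isInducing_coeffs, coeffs_injective⟩, hcl⟩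

theorem continuous_of : Continuous (of R : G → CompletedGroupRing R G) := by
  classical
  refine continuous_iff_coeffs.2 fun H q ↦ ?_
  have : DiscreteTopology (G ⧸ H.toSubgroup) := QuotientGroup.discreteTopology H.isOpen'
  simp only [coeffs_of]
  exact (continuous_of_discreteTopology (f := fun a : G ⧸ H.toSubgroup ↦
    if a = q then (1 : R) else 0)).comp continuous_quotient_mk'

/-- The span of the group elements is dense in `R[[G]]`. -/
theorem mem_of_forall_of_mem {C : Submodule R (CompletedGroupRing R G)}
    (hC : IsClosed (C : Set (CompletedGroupRing R G))) (h : ∀ g, of R g ∈ C)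
    (x : CompletedGroupRing R G) : x ∈ C := by
  have key : ∀ H : OpenNormalSubgroup G, ∃ c ∈ C, c.1 H = x.1 H := by
    intro H
    refine ⟨(x.1 H).coeff.sum fun q r ↦ r • of R q.out, ?_, ?_⟩
    · exact Submodule.sum_mem _ fun q _ ↦ C.smul_mem _ (h _)
    · let ev : CompletedGroupRing R G →ₐ[R] MonoidAlgebra R (G ⧸ H.toSubgroup) :=
        (Pi.evalAlgHom R _ H).comp (CompletedGroupRing R G).val
      change ev _ = _
      rw [Finsupp.sum, map_sum]
      apply MonoidAlgebra.coeff_injective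
      ext q
      have hof : ∀ q : G ⧸ H.toSubgroup, ev (of R q.out) = MonoidAlgebra.single q 1 := by
        intro q
        change MonoidAlgebra.of R _ (QuotientGroup.mk q.out) = _
        rw [MonoidAlgebra.of_apply, QuotientGroup.out_eq']
      simp only [map_smul, hof]
      classical
      simp [MonoidAlgebra.coeff_sum, Finsupp.finsetSum_apply, Finsupp.single_apply, eq_comm]
  choose c hcC hc using key
  have : Nonempty (OpenNormalSubgroup G) := ⟨{ (⊤ : OpenSubgroup G) with isNormal' :=
      inferInstanceAs (⊤ : Subgroup G).Normal }⟩
  -- The net is indexed by shrinking `H`; at each level its coefficients are eventually constant.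
  have hlim : Tendsto c atBot (𝓝 x) := by
    refine tendsto_iff_coeffs.2 fun H q ↦ tendsto_const_nhds.congr' ?_
    filter_upwards [eventually_le_atBot H] with H' hH'
    simp only [coeffs]
    rw [← (c H').2 H' H hH', hc, x.2 H' H hH']
  exact hC.mem_of_tendsto hlim (Eventually.of_forall hcC)

/-- Modulo `p` the power is `v ^ pᵏ + (-1) ^ pᵏ` with `v ^ pᵏ = 1`. The sum is `0`, except for `p =
2` and `k > 0`, where it is `2`. -/
theorem exists_of_sub_one_pow_eq {p : ℕ} (hp : p.Prime) {u : G} {H : OpenNormalSubgroup G} {k : ℕ}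
    (hk : u ^ p ^ k ∈ H) : ∃ r : MonoidAlgebra R (G ⧸ H.toSubgroup),
      ((of R u - 1 : CompletedGroupRing R G) ^ p ^ k).1 H = p * r := by
  let v := MonoidAlgebra.of R (G ⧸ H.toSubgroup) (QuotientGroup.mk u)
  have hv : v ^ p ^ k = 1 := by
    rw [← map_pow, ← QuotientGroup.mk_pow, (QuotientGroup.eq_one_iff _).2 hk, map_one]
  obtain ⟨r, hr⟩ := (Commute.neg_one_right v).exists_add_pow_prime_pow_eq hp k
  obtain ⟨s, hs⟩ : ∃ s : MonoidAlgebra R (G ⧸ H.toSubgroup), 1 + (-1) ^ p ^ k = p * s := by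
    rcases hp.eq_two_or_odd' with rfl | hodd
    · rcases Nat.eq_zero_or_pos k with rfl | hk0
      · exact ⟨0, by simp⟩
      · refine ⟨1, ?_⟩
        rw [Even.neg_one_pow (Nat.even_pow.2 ⟨even_two, hk0.ne'⟩)]
        norm_num
    · exact ⟨0, by rw [Odd.neg_one_pow (hodd.pow)]; simp⟩
  refine ⟨s + v * -1 * r, ?_⟩
  change (v - 1) ^ p ^ k = _
  rw [sub_eq_add_neg, hr, hv, hs]
  noncomm_ring

/-- At level `H` the `pᵏ`-th power is divisible by `p`, hence the `n`-th power by `p ^ (n / pᵏ)`. -/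
theorem tendsto_of_sub_one_pow [CompactSpace R] [T2Space R] {p : ℕ} (hp : p.Prime)
    (hpR : Tendsto (fun n ↦ (p : R) ^ n) atTop (𝓝 0)) {u : G}
    (hu : ∀ H : OpenNormalSubgroup G, ∃ k, u ^ p ^ k ∈ H) :
    Tendsto (fun n ↦ (of R u - 1 : CompletedGroupRing R G) ^ n) atTop (𝓝 0) := by
  refine tendsto_iff_coeffs.2 fun H q ↦ ?_
  obtain ⟨k, hk⟩ := hu H
  obtain ⟨r, hr⟩ := exists_of_sub_one_pow_eq (R := R) hp hk
  have hpk : 0 < p ^ k := pow_pos hp.pos k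
  have hdiv : Tendsto (fun n ↦ n / p ^ k) atTop atTop := Nat.tendsto_div_const_atTop hpk.ne'
  have key : ∀ n, ∃ z, coeffs ((of R u - 1 : CompletedGroupRing R G) ^ n) H q =
      (p : R) ^ (n / p ^ k) * z := by
    intro n
    set X : CompletedGroupRing R G := of R u - 1 with hX
    refine ⟨((r ^ (n / p ^ k)) * (X ^ (n % p ^ k)).1 H).coeff q, ?_⟩
    have h1 : (X ^ n).1 H = (p : R) ^ (n / p ^ k) • ((r ^ (n / p ^ k)) * (X ^ (n % p ^ k)).1 H)
        := by
      conv_lhs => rw [← Nat.div_add_mod n (p ^ k), pow_add, pow_mul]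
      change ((X ^ p ^ k).1 H) ^ (n / p ^ k) * (X ^ (n % p ^ k)).1 H = _
      rw [hr, (Nat.cast_commute p r).mul_pow, Algebra.smul_def, map_pow, map_natCast, mul_assoc]
    simp only [coeffs, h1]
    rfl
  choose z hz using key
  simp only [hz]
  exact tendsto_mul_zero_of_compactSpace (hpR.comp hdiv) z

end Compact

end CompletedGroupRing

/-! ### The ring of integers of a finite extension of `ℚ_p` -/

section RingOfIntegers

open Filter

set_option linter.unusedSectionVars false

variable (p : ℕ) [hp : Fact p.Prime] (K : Type*) [NormedField K] [IsUltrametricDist K]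
  [NormedAlgebra ℚ_[p] K]

include p in
theorem compactSpace_ringOfIntegersOf [FiniteDimensional ℚ_[p] K] :
    CompactSpace (RingOfIntegersOf K) := by
  have : ProperSpace K := FiniteDimensional.proper ℚ_[p] K
  have h : ((RingOfIntegersOf K : Subring K) : Set K) = Metric.closedBall 0 1 := by
    ext x
    simp [Valuation.mem_integer_iff]
    rfl
  exact isCompact_iff_compactSpace.1 (h ▸ isCompact_closedBall (0 : K) 1)

omit [NormedAlgebra ℚ_[p] K] hp in
theorem tendsto_ringOfIntegersOf_pow {r : RingOfIntegersOf K} (hr : ‖(r : K)‖ < 1) :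
    Tendsto (fun n : ℕ ↦ r ^ n) atTop (𝓝 0) := by
  rw [tendsto_subtype_rng]
  simpa using tendsto_pow_atTop_nhds_zero_of_norm_lt_one hr

theorem norm_natCast_prime_lt_one : ‖(p : K)‖ < 1 := by
  rw [norm_natCast_prime p K]
  exact inv_lt_one_of_one_lt₀ (by exact_mod_cast hp.out.one_lt)

include p in
-- The open unit ball is also closed, hence compact, so its norm attains a maximum; a maximiser
-- divides every nonunit. It is nonzero because the ball contains `p`.
theorem exists_uniformizer [FiniteDimensional ℚ_[p] K] :
    ∃ ϖ : RingOfIntegersOf K, (ϖ : K) ≠ 0 ∧ ‖(ϖ : K)‖ < 1 ∧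
      ∀ r : RingOfIntegersOf K, IsUnit r ∨ ϖ ∣ r := by
  have : ProperSpace K := FiniteDimensional.proper ℚ_[p] K
  have hc : IsCompact (Metric.ball (0 : K) 1) :=
    Metric.isCompact_of_isClosed_isBounded (IsUltrametricDist.isClosed_ball 0 1)
      Metric.isBounded_ball
  obtain ⟨z, hz, hmax⟩ := hc.exists_isMaxOn ⟨0, by simp⟩ continuous_norm.continuousOn
  have hp0 : 0 < ‖(p : K)‖ := by
    rw [norm_natCast_prime p K]
    exact inv_pos.2 (by exact_mod_cast hp.out.pos)
  have hz1 : ‖z‖ < 1 := by simpa using hz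
  have hz0 : 0 < ‖z‖ := hp0.trans_le (hmax (by simpa using norm_natCast_prime_lt_one p K))
  refine ⟨⟨z, hz1.le⟩, norm_pos_iff.1 hz0, hz1, fun r ↦ ?_⟩
  have hr : ‖(r : K)‖ ≤ 1 := r.2
  rcases hr.lt_or_eq with hlt | heq
  · right
    have hle : ‖(r : K)‖ ≤ ‖z‖ := hmax (by simpa using hlt)
    refine ⟨⟨r / z, ?_⟩, ?_⟩
    · change ‖(r : K) / z‖ ≤ 1
      rw [norm_div]
      exact div_le_one_of_le₀ hle hz0.le
    · apply Subtype.ext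
      exact (mul_div_cancel₀ _ (norm_pos_iff.1 hz0)).symm
  · left
    have hr0 : (r : K) ≠ 0 := by rw [← norm_pos_iff, heq]; exact one_pos
    refine IsUnit.of_mul_eq_one ⟨(r : K)⁻¹, ?_⟩ ?_
    · change ‖(r : K)⁻¹‖ ≤ 1
      rw [norm_inv, heq, inv_one]
    · apply Subtype.ext
      exact mul_inv_cancel₀ hr0

theorem isOpen_pIdeal_pow (n : ℕ) : IsOpen ((pIdeal p K ^ n : Ideal (RingOfIntegersOf K)) :
    Set (RingOfIntegersOf K)) := by
  have h : ((pIdeal p K ^ n : Ideal (RingOfIntegersOf K)) : Set (RingOfIntegersOf K)) =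
      Subtype.val ⁻¹' Metric.closedBall (0 : K) (((p : ℝ)⁻¹) ^ n) := by
    ext x
    rw [SetLike.mem_coe, mem_pIdeal_pow]
    simp
  rw [h]
  exact (IsUltrametricDist.isOpen_closedBall (0 : K) (pow_ne_zero _
    (inv_ne_zero (by exact_mod_cast hp.out.ne_zero)))).preimage continuous_subtype_val

/-- A linear functional is continuous if its reductions modulo `p ^ n` have open kernels. -/
theorem continuous_of_isOpen_preimage_pIdeal {A : Type*} [AddCommGroup A] [TopologicalSpace A]
    [IsTopologicalAddGroup A] (L : A →+ RingOfIntegersOf K)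
    (h : ∀ n, IsOpen {x | L x ∈ pIdeal p K ^ n}) : Continuous L := by
  refine continuous_of_continuousAt_zero L ?_
  rw [ContinuousAt, map_zero, tendsto_nhds]
  intro U hU h0
  obtain ⟨ε, hε, hεU⟩ := Metric.isOpen_iff.1 hU 0 h0
  obtain ⟨n, hn⟩ := exists_pow_lt_of_lt_one hε
    (inv_lt_one_of_one_lt₀ (by exact_mod_cast hp.out.one_lt : (1 : ℝ) < p))
  have hmem : {x | L x ∈ pIdeal p K ^ n} ∈ 𝓝 (0 : A) := (h n).mem_nhds (by simp)
  filter_upwards [hmem] with x hx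
  refine hεU ?_
  rw [Metric.mem_ball, dist_zero_right]
  exact ((mem_pIdeal_pow p n (L x)).1 hx).trans_lt hn

end RingOfIntegers

/-! ### Base change of a character -/

section BaseChange

variable {K R A : Type*} [Field K] [Ring R] [Ring A]

/-- An element of `K`, viewed as a vector of the module `ScalarModule φ`. -/
def scalarVector (φ : R →+* K) (k : K) : ScalarModule φ := k

theorem smul_scalarVector (φ : R →+* K) (r : R) (k : K) :
    r • scalarVector φ k = scalarVector φ (φ r * k) := rfl

/-- The generator `1 ⊗ 1` of `A ⊗_R K`. -/
def cyclicVector (f : R →+* A) (φ : R →+* K) : BaseChangeModule f (ScalarModule φ) :=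
  Submodule.Quotient.mk ((1 : A) ⊗ₜ[ℤ] scalarVector φ 1)

theorem smul_cyclicVector_eq (f : R →+* A) (φ : R →+* K) (a : A) (r : R) :
    (a * f r) • cyclicVector f φ = Submodule.Quotient.mk (a ⊗ₜ[ℤ] scalarVector φ (φ r)) := by
  rw [cyclicVector, ← Submodule.Quotient.mk_smul, TensorProduct.smul_tmul', smul_eq_mul, mul_one,
    Submodule.Quotient.eq]
  refine Submodule.subset_span ⟨a, r, scalarVector φ 1, ?_⟩
  rw [smul_scalarVector, mul_one]

theorem smul_cyclicVector_congr (f : R →+* A) (φ : R →+* K) {r r' : R} (h : φ r = φ r') :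
    f r • cyclicVector f φ = f r' • cyclicVector f φ := by
  have h1 := smul_cyclicVector_eq f φ 1 r
  have h2 := smul_cyclicVector_eq f φ 1 r'
  rw [one_mul] at h1 h2
  rw [h1, h2, h]

theorem exists_smul_cyclicVector (f : R →+* A) (φ : R →+* K) (hφ : Function.Surjective φ)
    (n : BaseChangeModule f (ScalarModule φ)) : ∃ a : A, n = a • cyclicVector f φ := by
  obtain ⟨z, rfl⟩ := Submodule.Quotient.mk_surjective _ n
  induction z using TensorProduct.induction_on with
  | zero => exact ⟨0, by simp⟩
  | tmul a k =>
    obtain ⟨r, hr⟩ := hφ k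
    exact ⟨a * f r, by rw [smul_cyclicVector_eq, hr]; rfl⟩
  | add x y hx hy =>
    obtain ⟨a, ha⟩ := hx
    obtain ⟨b, hb⟩ := hy
    exact ⟨a + b, by rw [add_smul, ← ha, ← hb, Submodule.Quotient.mk_add]⟩

/-- An additive functional on `A` that transforms under right multiplication by `f r` through `φ`
shows that `A ⊗_R K` is not trivial. -/
theorem nontrivial_baseChangeModule (f : R →+* A) (φ : R →+* K) (L : A →+ K)
    (hL : ∀ a r, L (a * f r) = L a * φ r) (h1 : L 1 ≠ 0) :
    Nontrivial (BaseChangeModule f (ScalarModule φ)) := by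
  let Λ : A ⊗[ℤ] ScalarModule φ →ₗ[ℤ] K := TensorProduct.lift
    (((LinearMap.mul ℤ K).comp L.toIntLinearMap : A →ₗ[ℤ] K →ₗ[ℤ] K))
  have hΛ : ∀ a (k : K), Λ (a ⊗ₜ[ℤ] scalarVector φ k) = L a * k := fun a k ↦ rfl
  -- The functional is only additive while the relations form an `A`-submodule, so the induction
  -- carries all left translates `b • z`.
  have key : ∀ z ∈ baseChangeRelations f (ScalarModule φ), ∀ b : A, Λ (b • z) = 0 := by
    intro z hz
    induction hz using Submodule.span_induction with
    | mem z hz =>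
      obtain ⟨a, r, v, rfl⟩ := hz
      intro b
      obtain ⟨k, hk⟩ : ∃ k : K, v = scalarVector φ k := ⟨v, rfl⟩
      rw [hk, smul_sub, TensorProduct.smul_tmul', TensorProduct.smul_tmul', map_sub,
        smul_scalarVector, hΛ, hΛ, smul_eq_mul, smul_eq_mul, ← mul_assoc, hL, mul_assoc, sub_self]
    | zero => simp
    | add x y _ _ hx hy => intro b; rw [smul_add, map_add, hx, hy, add_zero]
    | smul a x _ hx => intro b; rw [smul_smul, hx]
  refine ⟨⟨cyclicVector f φ, 0, fun h ↦ h1 ?_⟩⟩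
  rw [cyclicVector, Submodule.Quotient.mk_eq_zero] at h
  have h2 := key _ h 1
  rwa [one_smul, hΛ, mul_one] at h2

end BaseChange

/-- The algebra behind the finite codimension of submodules: if `A` is, up to `J` and up to division
by `ϖ`, finitely generated modulo every element outside of `J`, then every nonzero submodule of a
cyclic module whose generator is killed by `J` has finite codimension. -/
theorem finiteDimensional_quotient_of_generation {o A K B N : Type*} [CommRing o] [Ring A]
    [Algebra o A] [Field K] [Algebra o K] [Ring B] [Algebra K B] [AddCommGroup N] [Module B N]
    [Module K N] [IsScalarTower K B N] (j : A →+* B)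
    (hj : ∀ r a, j (r • a) = algebraMap o K r • j a) (hB : ∀ z : B, ∃ (k : K) (a : A), z = k • j a)
    {v : N} (hv : ∀ n : N, ∃ a : B, n = a • v) {J : Submodule A A} (hJv : ∀ a ∈ J, j a • v = 0)
    {ϖ : o} (hϖ : algebraMap o K ϖ ≠ 0) {x : A}
    (hgen : ∀ m ∉ J, ∃ (n d : ℕ) (m' : A), m - ϖ ^ n • m' ∈ J ∧
      ∀ a : A, ∃ (c : Fin d → o) (b : A), a - (∑ i, c i • x ^ (i : ℕ) + b * m') ∈ J)
    (M : Submodule B N) (hM : M ≠ ⊥) : FiniteDimensional K (N ⧸ M) := by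
  obtain ⟨n, hnM, hn0⟩ := (Submodule.ne_bot_iff M).1 hM
  obtain ⟨z, rfl⟩ := hv n
  obtain ⟨k, m, rfl⟩ := hB z
  rw [smul_assoc] at hnM hn0
  have hk : k ≠ 0 := fun h ↦ hn0 (by rw [h, zero_smul])
  have hmM : j m • v ∈ M := by
    have := M.smul_of_tower_mem k⁻¹ hnM
    rwa [inv_smul_smul₀ hk] at this
  have hm : m ∉ J := fun h ↦ hn0 (by rw [hJv m h, smul_zero])
  obtain ⟨n, d, m', hmm', hgen⟩ := hgen m hm
  -- `J` kills `v` and `ϖ` is invertible in `K`, so `m v ∈ M` passes to the divided element `m'`.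
  have hm'M : j m' • v ∈ M := by
    have h1 := hJv _ hmm'
    rw [map_sub, sub_smul, sub_eq_zero, hj, smul_assoc] at h1
    have hne : algebraMap o K (ϖ ^ n) ≠ 0 := by
      rw [map_pow]
      exact pow_ne_zero _ hϖ
    have := M.smul_of_tower_mem (algebraMap o K (ϖ ^ n))⁻¹ hmM
    rwa [h1, inv_smul_smul₀ hne] at this
  let e : Fin d → N ⧸ M := fun i ↦ Submodule.Quotient.mk (j (x ^ (i : ℕ)) • v)
  refine Module.finite_def.2 ?_
  have htop : (⊤ : Submodule K (N ⧸ M)) = Submodule.span K (Set.range e) := by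
    refine (Submodule.eq_top_iff'.2 fun w ↦ ?_).symm
    obtain ⟨w, rfl⟩ := Submodule.Quotient.mk_surjective _ w
    obtain ⟨z, rfl⟩ := hv w
    obtain ⟨k, a, rfl⟩ := hB z
    obtain ⟨c, b, hcb⟩ := hgen a
    rw [smul_assoc, Submodule.Quotient.mk_smul]
    refine Submodule.smul_mem _ _ ?_
    have h1 := hJv _ hcb
    rw [map_sub, sub_smul, sub_eq_zero, map_add, add_smul, map_sum, Finset.sum_smul, map_mul,
      mul_smul] at h1
    have h2 : (Submodule.Quotient.mk (j b • j m' • v) : N ⧸ M) = 0 :=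
      (Submodule.Quotient.mk_eq_zero M).2 (M.smul_mem _ hm'M)
    rw [h1, Submodule.Quotient.mk_add, h2, add_zero, ← Submodule.mkQ_apply, map_sum]
    refine Submodule.sum_mem _ fun i _ ↦ ?_
    rw [hj, smul_assoc, Submodule.mkQ_apply, Submodule.Quotient.mk_smul]
    exact Submodule.smul_mem _ _ (Submodule.subset_span ⟨i, rfl⟩)
  rw [htop]
  exact Submodule.fg_span (Set.finite_range e)

theorem map_smul_eq_zero_of_mem_span {A B N σ : Type*} [Ring A] [Ring B] [AddCommGroup N]
    [Module B N] (j : A →+* B) {s : σ → A} {v : N} (h : ∀ i, j (s i) • v = 0) {a : A}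
    (ha : a ∈ Submodule.span A (Set.range s)) : j a • v = 0 := by
  induction ha using Submodule.span_induction with
  | mem x hx =>
    obtain ⟨i, rfl⟩ := hx
    exact h i
  | zero => rw [map_zero, zero_smul]
  | add x y _ _ hx hy => rw [map_add, add_smul, hx, hy, add_zero]
  | smul b x _ hx => rw [smul_eq_mul, map_mul, mul_smul, hx, smul_zero]

theorem map_sub_algebraMap_smul_eq_zero {o A K B N : Type*} [CommRing o] [Ring A]
    [Algebra o A] [Field K] [Algebra o K] [Ring B] [Algebra K B] [AddCommGroup N] [Module B N]
    [Module K N] [IsScalarTower K B N] (j : A →+* B)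
    (hj : ∀ r a, j (r • a) = algebraMap o K r • j a) (h1 : j 1 = 1) {v : N} {a : A} {r : o}
    (h : j a • v = algebraMap o K r • v) : j (a - algebraMap o A r) • v = 0 := by
  rw [map_sub, sub_smul, sub_eq_zero, Algebra.algebraMap_eq_smul_one, hj, smul_assoc, h1,
      one_smul, h]

/-! ### Finite codimension of nonzero submodules -/

section FiniteCodimension

open Filter CompletedGroupRing

variable (p : ℕ) [hp : Fact p.Prime] {K : Type*} [NormedField K] [IsUltrametricDist K]
  [NormedAlgebra ℚ_[p] K] [FiniteDimensional ℚ_[p] K]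
  {G P : Type*} [Group G] [TopologicalSpace G] [Group P] [TopologicalSpace P]

omit [NormedAlgebra ℚ_[p] K] [FiniteDimensional ℚ_[p] K] hp in
-- Of two scalars the one of smaller norm is an `o`-multiple of the other, so it can be moved across
-- the tensor product and two pure tensors merged.
theorem exists_eq_tmul (z : IwasawaAlgebra K G) :
    ∃ (k : K) (a : CompletedGroupRing (RingOfIntegersOf K) G), z = k ⊗ₜ a := by
  have key : ∀ (k l : K) (a b : CompletedGroupRing (RingOfIntegersOf K) G), ‖k‖ ≤ ‖l‖ →
      ∃ (j : K) (c : CompletedGroupRing (RingOfIntegersOf K) G),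
        k ⊗ₜ[RingOfIntegersOf K] a + l ⊗ₜ b = j ⊗ₜ c := by
    intro k l a b hkl
    by_cases hl : l = 0
    · have hk : k = 0 := by simpa [hl] using hkl
      exact ⟨0, 0, by simp [hl, hk]⟩
    · have hmem : ‖k / l‖ ≤ 1 := by
        rw [norm_div]
        exact div_le_one_of_le₀ hkl (norm_nonneg _)
      let r : RingOfIntegersOf K := ⟨k / l, hmem⟩
      refine ⟨l, r • a + b, ?_⟩
      have hr : k = r • l := (div_mul_cancel₀ k hl).symm
      rw [TensorProduct.tmul_add, TensorProduct.tmul_smul, TensorProduct.smul_tmul', ← hr]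
  induction z using TensorProduct.induction_on with
  | zero => exact ⟨0, 0, by simp⟩
  | tmul k a => exact ⟨k, a, rfl⟩
  | add x y hx hy =>
    obtain ⟨k, a, rfl⟩ := hx
    obtain ⟨l, b, rfl⟩ := hy
    rcases le_total ‖k‖ ‖l‖ with h | h
    · exact key k l a b h
    · rw [add_comm]
      exact key l k b a h

/-- The left ideal of `o[[G]]` generated by `s - χ s` for `s ∈ S`. -/
def characterIdeal (ι : P →ₜ* G) (χ : P →ₜ* (RingOfIntegersOf K)ˣ) (S : Set P) :
    Submodule (CompletedGroupRing (RingOfIntegersOf K) G)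
      (CompletedGroupRing (RingOfIntegersOf K) G) :=
  Submodule.span _ (Set.range fun s : S ↦ of (RingOfIntegersOf K) (ι s) -
    algebraMap (RingOfIntegersOf K) _ (χ s : RingOfIntegersOf K))

variable [IsTopologicalGroup G] [CompactSpace G]

omit hp in
-- The `h` with this property form a subgroup containing `S`. It is closed because the ideal is
-- finitely generated and hence closed.
theorem of_sub_mem_characterIdeal [CompactSpace (RingOfIntegersOf K)] (ι : P →ₜ* G)
    (χ : P →ₜ* (RingOfIntegersOf K)ˣ) {S : Set P} (hSfin : S.Finite)
    (hS : ∀ Q : Subgroup P, IsClosed (Q : Set P) → S ⊆ Q → Q = ⊤) (h : P) :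
    of (RingOfIntegersOf K) (ι h) - algebraMap (RingOfIntegersOf K) _ (χ h : RingOfIntegersOf K) ∈
      characterIdeal ι χ S := by
  have := hSfin.to_subtype
  have hcl : IsClosed (characterIdeal ι χ S : Set (CompletedGroupRing (RingOfIntegersOf K) G)) :=
    isClosed_span_range _
  let Q : Subgroup P :=
    { carrier := {h | of (RingOfIntegersOf K) (ι h) -
        algebraMap (RingOfIntegersOf K) _ (χ h : RingOfIntegersOf K) ∈ characterIdeal ι χ S}
      mul_mem' := by
        intro a b ha hb
        have h1 : of (RingOfIntegersOf K) (ι (a * b)) - algebraMap (RingOfIntegersOf K)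
            (CompletedGroupRing (RingOfIntegersOf K) G) (χ (a * b) : (RingOfIntegersOf K)ˣ) =
            of (RingOfIntegersOf K) (ι a) * (of (RingOfIntegersOf K) (ι b) -
              algebraMap (RingOfIntegersOf K) _ (χ b : RingOfIntegersOf K)) +
            algebraMap (RingOfIntegersOf K) _ (χ b : RingOfIntegersOf K) *
              (of (RingOfIntegersOf K) (ι a) -
              algebraMap (RingOfIntegersOf K) _ (χ a : RingOfIntegersOf K)) := by
          rw [map_mul, map_mul, of_mul, Units.val_mul, mul_comm (χ a : RingOfIntegersOf K), map_mul,
            mul_sub, mul_sub, Algebra.commutes (χ b : RingOfIntegersOf K) (of _ (ι a))]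
          abel
        change _ ∈ characterIdeal ι χ S
        rw [h1]
        exact add_mem (Submodule.smul_mem _ _ hb) (Submodule.smul_mem _ _ ha)
      one_mem' := by
        change _ ∈ characterIdeal ι χ S
        rw [map_one, map_one, of_one, Units.val_one, map_one, sub_self]
        exact zero_mem _
      inv_mem' := by
        intro a ha
        have h1 : of (RingOfIntegersOf K) (ι a⁻¹) - algebraMap (RingOfIntegersOf K)
            (CompletedGroupRing (RingOfIntegersOf K) G) (χ a⁻¹ : (RingOfIntegersOf K)ˣ) =
            -((algebraMap (RingOfIntegersOf K) _ ((χ a)⁻¹ : (RingOfIntegersOf K)ˣ) *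
              of (RingOfIntegersOf K) (ι a⁻¹)) * (of (RingOfIntegersOf K) (ι a) -
              algebraMap (RingOfIntegersOf K) _ (χ a : RingOfIntegersOf K))) := by
          rw [mul_sub, mul_assoc, ← of_mul, ← map_mul, inv_mul_cancel, map_one, of_one, mul_assoc,
            ← Algebra.commutes (χ a : RingOfIntegersOf K), ← mul_assoc, ← map_mul, Units.inv_mul,
            map_one, one_mul, mul_one, neg_sub, map_inv χ]
        change _ ∈ characterIdeal ι χ S
        rw [h1]
        exact neg_mem (Submodule.smul_mem _ _ ha) }
  have hQ : IsClosed (Q : Set P) := by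
    refine hcl.preimage (f := fun h ↦ of (RingOfIntegersOf K) (ι h) -
      algebraMap (RingOfIntegersOf K) (CompletedGroupRing (RingOfIntegersOf K) G)
        (χ h : RingOfIntegersOf K)) ?_
    refine (continuous_of.comp ι.continuous_toFun).sub ?_
    exact (continuous_algebraMap _ _).comp (Units.continuous_val.comp χ.continuous_toFun)
  have hSQ : S ⊆ Q := fun s hs ↦ Submodule.subset_span ⟨⟨s, hs⟩, rfl⟩
  have : h ∈ Q := by rw [hS Q hQ hSQ]; trivial
  exact this

omit hp in
-- Modulo the ideal `u' h ≡ χ(h) u'`, and `u'` is a limit of powers of `1 + x`. So the sum of the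
-- closed subalgebra and the ideal contains all group elements; being compact it is closed, and they
-- span a dense submodule.
theorem exists_closedAdjoin_sub_mem [CompactSpace (RingOfIntegersOf K)] (ι : P →ₜ* G)
    (χ : P →ₜ* (RingOfIntegersOf K)ˣ) {S : Set P} (hSfin : S.Finite)
    (hS : ∀ Q : Subgroup P, IsClosed (Q : Set P) → S ⊆ Q → Q = ⊤) {u : G}
    (hdec : ∀ g, ∃ u' ∈ closure (Set.range fun n : ℕ ↦ u ^ n), ∃ h, g = u' * ι h)
    (a : CompletedGroupRing (RingOfIntegersOf K) G) :
    ∃ y ∈ closedAdjoin (RingOfIntegersOf K) (of (RingOfIntegersOf K) u - 1),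
      a - y ∈ characterIdeal ι χ S := by
  have := hSfin.to_subtype
  have hcl : IsClosed (characterIdeal ι χ S : Set (CompletedGroupRing (RingOfIntegersOf K) G)) :=
    isClosed_span_range _
  set x := of (RingOfIntegersOf K) u - 1 with hx
  let C : Submodule (RingOfIntegersOf K) (CompletedGroupRing (RingOfIntegersOf K) G) :=
    Subalgebra.toSubmodule (closedAdjoin (RingOfIntegersOf K) x) ⊔
      (characterIdeal ι χ S).restrictScalars (RingOfIntegersOf K)
  have hC : IsClosed (C : Set (CompletedGroupRing (RingOfIntegersOf K) G)) := by
    rw [Submodule.coe_sup]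
    exact ((isCompact_closedAdjoin x).add hcl.isCompact).isClosed
  have hmem : ∀ g, of (RingOfIntegersOf K) g ∈ C := by
    intro g
    obtain ⟨u', hu', h, rfl⟩ := hdec g
    have h1 : of (RingOfIntegersOf K) u' ∈ closedAdjoin (RingOfIntegersOf K) x := by
      have hcl' : IsClosed (of (RingOfIntegersOf K) ⁻¹'
          (closedAdjoin (RingOfIntegersOf K) x : Set (CompletedGroupRing (RingOfIntegersOf K)
              G))) :=
        (Subalgebra.isClosed_topologicalClosure _).preimage continuous_of
      refine closure_minimal ?_ hcl' hu'
      rintro _ ⟨n, rfl⟩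
      rw [Set.mem_preimage, of_pow, SetLike.mem_coe]
      refine pow_mem ?_ n
      have : of (RingOfIntegersOf K) u = x + 1 := by rw [hx, sub_add_cancel]
      rw [this]
      exact add_mem (self_mem_closedAdjoin x) (one_mem _)
    have h2 : of (RingOfIntegersOf K) (u' * ι h) = (χ h : RingOfIntegersOf K) •
        of (RingOfIntegersOf K) u' + of (RingOfIntegersOf K) u' *
          (of (RingOfIntegersOf K) (ι h) -
          algebraMap (RingOfIntegersOf K) _ (χ h : RingOfIntegersOf K)) := by
      rw [of_mul, mul_sub, Algebra.smul_def, Algebra.commutes]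
      abel
    rw [h2]
    refine Submodule.add_mem_sup (Subalgebra.smul_mem _ h1 _) ?_
    exact Submodule.smul_mem (characterIdeal ι χ S) _ (of_sub_mem_characterIdeal ι χ hSfin hS h)
  obtain ⟨y, hy, j, hj, hyj⟩ := Submodule.mem_sup.1 (mem_of_forall_of_mem hC hmem a)
  exact ⟨y, hy, by rw [← hyj, add_sub_cancel_left]; exact hj⟩

/-- Let `G = closure (uᴺ) · P`, where `P` is topologically finitely generated and `u` generates a
pro-`p` group. Let `N` be a cyclic `K[[G]]`-module with a generator on which `P` acts through a
character. Then every nonzero submodule of `N` has finite codimension. -/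
theorem finiteDimensional_quotient_of_cyclic (ι : P →ₜ* G) (χ : P →ₜ* (RingOfIntegersOf K)ˣ)
    {S : Set P} (hSfin : S.Finite) (hS : ∀ Q : Subgroup P, IsClosed (Q : Set P) → S ⊆ Q → Q = ⊤)
    {u : G} (hu : ∀ H : OpenNormalSubgroup G, ∃ k, u ^ p ^ k ∈ H)
    (hdec : ∀ g, ∃ u' ∈ closure (Set.range fun n : ℕ ↦ u ^ n), ∃ h, g = u' * ι h)
    {N : Type*} [AddCommGroup N] [Module (IwasawaAlgebra K G) N] [Module K N]
    [IsScalarTower K (IwasawaAlgebra K G) N] {v : N}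
    (hv : ∀ n : N, ∃ a : IwasawaAlgebra K G, n = a • v)
    (hPv : ∀ h, ((1 : K) ⊗ₜ of (RingOfIntegersOf K) (ι h) : IwasawaAlgebra K G) • v =
      ((χ h : RingOfIntegersOf K) : K) • v)
    (M : Submodule (IwasawaAlgebra K G) N) (hM : M ≠ ⊥) : FiniteDimensional K (N ⧸ M) := by
  have : CompactSpace (RingOfIntegersOf K) := compactSpace_ringOfIntegersOf p K
  have hSfin' := hSfin.to_subtype
  obtain ⟨ϖ, hϖ0, hϖ1, hϖ⟩ := exists_uniformizer p K
  have hϖA : Tendsto (fun n ↦ algebraMap (RingOfIntegersOf K)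
      (CompletedGroupRing (RingOfIntegersOf K) G) ϖ ^ n) atTop (𝓝 0) := by
    have := ((continuous_algebraMap (RingOfIntegersOf K)
      (CompletedGroupRing (RingOfIntegersOf K) G)).tendsto 0).comp
        (tendsto_ringOfIntegersOf_pow K hϖ1)
    rw [map_zero] at this
    exact this.congr fun n ↦ map_pow _ _ _
  have hpo : Tendsto (fun n ↦ (p : RingOfIntegersOf K) ^ n) atTop (𝓝 0) :=
    tendsto_ringOfIntegersOf_pow K (by simpa using norm_natCast_prime_lt_one p K)
  let j : CompletedGroupRing (RingOfIntegersOf K) G →ₐ[RingOfIntegersOf K] IwasawaAlgebra K G :=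
    Algebra.TensorProduct.includeRight
  have hj : ∀ (r : RingOfIntegersOf K) a, j (r • a) = algebraMap _ K r • j a := by
    intro r a
    rw [map_smul, algebraMap_smul]
  have hj' : ∀ a, j a = (1 : K) ⊗ₜ a := fun a ↦ rfl
  refine finiteDimensional_quotient_of_generation (o := RingOfIntegersOf K) (K := K)
    (j : CompletedGroupRing (RingOfIntegersOf K) G →+* IwasawaAlgebra K G) hj ?_ hv
    (J := characterIdeal ι χ S) ?_ hϖ0 (x := of (RingOfIntegersOf K) u - 1)
    (fun m hm ↦ exists_finite_generation hϖ hϖA (tendsto_of_sub_one_pow hp.out hpo hu)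
      (isClosed_span_range _) (exists_closedAdjoin_sub_mem ι χ hSfin hS hdec) hm) M hM
  · intro z
    obtain ⟨k, a, rfl⟩ := exists_eq_tmul z
    refine ⟨k, a, ?_⟩
    change _ = k • ((1 : K) ⊗ₜ a)
    rw [TensorProduct.smul_tmul', smul_eq_mul, mul_one]
  · refine fun a ha ↦ map_smul_eq_zero_of_mem_span _ (fun s ↦ ?_) ha
    exact map_sub_algebraMap_smul_eq_zero _ hj (map_one j) (hPv s)

omit [FiniteDimensional ℚ_[p] K] [IsTopologicalGroup G] [CompactSpace G]
    [NormedAlgebra ℚ_[p] K] hp in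
theorem tmul_of_smul_cyclicVector (ι : P →ₜ* G) (φ : IwasawaAlgebra K P →ₐ[K] K) (h : P) :
    ((1 : K) ⊗ₜ of (RingOfIntegersOf K) (ι h) : IwasawaAlgebra K G) •
        cyclicVector (IwasawaAlgebra.map K ι).toRingHom φ.toRingHom =
      φ (1 ⊗ₜ of (RingOfIntegersOf K) h) •
        cyclicVector (IwasawaAlgebra.map K ι).toRingHom φ.toRingHom := by
  have h1 := smul_cyclicVector_congr (IwasawaAlgebra.map K ι).toRingHom φ.toRingHom
    (r := 1 ⊗ₜ of (RingOfIntegersOf K) h)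
    (r' := algebraMap K _ (φ (1 ⊗ₜ of (RingOfIntegersOf K) h))) (φ.commutes _).symm
  have h2 : (IwasawaAlgebra.map K ι).toRingHom (1 ⊗ₜ of (RingOfIntegersOf K) h) =
      (1 : K) ⊗ₜ of (RingOfIntegersOf K) (ι h) := by
    change IwasawaAlgebra.map K ι (1 ⊗ₜ of (RingOfIntegersOf K) h) = _
    rw [IwasawaAlgebra.map, Algebra.TensorProduct.map_tmul, map_of]
    rfl
  have h3 : (IwasawaAlgebra.map K ι).toRingHom
      (algebraMap K _ (φ (1 ⊗ₜ of (RingOfIntegersOf K) h))) = algebraMap K _ _ :=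
    (IwasawaAlgebra.map K ι).commutes _
  rw [h2, h3, algebraMap_smul] at h1
  exact h1

end FiniteCodimension

/-! ### Continuous functionals on completed group rings -/

namespace CompletedGroupRing

open Filter

section Functional

variable {R : Type*} [CommRing R] [TopologicalSpace R] [IsTopologicalRing R]
  {G : Type*} [Group G] [TopologicalSpace G] [IsTopologicalGroup G] [CompactSpace G]

theorem isOpen_setOf_level_eq_zero {I : Ideal R} (hI : IsOpen (I : Set R))
    (H : OpenNormalSubgroup G)
    (F : MonoidAlgebra R (G ⧸ H.toSubgroup) →ₗ[R] R ⧸ I) :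
    IsOpen {x : CompletedGroupRing R G | F (x.1 H) = 0} := by
  have := Fintype.ofFinite (G ⧸ H.toSubgroup)
  choose r hr using fun q : G ⧸ H.toSubgroup ↦ Ideal.Quotient.mk_surjective (F (.single q 1))
  have key : ∀ x : CompletedGroupRing R G,
      F (x.1 H) = Ideal.Quotient.mk I (∑ q, coeffs x H q * r q) := by
    intro x
    have hx : x.1 H = ∑ q, coeffs x H q • MonoidAlgebra.single q (1 : R) := by
      classical
      ext q
      simp [MonoidAlgebra.coeff_sum, coeffs]
    rw [hx, map_sum, map_sum]
    refine Finset.sum_congr rfl fun q _ ↦ ?_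
    rw [map_smul, map_mul, hr, Algebra.smul_def]
    rfl
  have hset : {x : CompletedGroupRing R G | F (x.1 H) = 0} =
      (fun x : CompletedGroupRing R G ↦ ∑ q, coeffs x H q * r q) ⁻¹' I := by
    ext x
    rw [Set.mem_ofPred_eq, key, Ideal.Quotient.eq_zero_iff_mem]
    rfl
  rw [hset]
  exact hI.preimage (continuous_finsetSum _ fun q _ ↦ (continuous_coeffs H q).mul continuous_const)

/-- Uniform continuity of `f` on a compact group, where open normal subgroups form a basis at `1`.
-/
theorem exists_openNormalSubgroup_sub_mem [TotallyDisconnectedSpace G] {f : G → R}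
    (hf : Continuous f) {I : Ideal R} (hI : IsOpen (I : Set R)) :
    ∃ H : OpenNormalSubgroup G, ∀ g, ∀ h ∈ H, f (g * h) - f g ∈ I := by
  have h1 : ∀ᶠ h : G in 𝓝 1, ∀ g ∈ Set.univ, f (g * h) - f g ∈ I := by
    refine isCompact_univ.eventually_forall_of_forall_eventually fun g _ ↦ ?_
    have hc : Continuous fun z : G × G ↦ f (z.2 * z.1) - f z.2 := by fun_prop
    exact (hI.preimage hc).mem_nhds (by simp)
  obtain ⟨U, hU, hUo, h1U⟩ := eventually_nhds_iff.1 h1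
  obtain ⟨H, hH⟩ := ProfiniteGrp.exist_openNormalSubgroup_sub_open_nhds_of_one hUo h1U
  exact ⟨H, fun g h hh ↦ hU h (hH hh) g trivial⟩

/-- Every continuous function on a profinite group extends to a linear functional on the completed
group ring whose reductions modulo the powers of `I` have open kernels. -/
theorem exists_linearMap_of_eq [TotallyDisconnectedSpace G] {I : Ideal R} [IsAdicComplete I R]
    (hI : ∀ n, IsOpen ((I ^ n : Ideal R) : Set R)) {f : G → R} (hf : Continuous f) :
    ∃ L : CompletedGroupRing R G →ₗ[R] R, (∀ g, L (of R g) = f g) ∧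
      ∀ n, IsOpen {x | L x ∈ I ^ n} := by
  classical
  choose H hH using fun n ↦ exists_openNormalSubgroup_sub_mem hf (hI n)
  have hfin (n) : Fintype (G ⧸ (H n).toSubgroup) := Fintype.ofFinite _
  -- Riemann sums over the cosets of `H n`: elements of `R[[G]]` act as measures, and `L` is the
  -- integral of `f`.
  let ℓ : ℕ → CompletedGroupRing R G →ₗ[R] R := fun n ↦
    { toFun := fun x ↦ ∑ q, coeffs x (H n) q * f q.out
      map_add' := fun x y ↦ by simp only [coeffs_add, add_mul, Finset.sum_add_distrib]
      map_smul' := fun r x ↦ by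
        simp only [coeffs_smul, mul_assoc, RingHom.id_apply, smul_eq_mul, Finset.mul_sum] }
  have hℓ : ∀ n, Continuous (ℓ n) := fun n ↦
    continuous_finsetSum _ fun q _ ↦ (continuous_coeffs _ q).mul continuous_const
  have hℓof : ∀ n g, ℓ n (of R g) - f g ∈ I ^ n := by
    intro n g
    have h1 : ℓ n (of R g) = f (QuotientGroup.mk g : G ⧸ (H n).toSubgroup).out := by
      change ∑ q, coeffs (of R g) (H n) q * f q.out = _
      simp [coeffs_of]
    obtain ⟨h, hh⟩ := QuotientGroup.mk_out_eq_mul (H n).toSubgroup g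
    rw [h1, hh]
    exact hH n g h h.2
  -- An open submodule is closed, so the congruence need only be tested on group elements.
  have hcomp : ∀ m n, m ≤ n → ∀ x, ℓ n x - ℓ m x ∈ I ^ m := by
    intro m n hmn x
    have hopen : IsOpen {x | (ℓ n - ℓ m) x ∈ I ^ m} :=
      (hI m).preimage ((hℓ n).sub (hℓ m))
    let C : Submodule R (CompletedGroupRing R G) := Submodule.comap (ℓ n - ℓ m) (I ^ m)
    have hC : IsClosed (C : Set (CompletedGroupRing R G)) :=
      AddSubgroup.isClosed_of_isOpen C.toAddSubgroup hopen
    refine mem_of_forall_of_mem (C := C) hC (fun g ↦ ?_) x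
    change ℓ n (of R g) - ℓ m (of R g) ∈ I ^ m
    rw [← sub_sub_sub_cancel_right _ _ (f g)]
    exact sub_mem (Ideal.pow_le_pow_right hmn (hℓof n g)) (hℓof m g)
  let F : ∀ n, CompletedGroupRing R G →ₗ[R] R ⧸ (I ^ n • ⊤ : Submodule R R) := fun n ↦
    (Submodule.mkQ _).comp (ℓ n)
  have hF : ∀ {m n : ℕ} (hle : m ≤ n), (Submodule.factorPow I R hle) ∘ₗ F n = F m := by
    intro m n hle
    ext x
    change Submodule.Quotient.mk (ℓ n x) = (Submodule.Quotient.mk (ℓ m x) : R ⧸ _)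
    rw [Submodule.Quotient.eq, smul_eq_mul, Ideal.mul_top]
    exact hcomp m n hle x
  let L := IsAdicComplete.lift I F hF
  have hL : ∀ n x, L x - ℓ n x ∈ I ^ n := by
    intro n x
    have h1 : (Submodule.Quotient.mk (L x) : R ⧸ (I ^ n • ⊤ : Submodule R R)) =
        Submodule.Quotient.mk (ℓ n x) := IsAdicComplete.mk_lift I hF n x
    rwa [Submodule.Quotient.eq, smul_eq_mul, Ideal.mul_top] at h1
  refine ⟨L, fun g ↦ ?_, fun n ↦ ?_⟩
  · rw [IsHausdorff.eq_iff_smodEq (I := I)]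
    intro n
    rw [SModEq.sub_mem, smul_eq_mul, Ideal.mul_top]
    have := add_mem (hL n (of R g)) (hℓof n g)
    rwa [sub_add_sub_cancel] at this
  · have hset : {x | L x ∈ I ^ n} = ℓ n ⁻¹' (I ^ n : Ideal R) := by
      ext x
      exact ⟨fun h ↦ by simpa using sub_mem (show L x ∈ I ^ n from h) (hL n x),
        fun h ↦ by simpa using add_mem (show ℓ n x ∈ I ^ n from h) (hL n x)⟩
    rw [hset]
    exact (hI n).preimage (hℓ n)

theorem continuous_map {G' : Type*} [Group G'] [TopologicalSpace G'] (φ : G →ₜ* G') :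
    Continuous (map R φ) := by
  classical
  refine continuous_iff_coeffs.2 fun H q ↦ ?_
  have := Fintype.ofFinite (G ⧸ (comapOpenNormal φ H).toSubgroup)
  have h : ∀ x : CompletedGroupRing R G, coeffs (map R φ x) H q =
      ∑ a, if QuotientGroup.map (comapOpenNormal φ H).toSubgroup H.toSubgroup φ.toMonoidHom le_rfl a
        = q then coeffs x (comapOpenNormal φ H) a else 0 := by
    intro x
    change (mapLevel R φ H (x.1 (comapOpenNormal φ H))).coeff q = _
    rw [mapLevel, MonoidAlgebra.mapDomainAlgHom_apply, MonoidAlgebra.coeff_mapDomain,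
      Finsupp.mapDomain, Finsupp.sum_apply, Finsupp.sum_fintype _ _ (by simp)]
    exact Finset.sum_congr rfl fun a _ ↦ by rw [Finsupp.single_apply]; rfl
  simp only [h]
  refine continuous_finsetSum _ fun a _ ↦ ?_
  split_ifs
  · exact continuous_coeffs _ a
  · exact continuous_const

end Functional

/-- A functional that is equivariant on group elements is equivariant. -/
theorem functional_mul_map {R : Type*} [CommRing R] [TopologicalSpace R] [IsTopologicalRing R]
    [T2Space R] {G P : Type*} [Group G] [TopologicalSpace G] [IsTopologicalGroup G] [CompactSpace G]
    [Group P] [TopologicalSpace P] [IsTopologicalGroup P] [CompactSpace P] (ι : P →ₜ* G)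
    {L : CompletedGroupRing R G →ₗ[R] R} (hL : Continuous L)
    {θ : CompletedGroupRing R P →ₗ[R] R} (hθ : Continuous θ)
    (h : ∀ g h, L (of R (g * ι h)) = L (of R g) * θ (of R h)) (x : CompletedGroupRing R G)
    (y : CompletedGroupRing R P) : L (x * map R ι y) = L x * θ y := by
  let D (x : CompletedGroupRing R G) : CompletedGroupRing R P →ₗ[R] R :=
    L.comp ((LinearMap.mulLeft R x).comp (map R ι).toLinearMap) - L x • θ
  have hD : ∀ x y, D x y = L (x * map R ι y) - L x * θ y := fun x y ↦ rfl
  let E (y : CompletedGroupRing R P) : CompletedGroupRing R G →ₗ[R] R :=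
    L.comp (LinearMap.mulRight R (map R ι y)) - θ y • L
  have hE : ∀ x y, E y x = L (x * map R ι y) - L x * θ y := fun x y ↦ by
    rw [mul_comm (L x)]
    rfl
  have hDc : ∀ x, Continuous (D x) := fun x ↦
    (hL.comp (continuous_const.mul (continuous_map ι))).sub (hθ.const_smul _)
  have hEc : ∀ y, Continuous (E y) := fun y ↦
    (hL.comp (continuous_id.mul continuous_const)).sub (hL.const_smul _)
  -- Density is used once in each variable, with the first argument a group element here.
  have h1 : ∀ g y, D (of R g) y = 0 := fun g y ↦
    mem_of_forall_of_mem (C := (D (of R g)).ker) (isClosed_singleton.preimage (hDc _))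
      (fun a ↦ by rw [LinearMap.mem_ker, hD, map_of, ← of_mul, h, sub_self]) y
  have h2 : E y x = 0 := mem_of_forall_of_mem (C := (E y).ker)
    (isClosed_singleton.preimage (hEc _))
    (fun g ↦ by rw [LinearMap.mem_ker, hE, ← hD, h1]) x
  rwa [hE, sub_eq_zero] at h2

end CompletedGroupRing

/-! ### Nonvanishing of induced modules. -/

section Nontrivial

open CompletedGroupRing

variable (p : ℕ) [hp : Fact p.Prime] {K : Type*} [NormedField K] [IsUltrametricDist K]
  [NormedAlgebra ℚ_[p] K] [FiniteDimensional ℚ_[p] K]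
  {G P T : Type*} [Group G] [TopologicalSpace G] [Group P] [TopologicalSpace P] [Group T]
  [TopologicalSpace T] [IsTopologicalGroup T] [CompactSpace T]

theorem continuous_integralCharacterExtension (χ : T →ₜ* (RingOfIntegersOf K)ˣ) :
    Continuous (integralCharacterExtension p χ) := by
  refine continuous_of_isOpen_preimage_pIdeal p K
    ((integralCharacterExtension p χ).toLinearMap.toAddMonoidHom) fun n ↦ ?_
  have := isOpen_setOf_level_eq_zero (G := T) (isOpen_pIdeal_pow p K n) (congruenceKernel p χ n)
    (characterLevelFinite p χ n).toLinearMap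
  convert this using 1
  ext x
  rw [Set.mem_ofPred_eq, Set.mem_ofPred_eq, ← Ideal.Quotient.eq_zero_iff_mem]
  change Ideal.Quotient.mk _ (integralCharacterExtension p χ x) = 0 ↔ _
  rw [mk_integralCharacterExtension]
  rfl

variable [IsTopologicalGroup G] [CompactSpace G] [TotallyDisconnectedSpace G]
  [IsTopologicalGroup P] [CompactSpace P]

/-- The module induced from `P` to `G` by a character of `P` that factors through a quotient `T` is
nonzero if there is a continuous function on `G` that transforms under `P` through the character. -/
theorem nontrivial_induced (ι : P →ₜ* G) (τ : P →ₜ* T) (χ : T →ₜ* (RingOfIntegersOf K)ˣ)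
    {f : G → RingOfIntegersOf K} (hf : Continuous f) (hf1 : f 1 = 1)
    (hfP : ∀ g h, f (g * ι h) = f g * χ (τ h)) :
    Nontrivial (BaseChangeModule (IwasawaAlgebra.map K ι).toRingHom
      (ScalarModule ((characterExtension p χ).comp (IwasawaAlgebra.map K τ)).toRingHom)) := by
  obtain ⟨L, hLof, hL⟩ := exists_linearMap_of_eq (isOpen_pIdeal_pow p K) hf
  have hLc : Continuous L := continuous_of_isOpen_preimage_pIdeal p K
    L.toAddMonoidHom hL
  let θ := (integralCharacterExtension p χ).comp (CompletedGroupRing.map _ τ)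
  have hθc : Continuous θ := (continuous_integralCharacterExtension p χ).comp (continuous_map τ)
  have hmul := functional_mul_map ι hLc (θ := θ.toLinearMap) hθc (fun g h ↦ by
    rw [hLof, hLof, hfP]
    congr 1
    change _ = integralCharacterExtension p χ (CompletedGroupRing.map _ τ (of _ h))
    rw [map_of, integralCharacterExtension_of])
  let ΛK : IwasawaAlgebra K G →ₗ[RingOfIntegersOf K] K := TensorProduct.lift
    (((LinearMap.mul (RingOfIntegersOf K) K).flip.comp
      ((Algebra.linearMap (RingOfIntegersOf K) K).comp L)).flip)
  have hΛ : ∀ k x, ΛK (k ⊗ₜ x) = k * (L x : K) := fun k x ↦ rfl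
  refine nontrivial_baseChangeModule _ _ ΛK.toAddMonoidHom (fun a r ↦ ?_) ?_
  · obtain ⟨k, x, rfl⟩ := exists_eq_tmul a
    obtain ⟨l, y, rfl⟩ := exists_eq_tmul r
    have h1 : (IwasawaAlgebra.map K ι).toRingHom (l ⊗ₜ y) = l ⊗ₜ CompletedGroupRing.map _ ι y := by
      change IwasawaAlgebra.map K ι (l ⊗ₜ y) = _
      rw [IwasawaAlgebra.map, Algebra.TensorProduct.map_tmul]
      rfl
    have h2 : ((characterExtension p χ).comp (IwasawaAlgebra.map K τ)).toRingHom (l ⊗ₜ y) =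
        l * (θ y : K) := by
      change characterExtension p χ (IwasawaAlgebra.map K τ (l ⊗ₜ y)) = _
      rw [IwasawaAlgebra.map, Algebra.TensorProduct.map_tmul, characterExtension,
        Algebra.TensorProduct.lift_tmul]
      rfl
    rw [h1, h2, Algebra.TensorProduct.tmul_mul_tmul]
    rw [LinearMap.toAddMonoidHom_coe, hΛ, hΛ, hmul, Subring.coe_mul]
    change _ * (_ * (θ y : K)) = _
    ring
  · change ΛK (1 ⊗ₜ 1) ≠ 0
    rw [hΛ, ← of_one, hLof, hf1]
    simp

end Nontrivial

/-! ### One-parameter subgroups and finite-dimensional representations -/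

section Representation

variable {p : ℕ} [hp : Fact p.Prime]

theorem norm_natCast_p_lt_one : ‖(p : ℤ_[p])‖ < 1 := by
  rw [PadicInt.norm_p]
  exact inv_lt_one_of_one_lt₀ (by exact_mod_cast hp.out.one_lt)

theorem exists_unit_eq_one_add_mul (x : ℤ_[p]) : ∃ u : ℤ_[p]ˣ, (u : ℤ_[p]) = 1 + p * x := by
  refine exists_unit_eq_one_add ?_
  rw [norm_mul]
  exact mul_lt_one_of_nonneg_of_lt_one_left (norm_nonneg _) (norm_natCast_p_lt_one) x.norm_le_one

/-- Let `α` be a homomorphism from `ℤ_p` to a group that acts on a finite-dimensional space, and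
`v` a common eigenvector of elements `τ s` with `τ s * α (s * x) = α x * τ s`. If moreover
`w * α m = α (s⁻¹ * m) * h` for `s = 1 + p * m` and some `h` that acts on `v` as `ψ s`, then the
character `ψ` is algebraic near `1`. -/
theorem exists_eq_pow_of_representation {K A V G : Type*} [Field K] [CharZero K] [Ring A]
    [Algebra K A] [AddCommGroup V] [Module A V] [Module K V] [IsScalarTower K A V]
    [FiniteDimensional K V] [Group G] (E : G →* A) (α : Multiplicative ℤ_[p] →* G)
    (τ : ℤ_[p]ˣ → G) (w : G) (ψ : ℤ_[p]ˣ →* K) {v : V} (hv : v ≠ 0)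
    (hτ : ∀ s, ∃ r : K, r ≠ 0 ∧ E (τ s) • v = r • v)
    (hτα : ∀ (s : ℤ_[p]ˣ) (x : ℤ_[p]), τ s * α (.ofAdd (s * x)) = α (.ofAdd x) * τ s)
    (hw : ∀ (m : ℕ) (s : ℤ_[p]ˣ), (s : ℤ_[p]) = 1 + p * m → ∃ h, w * α (.ofAdd (m : ℤ_[p])) =
      α (.ofAdd (((s⁻¹ : ℤ_[p]ˣ) : ℤ_[p]) * m)) * h ∧ E h • v = ψ s • v) :
    ∃ r k : ℕ, 0 < r ∧ ∀ (a : ℤ_[p]ˣ) (m : ℕ), (a : ℤ_[p]) = ((1 + p * r * m : ℕ) : ℤ_[p]) →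
      ψ a = ((1 + p * r * m : ℕ) : K) ^ k := by
  classical
  have : SMulCommClass A K V := IsScalarTower.to_smulCommClass'
  let ρ : G →* Module.End K V := ((Algebra.lsmul K K V : A →ₐ[K] Module.End K V) : A →* _).comp E
  have hρ : ∀ g x, ρ g x = E g • x := fun _ _ ↦ rfl
  -- The value `1` at nonunits is a default; only arguments `1 + p * m` occur.
  let σ : ℕ → ℤ_[p]ˣ := fun n ↦ if h : IsUnit (n : ℤ_[p]) then h.unit else 1
  have hσ : ∀ m : ℕ, (σ (1 + p * m) : ℤ_[p]) = 1 + p * m := by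
    intro m
    obtain ⟨u, hu⟩ := exists_unit_eq_one_add_mul (p := p) m
    have h : IsUnit ((1 + p * m : ℕ) : ℤ_[p]) := ⟨u, by rw [hu]; push_cast; rfl⟩
    simp only [σ, dif_pos h, IsUnit.unit_spec]
    push_cast
    rfl
  have hσeq : ∀ (a : ℤ_[p]ˣ) (m : ℕ), (a : ℤ_[p]) = ((1 + p * m : ℕ) : ℤ_[p]) →
      σ (1 + p * m) = a := by
    intro a m h
    apply Units.ext
    rw [hσ, h]
    push_cast
    rfl
  choose r hr0 hr using hτ
  have hαpow : ∀ n : ℕ, α (.ofAdd (n : ℤ_[p])) = α (.ofAdd 1) ^ n := by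
    intro n
    rw [← map_pow, ← ofAdd_nsmul, nsmul_one]
  have hτv : ∀ s, (r s)⁻¹ • ρ (τ s) v = v := fun s ↦ by rw [hρ, hr, inv_smul_smul₀ (hr0 s)]
  have hunit : ∀ g, IsUnit (ρ g) := fun g ↦ (Group.isUnit g).map ρ
  obtain ⟨N, k, hN, h⟩ : ∃ N k : ℕ, 0 < N ∧
      ∀ m : ℕ, ψ (σ (1 + p * N * m)) = ((1 + p * N * m : ℕ) : K) ^ k := by
    -- The torus operators are divided by their eigenvalue on `v` so that they fix `v`.
    refine exists_eq_pow_of_intertwining (K := K) (V := V) hp.out.pos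
      (A := ρ (α (.ofAdd 1))) (b := ρ w) (t := fun n ↦ (r (σ n))⁻¹ • ρ (τ (σ n)))
      (ψ := fun n ↦ ψ (σ n)) hv (hunit _)
      (fun m ↦ (hunit _).smul (Units.mk0 _ (inv_ne_zero (hr0 (σ (1 + p * m))))))
      (fun m ↦ hτv _) ?_ ?_ ?_ ?_
    · intro m
      have h1 := hτα (σ (1 + p * m)) 1
      rw [mul_one, hσ, show (1 + p * m : ℤ_[p]) = ((1 + p * m : ℕ) : ℤ_[p]) by push_cast; rfl,
        hαpow] at h1
      rw [smul_mul_assoc, mul_smul_comm, ← map_pow, ← map_mul, h1, map_mul]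
    · intro m
      obtain ⟨h, hh, hhv⟩ := hw m _ (hσ m)
      -- With `x = s⁻¹ m` this reads `τ s α(m) = α(s⁻¹ m) τ s`, which converts `α(s⁻¹ m) v` into a
      -- torus translate of `α(m) v`.
      have h1 := hτα (σ (1 + p * m)) (((σ (1 + p * m))⁻¹ : ℤ_[p]ˣ) * m)
      rw [Units.mul_inv_cancel_left] at h1
      rw [← map_pow, ← hαpow, ← Module.End.mul_apply, ← map_mul ρ, hh, map_mul ρ,
          Module.End.mul_apply,
        hρ h, hhv, LinearMap.smul_apply, ← Module.End.mul_apply, ← map_mul ρ, h1, map_mul ρ,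
        Module.End.mul_apply, hρ (τ _) v, hr, map_smul, map_smul,
        inv_smul_smul₀ (hr0 _)]
    · have : σ 1 = 1 := by simpa using hσeq 1 0 (by simp)
      rw [this, map_one]
    · intro m n
      rw [← map_mul]
      congr 1
      have h1 : (1 + p * m) * (1 + p * n) = 1 + p * (m + n + p * m * n) := by ring
      rw [h1]
      refine hσeq _ _ ?_
      rw [← h1, Units.val_mul, hσ, hσ]
      push_cast
      rfl
  refine ⟨N, k, hN, fun a m ha ↦ ?_⟩
  rw [← h m, mul_assoc, hσeq a (N * m) (by rw [ha, mul_assoc])]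

variable {G : Type*} [Group G] [TopologicalSpace G]

theorem map_mem_closure_range_pow (α : Multiplicative ℤ_[p] →ₜ* G) (x : ℤ_[p]) :
    α (.ofAdd x) ∈ closure (Set.range fun n : ℕ ↦ α (.ofAdd 1) ^ n) := by
  have hc : Continuous fun y : ℤ_[p] ↦ α (.ofAdd y) := α.continuous_toFun
  refine map_mem_closure hc (PadicInt.denseRange_natCast x) ?_
  rintro _ ⟨n, rfl⟩
  refine ⟨n, ?_⟩
  change α (.ofAdd 1) ^ n = α (.ofAdd (n : ℤ_[p]))
  rw [← map_pow, ← ofAdd_nsmul, nsmul_one]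

theorem exists_map_pow_mem (α : Multiplicative ℤ_[p] →ₜ* G) (H : OpenNormalSubgroup G) :
    ∃ k, α (.ofAdd 1) ^ p ^ k ∈ H := by
  have hc : Continuous fun y : ℤ_[p] ↦ α (.ofAdd y) := α.continuous_toFun
  have h0 : Filter.Tendsto (fun k : ℕ ↦ (p : ℤ_[p]) ^ k) Filter.atTop (𝓝 0) :=
    tendsto_pow_atTop_nhds_zero_of_norm_lt_one (norm_natCast_p_lt_one)
  have h1 := (hc.tendsto 0).comp h0
  have h2 : (H : Set G) ∈ 𝓝 (α (.ofAdd (0 : ℤ_[p]))) := by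
    rw [ofAdd_zero, map_one]
    exact H.isOpen'.mem_nhds H.one_mem
  obtain ⟨k, hk⟩ := (h1.eventually h2).exists
  refine ⟨k, ?_⟩
  have h3 : α (.ofAdd 1) ^ p ^ k = α (.ofAdd ((p : ℤ_[p]) ^ k)) := by
    rw [← map_pow, ← ofAdd_nsmul, nsmul_one, Nat.cast_pow]
  rw [h3]
  exact hk

/-- `1 + p ^ 2` topologically generates `1 + p ^ 2 ℤ_p` for every `p`, including `2`;
representatives of the finitely many cosets complete it. -/
theorem exists_finite_generating_units : ∃ S : Set ℤ_[p]ˣ, S.Finite ∧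
    ∀ Q : Subgroup ℤ_[p]ˣ, IsClosed (Q : Set ℤ_[p]ˣ) → S ⊆ Q → Q = ⊤ := by
  obtain ⟨g, hg⟩ := exists_unit_eq_one_add_mul (p : ℤ_[p])
  rw [← sq] at hg
  let φ : ℤ_[p]ˣ →* (ZMod (p ^ 2))ˣ := Units.map (PadicInt.toZModPow 2).toMonoidHom
  have : Finite (ℤ_[p]ˣ ⧸ φ.ker) :=
    Finite.of_equiv _ (QuotientGroup.quotientKerEquivRange φ).symm.toEquiv
  refine ⟨insert g (Set.range fun q : ℤ_[p]ˣ ⧸ φ.ker ↦ q.out),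
    (Set.finite_range _).insert g, fun Q hQ hS ↦ ?_⟩
  have hker : φ.ker ≤ Q := by
    intro a ha
    have h1 : PadicInt.toZModPow 2 (a : ℤ_[p]) = 1 := congrArg Units.val (MonoidHom.mem_ker.1 ha)
    have h2 : (p : ℤ_[p]) ^ 2 ∣ a - 1 := by
      rw [← Ideal.mem_span_singleton, ← PadicInt.ker_toZModPow, RingHom.mem_ker, map_sub, h1,
        map_one, sub_self]
    refine closure_minimal ?_ hQ (mem_closure_range_pow le_rfl hg h2)
    rintro _ ⟨n, rfl⟩
    exact pow_mem (hS (Set.mem_insert _ _)) n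
  refine (Subgroup.eq_top_iff' Q).2 fun a ↦ ?_
  obtain ⟨h, hh⟩ := QuotientGroup.mk_out_eq_mul φ.ker a
  have h1 : a = (QuotientGroup.mk a : ℤ_[p]ˣ ⧸ φ.ker).out * (h : ℤ_[p]ˣ)⁻¹ := by
    rw [hh, mul_inv_cancel_right]
  rw [h1]
  exact mul_mem (hS (Set.mem_insert_of_mem _ ⟨_, rfl⟩)) (inv_mem (hker h.2))

theorem exists_finite_generating (α : Multiplicative ℤ_[p] →ₜ* G)
    (β : ℤ_[p]ˣ × ℤ_[p]ˣ →ₜ* G) (h : ∀ g, ∃ x y, g = α x * β y) :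
    ∃ S : Set G, S.Finite ∧ ∀ Q : Subgroup G, IsClosed (Q : Set G) → S ⊆ Q → Q = ⊤ := by
  obtain ⟨S, hS, hSQ⟩ := exists_finite_generating_units (p := p)
  refine ⟨insert (α (.ofAdd 1)) (((fun a ↦ β (a, 1)) '' S) ∪ ((fun a ↦ β (1, a)) '' S)),
    ((hS.image _).union (hS.image _)).insert _, fun Q hQ hQS ↦ ?_⟩
  have hα : ∀ x, α x ∈ Q := by
    intro x
    refine closure_minimal ?_ hQ (map_mem_closure_range_pow α x.toAdd)
    rintro _ ⟨n, rfl⟩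
    exact pow_mem (hQS (Set.mem_insert _ _)) n
  have h1 : Q.comap (β.toMonoidHom.comp (MonoidHom.inl _ _)) = ⊤ :=
    hSQ _ (hQ.preimage (β.continuous_toFun.comp (continuous_id.prodMk continuous_const)))
      fun a ha ↦ hQS (Set.mem_insert_of_mem _ (.inl ⟨a, ha, rfl⟩))
  have h2 : Q.comap (β.toMonoidHom.comp (MonoidHom.inr _ _)) = ⊤ :=
    hSQ _ (hQ.preimage (β.continuous_toFun.comp (continuous_const.prodMk continuous_id)))
      fun a ha ↦ hQS (Set.mem_insert_of_mem _ (.inr ⟨a, ha, rfl⟩))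
  refine (Subgroup.eq_top_iff' Q).2 fun g ↦ ?_
  obtain ⟨x, ⟨a, d⟩, rfl⟩ := h g
  refine mul_mem (hα x) ?_
  have h3 : β (a, d) = β (a, 1) * β (1, d) := by rw [← map_mul]; simp
  rw [h3]
  exact mul_mem ((Subgroup.eq_top_iff' _).1 h1 a) ((Subgroup.eq_top_iff' _).1 h2 d)

end Representation

/-! ### A criterion for the simplicity of induced modules -/

section Criterion

open CompletedGroupRing

theorem mk_ne_zero_of_cyclic {A N : Type*} [Ring A] [AddCommGroup N] [Module A N] {v : N}
    (hv : ∀ n : N, ∃ a : A, n = a • v) {M : Submodule A N} (hM : M ≠ ⊤) :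
    (Submodule.Quotient.mk v : N ⧸ M) ≠ 0 := by
  intro h
  refine hM ((Submodule.eq_top_iff').2 fun n ↦ ?_)
  obtain ⟨a, rfl⟩ := hv n
  exact M.smul_mem a ((Submodule.Quotient.mk_eq_zero M).1 h)

/-- The homomorphism from `G` to the multiplicative monoid of `K[[G]]`. -/
def IwasawaAlgebra.ofHom (K : Type*) [NormedField K] [IsUltrametricDist K] (G : Type*) [Group G]
    [TopologicalSpace G] : G →* IwasawaAlgebra K G where
  toFun g := 1 ⊗ₜ of (RingOfIntegersOf K) g
  map_one' := by rw [of_one]; rfl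
  map_mul' g h := by rw [of_mul, Algebra.TensorProduct.tmul_mul_tmul, mul_one]

variable (p : ℕ) [hp : Fact p.Prime] {K : Type*} [NormedField K] [IsUltrametricDist K]
  [NormedAlgebra ℚ_[p] K] [FiniteDimensional ℚ_[p] K]
  {G P T : Type*} [Group G] [TopologicalSpace G] [Group P] [TopologicalSpace P] [Group T]
  [TopologicalSpace T] [IsTopologicalGroup G] [CompactSpace G]

/-- If a module induced from a character has a proper nonzero submodule then the character `ψ` of
`ℤ_pˣ` that describes the commutation of `w` with `α` is algebraic near `1`. -/
theorem exists_eq_pow_of_submodule (ι : P →ₜ* G) (χ : P →ₜ* (RingOfIntegersOf K)ˣ)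
    {S : Set P} (hSfin : S.Finite) (hS : ∀ Q : Subgroup P, IsClosed (Q : Set P) → S ⊆ Q → Q = ⊤)
    (α : Multiplicative ℤ_[p] →ₜ* G) (hdec : ∀ g, ∃ x h, g = α x * ι h)
    (t : ℤ_[p]ˣ → P) (htα : ∀ (s : ℤ_[p]ˣ) (x : ℤ_[p]),
      ι (t s) * α (.ofAdd (s * x)) = α (.ofAdd x) * ι (t s)) (w : G) (ψ : ℤ_[p]ˣ →* K)
    (hw : ∀ (m : ℕ) (s : ℤ_[p]ˣ), (s : ℤ_[p]) = 1 + p * m → ∃ h, w * α (.ofAdd (m : ℤ_[p])) =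
      α (.ofAdd (((s⁻¹ : ℤ_[p]ˣ) : ℤ_[p]) * m)) * ι h ∧ ((χ h : RingOfIntegersOf K) : K) = ψ s)
    {N : Type*} [AddCommGroup N] [Module (IwasawaAlgebra K G) N] [Module K N]
    [IsScalarTower K (IwasawaAlgebra K G) N] {v : N}
    (hv : ∀ n : N, ∃ a : IwasawaAlgebra K G, n = a • v)
    (hPv : ∀ h, IwasawaAlgebra.ofHom K G (ι h) • v = ((χ h : RingOfIntegersOf K) : K) • v)
    {M : Submodule (IwasawaAlgebra K G) N} (hbot : M ≠ ⊥) (htop : M ≠ ⊤) :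
    ∃ r k : ℕ, 0 < r ∧ ∀ (a : ℤ_[p]ˣ) (m : ℕ), (a : ℤ_[p]) = ((1 + p * r * m : ℕ) : ℤ_[p]) →
      ψ a = ((1 + p * r * m : ℕ) : K) ^ k := by
  have : CharZero K := charZero_of_normedAlgebra_padic p K
  have hdec' : ∀ g, ∃ u' ∈ closure (Set.range fun n : ℕ ↦ α (.ofAdd 1) ^ n),
      ∃ h, g = u' * ι h := by
    intro g
    obtain ⟨x, h, hg⟩ := hdec g
    exact ⟨α x, map_mem_closure_range_pow α x.toAdd, h, hg⟩
  have := finiteDimensional_quotient_of_cyclic p ι χ hSfin hS (exists_map_pow_mem α) hdec' hv hPv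
    M hbot
  have hPv' : ∀ h, IwasawaAlgebra.ofHom K G (ι h) • (Submodule.Quotient.mk v : N ⧸ M) =
      ((χ h : RingOfIntegersOf K) : K) • (Submodule.Quotient.mk v : N ⧸ M) := by
    intro h
    rw [← Submodule.Quotient.mk_smul, hPv, Submodule.Quotient.mk_smul]
  refine exists_eq_pow_of_representation (V := N ⧸ M) (IwasawaAlgebra.ofHom K G) α.toMonoidHom
    (fun s ↦ ι (t s)) w ψ (mk_ne_zero_of_cyclic hv htop) (fun s ↦ ⟨_, ?_, hPv' (t s)⟩) htα ?_
  · exact (((χ (t s)).isUnit.map (RingOfIntegersOf K).subtype).ne_zero)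
  · intro m s hs
    obtain ⟨h, hh, hψ⟩ := hw m s hs
    exact ⟨ι h, hh, by rw [hPv', hψ]⟩

variable [TotallyDisconnectedSpace G] [IsTopologicalGroup P] [CompactSpace P]
  [IsTopologicalGroup T] [CompactSpace T]

/-- A module induced from a character is simple if the associated character `ψ` of `ℤ_pˣ` is not
algebraic near `1`. -/
theorem isSimpleModule_induced (ι : P →ₜ* G) (τ : P →ₜ* T) (χ : T →ₜ* (RingOfIntegersOf K)ˣ)
    {f : G → RingOfIntegersOf K} (hf : Continuous f) (hf1 : f 1 = 1)
    (hfP : ∀ g h, f (g * ι h) = f g * χ (τ h))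
    (hS : ∃ S : Set P, S.Finite ∧ ∀ Q : Subgroup P, IsClosed (Q : Set P) → S ⊆ Q → Q = ⊤)
    (α : Multiplicative ℤ_[p] →ₜ* G) (hdec : ∀ g, ∃ x h, g = α x * ι h)
    (t : ℤ_[p]ˣ → P) (htα : ∀ (s : ℤ_[p]ˣ) (x : ℤ_[p]),
      ι (t s) * α (.ofAdd (s * x)) = α (.ofAdd x) * ι (t s)) (w : G) (ψ : ℤ_[p]ˣ →* K)
    (hw : ∀ (m : ℕ) (s : ℤ_[p]ˣ), (s : ℤ_[p]) = 1 + p * m → ∃ h, w * α (.ofAdd (m : ℤ_[p])) =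
      α (.ofAdd (((s⁻¹ : ℤ_[p]ˣ) : ℤ_[p]) * m)) * ι h ∧
        ((χ (τ h) : RingOfIntegersOf K) : K) = ψ s)
    (hψ : ¬ ∃ r k : ℕ, 0 < r ∧ ∀ (a : ℤ_[p]ˣ) (m : ℕ),
      (a : ℤ_[p]) = ((1 + p * r * m : ℕ) : ℤ_[p]) → ψ a = ((1 + p * r * m : ℕ) : K) ^ k) :
    IsSimpleModule (IwasawaAlgebra K G) (BaseChangeModule (IwasawaAlgebra.map K ι).toRingHom
      (ScalarModule ((characterExtension p χ).comp (IwasawaAlgebra.map K τ)).toRingHom)) := by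
  have := nontrivial_induced p ι τ χ hf hf1 hfP
  set φ := (characterExtension p χ).comp (IwasawaAlgebra.map K τ) with hφ
  have hφof : ∀ h, φ (1 ⊗ₜ of (RingOfIntegersOf K) h) = ((χ (τ h) : RingOfIntegersOf K) : K) := by
    intro h
    rw [hφ, AlgHom.comp_apply, IwasawaAlgebra.map, Algebra.TensorProduct.map_tmul, map_of]
    exact (characterExtension_of p χ 1 (τ h)).trans (one_mul _)
  have hPv := fun h ↦ (tmul_of_smul_cyclicVector ι φ h).trans (by rw [hφof])
  refine (isSimpleModule_iff _ _).2 ⟨fun M ↦ ?_⟩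
  by_contra! hM
  obtain ⟨S, hSfin, hS⟩ := hS
  exact hψ (exists_eq_pow_of_submodule p ι (χ.comp τ) hSfin hS α hdec t htα w ψ hw
    (exists_smul_cyclicVector _ _ fun k ↦ ⟨algebraMap K _ k, φ.commutes k⟩) hPv hM.1 hM.2)

end Criterion

/-! ### The Iwahori subgroup of `GL₂(ℤ_p)` -/

section Iwahori

variable {p : ℕ} [hp : Fact p.Prime]

instance : CompactSpace (GL (Fin 2) ℤ_[p]) := by
  have : CompactSpace (Matrix (Fin 2) (Fin 2) ℤ_[p]) :=
    inferInstanceAs (CompactSpace (Fin 2 → Fin 2 → ℤ_[p]))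
  exact inferInstanceAs (CompactSpace (Matrix (Fin 2) (Fin 2) ℤ_[p])ˣ)

theorem continuous_entry (i j : Fin 2) : Continuous fun g : iwahori p ↦ g.1.val i j :=
  (Units.continuous_val.comp continuous_subtype_val).matrix_elem i j

instance : CompactSpace (iwahori p) := by
  refine isCompact_iff_compactSpace.1 (IsClosed.isCompact ?_)
  have h : ((iwahori p : Subgroup (GL (Fin 2) ℤ_[p])) : Set (GL (Fin 2) ℤ_[p])) =
      (fun g ↦ g.val 0 1) ⁻¹' Metric.closedBall (0 : ℤ_[p]) (((p : ℝ)⁻¹) ^ 1) := by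
    ext g
    rw [Set.mem_preimage, mem_closedBall_zero_iff, ← prime_pow_dvd_iff, pow_one]
    rfl
  rw [h]
  exact Metric.isClosed_closedBall.preimage (Units.continuous_val.matrix_elem 0 1)

instance : CompactSpace (lowerTriangular p) :=
  isCompact_iff_compactSpace.1
    (isClosed_singleton.preimage (continuous_entry (p := p) 0 1)).isCompact

instance : CompactSpace (upperTriangular p) :=
  isCompact_iff_compactSpace.1
    (isClosed_singleton.preimage (continuous_entry (p := p) 1 0)).isCompact

instance : CompactSpace (diagonalTorus p) :=
  isCompact_iff_compactSpace.1
    ((isClosed_singleton.preimage (continuous_entry (p := p) 0 1)).inter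
      (isClosed_singleton.preimage (continuous_entry (p := p) 1 0))).isCompact

theorem iwahori_ext {g h : iwahori p} (H : g.1.val = h.1.val) : g = h :=
  Subtype.ext (Units.ext H)

instance : TotallyDisconnectedSpace (iwahori p) := by
  have : TotallyDisconnectedSpace (Matrix (Fin 2) (Fin 2) ℤ_[p]) :=
    inferInstanceAs (TotallyDisconnectedSpace (Fin 2 → Fin 2 → ℤ_[p]))
  refine ⟨isTotallyDisconnected_of_image
    (f := fun g : iwahori p ↦ g.1.val) (Units.continuous_val.comp
        continuous_subtype_val).continuousOn
    (fun _ _ h ↦ iwahori_ext h) (isTotallyDisconnected_of_totallyDisconnectedSpace _)⟩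

theorem continuous_units_iff {X : Type*} [TopologicalSpace X] {f : X → ℤ_[p]ˣ} :
    Continuous f ↔ Continuous fun x ↦ (f x : ℤ_[p]) :=
  (Units.continuous_val.isClosedEmbedding Units.val_injective).isInducing.continuous_iff

/-- The unipotent matrices `[[1, p x], [0, 1]]`. -/
def upperUnipotent : Multiplicative ℤ_[p] →ₜ* iwahori p where
  toFun x := ⟨⟨!![1, p * x.toAdd; 0, 1], !![1, -(p * x.toAdd); 0, 1],
    by simp [Matrix.one_fin_two], by simp [Matrix.one_fin_two]⟩, dvd_mul_right _ _⟩
  map_one' := iwahori_ext (by simp [Matrix.one_fin_two])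
  map_mul' x y := iwahori_ext (by simp [mul_add, add_comm])
  continuous_toFun := by
    refine Continuous.subtype_mk (Units.continuous_iff.mpr ⟨?_, ?_⟩) _
    all_goals
      refine continuous_matrix fun i j ↦ ?_
      fin_cases i <;> fin_cases j <;> simp <;> fun_prop

/-- The unipotent matrices `[[1, 0], [x, 1]]`. -/
def lowerUnipotent : Multiplicative ℤ_[p] →ₜ* iwahori p where
  toFun x := ⟨⟨!![1, 0; x.toAdd, 1], !![1, 0; -x.toAdd, 1],
    by simp [Matrix.one_fin_two], by simp [Matrix.one_fin_two]⟩, dvd_zero _⟩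
  map_one' := iwahori_ext (by simp [Matrix.one_fin_two])
  map_mul' x y := iwahori_ext (by simp)
  continuous_toFun := by
    refine Continuous.subtype_mk (Units.continuous_iff.mpr ⟨?_, ?_⟩) _
    all_goals
      refine continuous_matrix fun i j ↦ ?_
      fin_cases i <;> fin_cases j <;> simp <;> fun_prop

theorem upperUnipotent_val (x : ℤ_[p]) :
    (upperUnipotent (.ofAdd x)).1.val = !![1, (p : ℤ_[p]) * x; 0, 1] := rfl

theorem lowerUnipotent_val (x : ℤ_[p]) :
    (lowerUnipotent (.ofAdd x)).1.val = !![1, 0; x, 1] := rfl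

theorem torusDiag_val (a d : ℤ_[p]ˣ) :
    (torusDiag (a, d)).1.1.val = !![(a : ℤ_[p]), 0; 0, (d : ℤ_[p])] := rfl

/-- The unipotent matrices `[[1, p x], [0, 1]]` in the group of upper triangular matrices. -/
def upperUnipotent' : Multiplicative ℤ_[p] →ₜ* upperTriangular p where
  toFun x := ⟨upperUnipotent x, rfl⟩
  map_one' := Subtype.ext (map_one upperUnipotent)
  map_mul' x y := Subtype.ext (map_mul upperUnipotent x y)
  continuous_toFun := upperUnipotent.continuous_toFun.subtype_mk _

/-- The unipotent matrices `[[1, 0], [x, 1]]` in the group of lower triangular matrices. -/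
def lowerUnipotent' : Multiplicative ℤ_[p] →ₜ* lowerTriangular p where
  toFun x := ⟨lowerUnipotent x, rfl⟩
  map_one' := Subtype.ext (map_one lowerUnipotent)
  map_mul' x y := Subtype.ext (map_mul lowerUnipotent x y)
  continuous_toFun := lowerUnipotent.continuous_toFun.subtype_mk _

/-- The diagonal matrices in the group of lower triangular matrices. -/
def lowerTorusDiag : ℤ_[p]ˣ × ℤ_[p]ˣ →ₜ* lowerTriangular p where
  toMonoidHom := (Subgroup.inclusion inf_le_left).comp torusDiag.toMonoidHom
  continuous_toFun := (continuous_subtype_val.comp torusDiag.continuous_toFun).subtype_mk _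

/-- The diagonal matrices in the group of upper triangular matrices. -/
def upperTorusDiag : ℤ_[p]ˣ × ℤ_[p]ˣ →ₜ* upperTriangular p where
  toMonoidHom := (Subgroup.inclusion inf_le_right).comp torusDiag.toMonoidHom
  continuous_toFun := (continuous_subtype_val.comp torusDiag.continuous_toFun).subtype_mk _

theorem isUnit_diag (g : iwahori p) (i : Fin 2) : IsUnit (g.1.val i i) := by
  obtain ⟨y, hy⟩ : (p : ℤ_[p]) ∣ g.1.val 0 1 := g.2
  have hdet : IsUnit (g.1.val 0 0 * g.1.val 1 1 - g.1.val 0 1 * g.1.val 1 0) := by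
    rw [← Matrix.det_fin_two]
    exact (Matrix.isUnit_iff_isUnit_det _).1 g.1.isUnit
  have h : IsUnit (g.1.val 0 0 * g.1.val 1 1) := by
    by_contra hn
    have hmem : g.1.val 0 0 * g.1.val 1 1 - g.1.val 0 1 * g.1.val 1 0 ∈
        IsLocalRing.maximalIdeal ℤ_[p] := by
      refine sub_mem hn ?_
      rw [hy, mul_assoc]
      exact Ideal.mul_mem_right _ _ PadicInt.p_nonunit
    exact hmem hdet
  fin_cases i
  · exact isUnit_of_mul_isUnit_left h
  · exact isUnit_of_mul_isUnit_right h

/-- The diagonal entries of a matrix in the Iwahori subgroup, as units. -/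
def diagUnit (i : Fin 2) (g : iwahori p) : ℤ_[p]ˣ := (isUnit_diag g i).unit

theorem diagUnit_val (i : Fin 2) (g : iwahori p) : (diagUnit i g : ℤ_[p]) = g.1.val i i := rfl

theorem continuous_diagUnit (i : Fin 2) : Continuous (diagUnit (p := p) i) :=
  continuous_units_iff.2 (continuous_entry i i)

/-- The determinant on the Iwahori subgroup. -/
def detUnit (g : iwahori p) : ℤ_[p]ˣ := Matrix.GeneralLinearGroup.det g.1

theorem detUnit_val (g : iwahori p) : (detUnit g : ℤ_[p]) =
    g.1.val 0 0 * g.1.val 1 1 - g.1.val 0 1 * g.1.val 1 0 := Matrix.det_fin_two _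

theorem continuous_detUnit : Continuous (detUnit (p := p)) := by
  refine continuous_units_iff.2 ?_
  simp only [detUnit_val]
  exact ((continuous_entry 0 0).mul (continuous_entry 1 1)).sub
    ((continuous_entry 0 1).mul (continuous_entry 1 0))

theorem mul_val (g h : iwahori p) (i j : Fin 2) : (g * h).1.val i j =
    g.1.val i 0 * h.1.val 0 j + g.1.val i 1 * h.1.val 1 j := by
  change (g.1.val * h.1.val) i j = _
  rw [Matrix.mul_apply, Fin.sum_univ_two]

theorem exists_eq_upperUnipotent_mul (g : iwahori p) :
    ∃ x h, g = upperUnipotent x * lowerToIwahori p h := by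
  obtain ⟨y, hy⟩ : (p : ℤ_[p]) ∣ g.1.val 0 1 := g.2
  -- Chosen to clear the upper right entry `p y`. The lower right entry is a unit for every element
  -- of the Iwahori subgroup.
  let x : ℤ_[p] := y * ((diagUnit 1 g)⁻¹ : ℤ_[p]ˣ)
  refine ⟨.ofAdd x, ⟨(upperUnipotent (.ofAdd x))⁻¹ * g, ?_⟩, (mul_inv_cancel_left _ _).symm⟩
  change ((upperUnipotent (.ofAdd x))⁻¹ * g).1.val 0 1 = 0
  rw [← map_inv, ← ofAdd_neg, mul_val, upperUnipotent_val]
  simp only [Matrix.of_apply, Matrix.cons_val', Matrix.cons_val_zero, Matrix.cons_val_one, one_mul]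
  rw [hy, ← diagUnit_val, mul_assoc, neg_mul, mul_assoc, Units.inv_mul]
  simp

theorem exists_eq_lowerUnipotent_mul (g : iwahori p) :
    ∃ x h, g = lowerUnipotent x * upperToIwahori p h := by
  let x : ℤ_[p] := g.1.val 1 0 * ((diagUnit 0 g)⁻¹ : ℤ_[p]ˣ)
  refine ⟨.ofAdd x, ⟨(lowerUnipotent (.ofAdd x))⁻¹ * g, ?_⟩, (mul_inv_cancel_left _ _).symm⟩
  change ((lowerUnipotent (.ofAdd x))⁻¹ * g).1.val 1 0 = 0
  rw [← map_inv, ← ofAdd_neg, mul_val, lowerUnipotent_val]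
  simp only [Matrix.of_apply, Matrix.cons_val', Matrix.cons_val_zero, Matrix.cons_val_one, one_mul]
  rw [← diagUnit_val, neg_mul, mul_assoc, Units.inv_mul]
  simp

theorem exists_diag_eq (g : iwahori p) :
    ∃ a d : ℤ_[p]ˣ, g.1.val 0 0 = a ∧ g.1.val 1 1 = d :=
  ⟨diagUnit 0 g, diagUnit 1 g, rfl, rfl⟩

theorem exists_eq_lowerUnipotent_mul_diag (g : lowerTriangular p) :
    ∃ x y, g = lowerUnipotent' x * lowerTorusDiag y := by
  have hg : g.1.1.val 0 1 = 0 := g.2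
  obtain ⟨a, d, ha, hd⟩ := exists_diag_eq g.1
  let z : ℤ_[p] := g.1.1.val 1 0 * (a⁻¹ : ℤ_[p]ˣ)
  have h : g.1 = lowerUnipotent (.ofAdd z) * (torusDiag (a, d)).1 := by
    refine iwahori_ext (Matrix.ext fun i j ↦ ?_)
    rw [mul_val, lowerUnipotent_val, torusDiag_val]
    fin_cases i <;> fin_cases j <;> simp [hg, ha, hd, z]
  exact ⟨.ofAdd z, (a, d), Subtype.ext h⟩

theorem exists_eq_upperUnipotent_mul_diag (g : upperTriangular p) :
    ∃ x y, g = upperUnipotent' x * upperTorusDiag y := by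
  have hg : g.1.1.val 1 0 = 0 := g.2
  obtain ⟨y, hy⟩ : (p : ℤ_[p]) ∣ g.1.1.val 0 1 := g.1.2
  obtain ⟨a, d, ha, hd⟩ := exists_diag_eq g.1
  let z : ℤ_[p] := y * (d⁻¹ : ℤ_[p]ˣ)
  have h : g.1 = upperUnipotent (.ofAdd z) * (torusDiag (a, d)).1 := by
    refine iwahori_ext (Matrix.ext fun i j ↦ ?_)
    rw [mul_val, upperUnipotent_val, torusDiag_val]
    fin_cases i <;> fin_cases j <;> simp [hg, ha, hd, hy, z, mul_assoc]
  exact ⟨.ofAdd z, (a, d), Subtype.ext h⟩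

theorem lowerToTorus_eq (h : lowerTriangular p) :
    lowerToTorus p h = torusDiag (diagUnit 0 h.1, diagUnit 1 h.1) := by
  have : ∀ i, lowerDiagEntry i h = diagUnit i h.1 := fun i ↦ Units.ext rfl
  rw [← this, ← this]
  rfl

theorem upperToTorus_eq (h : upperTriangular p) :
    upperToTorus p h = torusDiag (diagUnit 0 h.1, diagUnit 1 h.1) := by
  have : ∀ i, upperDiagEntry i h = diagUnit i h.1 := fun i ↦ Units.ext rfl
  rw [← this, ← this]
  rfl

theorem detUnit_mul (g h : iwahori p) : detUnit (g * h) = detUnit g * detUnit h :=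
  map_mul Matrix.GeneralLinearGroup.det g.1 h.1

/-- The continuous map `g ↦ diag(det g / d, d)` from `B` to `T`, where `d` is the lower right
entry of `g`. It extends the projection of lower triangular matrices. -/
def lowerRetraction (g : iwahori p) : diagonalTorus p :=
  torusDiag (detUnit g / diagUnit 1 g, diagUnit 1 g)

/-- The continuous map `g ↦ diag(a, det g / a)` from `B` to `T`, where `a` is the upper left
entry of `g`. It extends the projection of upper triangular matrices. -/
def upperRetraction (g : iwahori p) : diagonalTorus p :=
  torusDiag (diagUnit 0 g, detUnit g / diagUnit 0 g)

theorem continuous_lowerRetraction : Continuous (lowerRetraction (p := p)) :=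
  torusDiag.continuous_toFun.comp
    ((continuous_detUnit.div' (continuous_diagUnit 1)).prodMk (continuous_diagUnit 1))

theorem continuous_upperRetraction : Continuous (upperRetraction (p := p)) :=
  torusDiag.continuous_toFun.comp
    ((continuous_diagUnit 0).prodMk (continuous_detUnit.div' (continuous_diagUnit 0)))

theorem lowerRetraction_one : lowerRetraction (p := p) 1 = 1 := by
  have h : diagUnit 1 (1 : iwahori p) = 1 := Units.ext rfl
  have h' : detUnit (1 : iwahori p) = 1 := map_one Matrix.GeneralLinearGroup.det
  rw [lowerRetraction, h, h', div_one]
  exact map_one torusDiag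

theorem upperRetraction_one : upperRetraction (p := p) 1 = 1 := by
  have h : diagUnit 0 (1 : iwahori p) = 1 := Units.ext rfl
  have h' : detUnit (1 : iwahori p) = 1 := map_one Matrix.GeneralLinearGroup.det
  rw [upperRetraction, h, h', div_one]
  exact map_one torusDiag

theorem lowerRetraction_mul (g : iwahori p) (h : lowerTriangular p) :
    lowerRetraction (g * lowerToIwahori p h) = lowerRetraction g * lowerToTorus p h := by
  have hh : h.1.1.val 0 1 = 0 := h.2
  have h1 : diagUnit 1 (g * h.1) = diagUnit 1 g * diagUnit 1 h.1 := by
    apply Units.ext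
    rw [Units.val_mul, diagUnit_val, diagUnit_val, diagUnit_val, mul_val, hh]
    simp
  have h2 : detUnit h.1 = diagUnit 0 h.1 * diagUnit 1 h.1 := by
    apply Units.ext
    rw [Units.val_mul, diagUnit_val, diagUnit_val, detUnit_val, hh]
    simp
  change lowerRetraction (g * h.1) = _
  rw [lowerToTorus_eq, lowerRetraction, lowerRetraction, ← map_mul, detUnit_mul, h1, h2,
    Prod.mk_mul_mk]
  rw [mul_div_mul_comm, mul_div_cancel_right]

theorem upperRetraction_mul (g : iwahori p) (h : upperTriangular p) :
    upperRetraction (g * upperToIwahori p h) = upperRetraction g * upperToTorus p h := by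
  have hh : h.1.1.val 1 0 = 0 := h.2
  have h1 : diagUnit 0 (g * h.1) = diagUnit 0 g * diagUnit 0 h.1 := by
    apply Units.ext
    rw [Units.val_mul, diagUnit_val, diagUnit_val, diagUnit_val, mul_val, hh]
    simp
  have h2 : detUnit h.1 = diagUnit 0 h.1 * diagUnit 1 h.1 := by
    apply Units.ext
    rw [Units.val_mul, diagUnit_val, diagUnit_val, detUnit_val, hh]
    simp
  change upperRetraction (g * h.1) = _
  rw [upperToTorus_eq, upperRetraction, upperRetraction, ← map_mul, detUnit_mul, h1, h2,
    Prod.mk_mul_mk]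
  rw [mul_div_mul_comm, mul_div_cancel_left]

end Iwahori

/-! ### Simplicity of `N_χ` and `N_χ⁻` -/

section Simplicity

variable {p : ℕ} [hp : Fact p.Prime]

theorem lowerTorusDiag_mul_upperUnipotent (s : ℤ_[p]ˣ) (x : ℤ_[p]) :
    lowerToIwahori p (lowerTorusDiag (1, s)) * upperUnipotent (.ofAdd ((s : ℤ_[p]) * x)) =
      upperUnipotent (.ofAdd x) * lowerToIwahori p (lowerTorusDiag (1, s)) := by
  change (torusDiag (1, s)).1 * _ = _ * (torusDiag (1, s)).1
  refine iwahori_ext (Matrix.ext fun i j ↦ ?_)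
  rw [mul_val, mul_val, upperUnipotent_val, upperUnipotent_val, torusDiag_val]
  fin_cases i <;> fin_cases j <;> simp [mul_left_comm, mul_assoc, mul_comm x]

theorem upperTorusDiag_mul_lowerUnipotent (s : ℤ_[p]ˣ) (x : ℤ_[p]) :
    upperToIwahori p (upperTorusDiag (s, 1)) * lowerUnipotent (.ofAdd ((s : ℤ_[p]) * x)) =
      lowerUnipotent (.ofAdd x) * upperToIwahori p (upperTorusDiag (s, 1)) := by
  change (torusDiag (s, 1)).1 * _ = _ * (torusDiag (s, 1)).1
  refine iwahori_ext (Matrix.ext fun i j ↦ ?_)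
  rw [mul_val, mul_val, lowerUnipotent_val, lowerUnipotent_val, torusDiag_val]
  fin_cases i <;> fin_cases j <;> simp [mul_comm]

theorem lowerToTorus_lowerTorusDiag_mul (a d : ℤ_[p]ˣ) (x : Multiplicative ℤ_[p]) :
    lowerToTorus p (lowerTorusDiag (a, d) * lowerUnipotent' x) = torusDiag (a, d) := by
  have h : ∀ i, lowerDiagEntry i (lowerUnipotent' (p := p) x) = 1 := fun i ↦
    Units.ext (by fin_cases i <;> rfl)
  have h0 : lowerDiagEntry 0 (lowerTorusDiag (a, d)) = a := Units.ext rfl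
  have h1 : lowerDiagEntry 1 (lowerTorusDiag (a, d)) = d := Units.ext rfl
  change torusDiag (lowerDiagEntry 0 _, lowerDiagEntry 1 _) = _
  rw [map_mul, map_mul, h, h, h0, h1, mul_one, mul_one]

theorem upperToTorus_upperTorusDiag_mul (a d : ℤ_[p]ˣ) (x : Multiplicative ℤ_[p]) :
    upperToTorus p (upperTorusDiag (a, d) * upperUnipotent' x) = torusDiag (a, d) := by
  have h : ∀ i, upperDiagEntry i (upperUnipotent' (p := p) x) = 1 := fun i ↦
    Units.ext (by fin_cases i <;> rfl)
  have h0 : upperDiagEntry 0 (upperTorusDiag (a, d)) = a := Units.ext rfl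
  have h1 : upperDiagEntry 1 (upperTorusDiag (a, d)) = d := Units.ext rfl
  change torusDiag (upperDiagEntry 0 _, upperDiagEntry 1 _) = _
  rw [map_mul, map_mul, h, h, h0, h1, mul_one, mul_one]

/-- The product is `[[1, p x], [1, s]]`, of determinant `1` and lower right entry `s`, so its
diagonal part is `diag(s⁻¹, s)`. This is where the character defining `c(χ)` enters. -/
theorem lowerUnipotent_mul_upperUnipotent {x : ℤ_[p]} {s : ℤ_[p]ˣ} (hs : (s : ℤ_[p]) = 1 + p * x) :
    ∃ h, lowerUnipotent (.ofAdd 1) * upperUnipotent (.ofAdd x) =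
      upperUnipotent (.ofAdd (((s⁻¹ : ℤ_[p]ˣ) : ℤ_[p]) * x)) * lowerToIwahori p h ∧
      lowerToTorus p h = torusDiag (s⁻¹, s) := by
  refine ⟨lowerTorusDiag (s⁻¹, s) * lowerUnipotent' (.ofAdd ((s⁻¹ : ℤ_[p]ˣ) : ℤ_[p])), ?_,
    lowerToTorus_lowerTorusDiag_mul _ _ _⟩
  change _ = upperUnipotent _ * ((torusDiag (s⁻¹, s)).1 * lowerUnipotent _)
  have h1 : (s : ℤ_[p]) * (s⁻¹ : ℤ_[p]ˣ) = 1 := s.mul_inv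
  refine iwahori_ext (Matrix.ext fun i j ↦ ?_)
  simp only [mul_val, upperUnipotent_val, torusDiag_val, lowerUnipotent_val]
  generalize ((s⁻¹ : ℤ_[p]ˣ) : ℤ_[p]) = y at h1 ⊢
  fin_cases i <;> fin_cases j <;> simp
  · linear_combination (-1 - p * y * x) * h1 + y * hs
  · linear_combination (-p * x) * h1
  · linear_combination -h1
  · linear_combination -hs

/-- Here the product is `[[s, p], [x, 1]]` and the diagonal part is inverted; this is the origin of
the sign in the condition on `N_χ⁻`. -/
theorem upperUnipotent_mul_lowerUnipotent {x : ℤ_[p]} {s : ℤ_[p]ˣ} (hs : (s : ℤ_[p]) = 1 + p * x) :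
    ∃ h, upperUnipotent (.ofAdd 1) * lowerUnipotent (.ofAdd x) =
      lowerUnipotent (.ofAdd (((s⁻¹ : ℤ_[p]ˣ) : ℤ_[p]) * x)) * upperToIwahori p h ∧
      upperToTorus p h = torusDiag (s, s⁻¹) := by
  refine ⟨upperTorusDiag (s, s⁻¹) * upperUnipotent' (.ofAdd ((s⁻¹ : ℤ_[p]ˣ) : ℤ_[p])), ?_,
    upperToTorus_upperTorusDiag_mul _ _ _⟩
  change _ = lowerUnipotent _ * ((torusDiag (s, s⁻¹)).1 * upperUnipotent _)
  have h1 : (s : ℤ_[p]) * (s⁻¹ : ℤ_[p]ˣ) = 1 := s.mul_inv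
  refine iwahori_ext (Matrix.ext fun i j ↦ ?_)
  simp only [mul_val, upperUnipotent_val, torusDiag_val, lowerUnipotent_val]
  generalize ((s⁻¹ : ℤ_[p]ˣ) : ℤ_[p]) = y at h1 ⊢
  fin_cases i <;> fin_cases j <;> simp
  · linear_combination -hs
  · linear_combination (-p) * h1
  · linear_combination (-x) * h1
  · linear_combination (-1 - p * y * x) * h1 + y * hs

variable {K : Type*} [NormedField K] [IsUltrametricDist K] [NormedAlgebra ℚ_[p] K]

/-- The character `a ↦ χ(diag(a⁻¹, a))`. -/
def antidiagonalCharacter (χ : diagonalTorus p →ₜ* (RingOfIntegersOf K)ˣ) : ℤ_[p]ˣ →* K where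
  toFun a := ((χ (torusDiag (a⁻¹, a)) : RingOfIntegersOf K) : K)
  map_one' := by
    rw [inv_one, ← Prod.one_eq_mk, map_one, map_one]
    rfl
  map_mul' a b := by
    rw [mul_inv, ← Prod.mk_mul_mk, map_mul, map_mul]
    rfl

omit [NormedAlgebra ℚ_[p] K] in
theorem continuous_antidiagonalCharacter (χ : diagonalTorus p →ₜ* (RingOfIntegersOf K)ˣ) :
    Continuous (antidiagonalCharacter χ) := by
  refine continuous_subtype_val.comp (Units.continuous_val.comp (χ.continuous_toFun.comp
    (torusDiag.continuous_toFun.comp ?_)))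
  exact continuous_inv.prodMk continuous_id

theorem existsUnique_isCharacterExponent [CompleteSpace K]
    (χ : diagonalTorus p →ₜ* (RingOfIntegersOf K)ˣ) : ∃! c : K, IsCharacterExponent χ c := by
  obtain ⟨c, hc⟩ := exists_exponent (continuous_antidiagonalCharacter χ)
  exact ⟨c, hc, fun c' hc' ↦ exponent_unique hc' hc⟩

variable [FiniteDimensional ℚ_[p] K]

theorem isSimpleModule_NModule (χ : diagonalTorus p →ₜ* (RingOfIntegersOf K)ˣ) {c : K}
    (hc : IsCharacterExponent χ c) (h : ∀ n : ℕ, c ≠ n) :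
    IsSimpleModule (IwasawaAlgebra K (iwahori p)) (NModule χ) := by
  have : CompleteSpace K := FiniteDimensional.complete ℚ_[p] K
  have hf : Continuous fun g ↦ (χ (lowerRetraction g) : RingOfIntegersOf K) :=
    Units.continuous_val.comp (χ.continuous_toFun.comp continuous_lowerRetraction)
  have hf1 : (χ (lowerRetraction (p := p) 1) : RingOfIntegersOf K) = 1 := by
    rw [lowerRetraction_one, map_one, Units.val_one]
  have hfP : ∀ (g : iwahori p) h, (χ (lowerRetraction (g * lowerToIwahori p h)) :
      RingOfIntegersOf K) = χ (lowerRetraction g) * χ (lowerToTorus p h) := by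
    intro g h
    rw [lowerRetraction_mul, map_mul, Units.val_mul]
  have hS := exists_finite_generating lowerUnipotent'
    (lowerTorusDiag (p := p)) exists_eq_lowerUnipotent_mul_diag
  have hw : ∀ (m : ℕ) (s : ℤ_[p]ˣ), (s : ℤ_[p]) = 1 + p * m → ∃ h,
      lowerUnipotent (.ofAdd 1) * upperUnipotent (.ofAdd (m : ℤ_[p])) =
        upperUnipotent (.ofAdd (((s⁻¹ : ℤ_[p]ˣ) : ℤ_[p]) * (m : ℤ_[p]))) * lowerToIwahori p h ∧
      ((χ (lowerToTorus p h) : RingOfIntegersOf K) : K) = antidiagonalCharacter χ s := by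
    intro m s hs
    obtain ⟨h, hh, ht⟩ := lowerUnipotent_mul_upperUnipotent hs
    exact ⟨h, hh, by rw [ht]; rfl⟩
  exact isSimpleModule_induced p (lowerToIwahori p) (lowerToTorus p) χ hf hf1 hfP hS upperUnipotent
    exists_eq_upperUnipotent_mul _ lowerTorusDiag_mul_upperUnipotent _ _ hw
    fun ⟨r, k, hr, hk⟩ ↦ h k (exponent_eq_natCast hc hr hk)

theorem isSimpleModule_NMinusModule (χ : diagonalTorus p →ₜ* (RingOfIntegersOf K)ˣ) {c : K}
    (hc : IsCharacterExponent χ c) (h : ∀ n : ℕ, c ≠ -n) :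
    IsSimpleModule (IwasawaAlgebra K (iwahori p)) (NMinusModule χ) := by
  have : CompleteSpace K := FiniteDimensional.complete ℚ_[p] K
  have hf : Continuous fun g ↦ (χ (upperRetraction g) : RingOfIntegersOf K) :=
    Units.continuous_val.comp (χ.continuous_toFun.comp continuous_upperRetraction)
  have hf1 : (χ (upperRetraction (p := p) 1) : RingOfIntegersOf K) = 1 := by
    rw [upperRetraction_one, map_one, Units.val_one]
  have hfP : ∀ (g : iwahori p) h, (χ (upperRetraction (g * upperToIwahori p h)) :
      RingOfIntegersOf K) = χ (upperRetraction g) * χ (upperToTorus p h) := by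
    intro g h
    rw [upperRetraction_mul, map_mul, Units.val_mul]
  have hS := exists_finite_generating upperUnipotent'
    (upperTorusDiag (p := p)) exists_eq_upperUnipotent_mul_diag
  have hw : ∀ (m : ℕ) (s : ℤ_[p]ˣ), (s : ℤ_[p]) = 1 + p * m → ∃ h,
      upperUnipotent (.ofAdd 1) * lowerUnipotent (.ofAdd (m : ℤ_[p])) =
        lowerUnipotent (.ofAdd (((s⁻¹ : ℤ_[p]ˣ) : ℤ_[p]) * (m : ℤ_[p]))) * upperToIwahori p h ∧
      ((χ (upperToTorus p h) : RingOfIntegersOf K) : K) =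
        (antidiagonalCharacter χ).comp invMonoidHom s := by
    intro m s hs
    obtain ⟨h, hh, ht⟩ := upperUnipotent_mul_lowerUnipotent hs
    refine ⟨h, hh, ?_⟩
    rw [ht]
    change _ = ((χ (torusDiag ((s⁻¹)⁻¹, s⁻¹)) : RingOfIntegersOf K) : K)
    rw [inv_inv]
  -- The relevant character is the inverse of `a ↦ χ(diag(a⁻¹, a))`, so algebraicity of degree `k`
  -- means `c = -k`.
  have hexp : ∀ r k : ℕ, 0 < r → (∀ (a : ℤ_[p]ˣ) (m : ℕ),
      (a : ℤ_[p]) = ((1 + p * r * m : ℕ) : ℤ_[p]) →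
        (antidiagonalCharacter χ).comp invMonoidHom a = ((1 + p * r * m : ℕ) : K) ^ k) →
      c = -k := by
    intro r k hr hk
    refine exponent_eq_neg_natCast hc hr fun a m ham ↦ ?_
    rw [← hk a m ham]
    refine eq_inv_of_mul_eq_one_left ?_
    change antidiagonalCharacter χ a * antidiagonalCharacter χ a⁻¹ = 1
    rw [← map_mul, mul_inv_cancel, map_one]
  exact isSimpleModule_induced p (upperToIwahori p) (upperToTorus p) χ hf hf1 hfP hS lowerUnipotent
    exists_eq_lowerUnipotent_mul _ upperTorusDiag_mul_lowerUnipotent _ _ hw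
    fun ⟨r, k, hr, hk⟩ ↦ h k (hexp r k hr hk)

end Simplicity

end

/-- Let `K` be a finite extension of `ℚ_p` and `χ : T → oˣ` a continuous character. The invariant
`c(χ)` exists and is unique; if it is not in `ℕ₀` then `N_χ` is a simple `K[[B]]`-module, and if it
is not in `-ℕ₀` then `N_χ⁻` is a simple `K[[B]]`-module. -/
theorem proposition4p1 (p : ℕ) [Fact p.Prime] (K : Type*) [NormedField K] [IsUltrametricDist K]
    [NormedAlgebra ℚ_[p] K] [FiniteDimensional ℚ_[p] K]
    (χ : diagonalTorus p →ₜ* (RingOfIntegersOf K)ˣ) :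
    (∃! c : K, IsCharacterExponent χ c) ∧
    ∀ c : K, IsCharacterExponent χ c →
      ((∀ n : ℕ, c ≠ (n : K)) →
        IsSimpleModule (IwasawaAlgebra K (iwahori p)) (NModule χ)) ∧
      ((∀ n : ℕ, c ≠ -(n : K)) →
        IsSimpleModule (IwasawaAlgebra K (iwahori p)) (NMinusModule χ)) := by
  have : CompleteSpace K := FiniteDimensional.complete ℚ_[p] K
  exact ⟨existsUnique_isCharacterExponent χ, fun c hc ↦
    ⟨isSimpleModule_NModule χ hc, isSimpleModule_NMinusModule χ hc⟩⟩
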